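/- Conventions. A model category is complete and cocomplete. For a model category $M$ and a small category $D$, a projective model structure on $M^D$ is one whose weak equivalences and fibrations are objectwise; a projective-cofibration in $M^D$ is a map with the left lifting property against all objectwise acyclic fibrations, and it is acyclic if it is also an objectwise weak equivalence. Abstract bigluing data from a small category $C$ to a small category $D$ consists of functors $U:C^{op}\times D\to \mathrm{Set}$ and $W:D^{op}\times C\to\mathrm{Set}$ and maps $\alpha:U(c,d)\times W(d,c')\to C(c,c')$, natural in $c,c'$ and dinatural in $d$. Its collage is the category with objects $\mathrm{ob}\,C\sqcup\mathrm{ob}\,D$ and hom-sets $C(c,c')$, $U(c,d)$ from $c$ to $d$, $W(d,c)$ from $d$ to $c$, and $D(d,d')\sqcup\int^{c}W(d,c)\times U(c,d')$ from $d$ to $d'$, with the evident composition. Bistratified categories of height $\beta$ are defined by transfinite recursion: for height $0$, the empty category; for height $\beta+1$, up to isomorphism, the collages of abstract bigluing data from a bistratified category of height $\beta$ to a small category $D$, the objects of $D$ being given degree $\beta$ and $D$ being called the stratum $C_{=\beta}$ (a not necessarily full subcategory); for limit heights, the colimits of the resulting chains of full inclusions. Write $C_\delta$ for the full subcategory of objects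 of degree $<\delta$. For $A\in M^C$ ($M$ complete and cocomplete) let $M_\delta A$ and $L_\delta A$ be the right and left Kan extensions along $C_\delta\hookrightarrow C$ of $A|_{C_\delta}$; so $(M_\delta A)_x$ is the limit of $A|_{C_\delta}$ weighted by $C(x,-)$ and $(L_\delta A)_x$ is the colimit weighted by $C(-,x)$. There are canonical maps $L_\delta A\to A\to M_\delta A$. For $x$ of degree $\delta$ write $M_xA=(M_\delta A)_x$, $L_xA=(L_\delta A)_x$. Write $A_\delta=A|_{C_{=\delta}}$, and also $L_\delta A$ for its restriction to $C_{=\delta}$. For a class $R$ of right maps in $M$, call $A\to B$ in $M^C$ a c-Reedy $R$-map if $A_x\to M_xA\times_{M_xB}B_x$ is in $R$ for all $x\in C$, and a c-Reedy $L$-map if for all $\delta$ the map $L_\delta B\sqcup_{L_\delta A}A_\delta\to B_\delta$ in $M^{C_{=\delta}}$ has the left lifting property against all maps that are objectwise in $R$. A bistratified category $C$ is almost c-Reedy if for every object $x$, of degree $\beta$ say, (i) the map from $C(-,x)$, regarded as an object of $(\mathrm{Set}^{op})^{C_\beta}$, to the terminal object is a c-Reedy $R$-map, where $R$ consists of the opposites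 of injections, and (ii) $\emptyset\to C(x,-)$ is a c-Reedy $L$-map in $\mathrm{Set}^{C_\beta}$, where $R$ consists of the surjections. It is almost g-Reedy if moreover all strata $C_{=\delta}$ are groupoids. Theorem. Let $C$ be almost c-Reedy, and let $M$ be a model category such that each $M^{C_{=\delta}}$ has a projective model structure. Then $M^C$ has a model structure such that: - the weak equivalences are objectwise; - $A\to B$ is a fibration (resp. acyclic fibration) iff for all $x\in C$ the induced map $A_x\to M_xA\times_{M_xB}B_x$ is a fibration (resp. acyclic fibration) in $M$; - $A\to B$ is a cofibration (resp. acyclic cofibration) iff for all degrees $\delta$ the induced map $L_\delta B\sqcup_{L_\delta A}A_\delta\to B_\delta$ is a projective-cofibration (resp. acyclic projective-cofibration) in $M^{C_{=\delta}}$. If $C$ is almost g-Reedy, then moreover $A\to B$ is a cofibration (resp. acyclic cofibration) iff for all $x\in C$ the induced map $L_xB\sqcup_{L_xA}A_x\to B_x$ is a projective-cofibration (resp. acyclic projective-cofibration) in $M^{\mathrm{aut}(x)}$, where $\mathrm{aut}(x)$ is the automorphism group of $x$. -/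

import Mathlib

open CategoryTheory Limits Opposite HomotopicalAlgebra

universe v u w w'

/-- Abstract bigluing data from `C` to `D`: profunctors `U : D ⇸ C` and `W : C ⇸ D` together with
a map of profunctors `W ⊗_D U ⟶ C(-,-)`.  The latter is a family of maps
`U(c,d) × W(d,c') → C(c,c')`, natural in `c` and `c'` and balanced over `d`. -/
structure AbstractBigluingData (C D : Type v) [SmallCategory C] [SmallCategory D] where
  U : Cᵒᵖ ⥤ D ⥤ Type v
  W : Dᵒᵖ ⥤ C ⥤ Type v
  α {c : C} {d : D} {c' : C} :
    (U.obj (op c)).obj d → (W.obj (op d)).obj c' → (c ⟶ c')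
  α_left {c₁ c : C} {d : D} {c' : C} (f : c₁ ⟶ c)
    (a : (U.obj (op c)).obj d) (w : (W.obj (op d)).obj c') :
    α ((U.map f.op).app d a) w = f ≫ α a w
  α_right {c : C} {d : D} {c' c₁ : C} (a : (U.obj (op c)).obj d)
    (w : (W.obj (op d)).obj c') (g : c' ⟶ c₁) :
    α a ((W.obj (op d)).map g w) = α a w ≫ g
  α_middle {c : C} {d d' : D} {c' : C} (a : (U.obj (op c)).obj d) (h : d ⟶ d')
    (w : (W.obj (op d')).obj c') :
    α ((U.obj (op c)).map h a) w = α a ((W.map h.op).app c' w)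

namespace AbstractBigluingData

variable {C D : Type v} [SmallCategory C] [SmallCategory D] (P : AbstractBigluingData C D)

/-- The action of a morphism of `C` on `U(-,d)`. -/
def lc {c₁ c : C} {d : D} (f : c₁ ⟶ c) (a : (P.U.obj (op c)).obj d) :
    (P.U.obj (op c₁)).obj d := (P.U.map f.op).app d a

/-- The action of a morphism of `D` on `U(c,-)`. -/
def ld {c : C} {d d' : D} (a : (P.U.obj (op c)).obj d) (h : d ⟶ d') :
    (P.U.obj (op c)).obj d' := (P.U.obj (op c)).map h a

/-- The action of a morphism of `D` on `W(-,c)`. -/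
def wd {d₁ d : D} {c : C} (h : d₁ ⟶ d) (w : (P.W.obj (op d)).obj c) :
    (P.W.obj (op d₁)).obj c := (P.W.map h.op).app c w

/-- The action of a morphism of `C` on `W(d,-)`. -/
def wc {d : D} {c c' : C} (w : (P.W.obj (op d)).obj c) (f : c ⟶ c') :
    (P.W.obj (op d)).obj c' := (P.W.obj (op d)).map f w

@[simp] lemma lc_id {c : C} {d : D} (a : (P.U.obj (op c)).obj d) : P.lc (𝟙 c) a = a := by
  simp [lc]
@[simp] lemma lc_comp {c₂ c₁ c : C} {d : D} (f : c₂ ⟶ c₁) (g : c₁ ⟶ c)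
    (a : (P.U.obj (op c)).obj d) : P.lc (f ≫ g) a = P.lc f (P.lc g a) := by
  simp [lc]
@[simp] lemma ld_id {c : C} {d : D} (a : (P.U.obj (op c)).obj d) : P.ld a (𝟙 d) = a := by
  simp [ld]
@[simp] lemma ld_comp {c : C} {d d' d'' : D} (a : (P.U.obj (op c)).obj d) (h : d ⟶ d')
    (k : d' ⟶ d'') : P.ld a (h ≫ k) = P.ld (P.ld a h) k := by
  simp [ld]
@[simp] lemma ld_lc {c₁ c : C} {d d' : D} (f : c₁ ⟶ c) (a : (P.U.obj (op c)).obj d)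
    (h : d ⟶ d') : P.ld (P.lc f a) h = P.lc f (P.ld a h) := by
  simp [ld, lc]
@[simp] lemma wd_id {d : D} {c : C} (w : (P.W.obj (op d)).obj c) : P.wd (𝟙 d) w = w := by
  simp [wd]
@[simp] lemma wd_comp {d₂ d₁ d : D} {c : C} (h : d₂ ⟶ d₁) (k : d₁ ⟶ d)
    (w : (P.W.obj (op d)).obj c) : P.wd (h ≫ k) w = P.wd h (P.wd k w) := by
  simp [wd]
@[simp] lemma wc_id {d : D} {c : C} (w : (P.W.obj (op d)).obj c) : P.wc w (𝟙 c) = w := by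
  simp [wc]
@[simp] lemma wc_comp {d : D} {c c' c'' : C} (w : (P.W.obj (op d)).obj c) (f : c ⟶ c')
    (g : c' ⟶ c'') : P.wc w (f ≫ g) = P.wc (P.wc w f) g := by
  simp [wc]
@[simp] lemma wc_wd {d₁ d : D} {c c' : C} (h : d₁ ⟶ d) (w : (P.W.obj (op d)).obj c)
    (f : c ⟶ c') : P.wc (P.wd h w) f = P.wd h (P.wc w f) := by
  simp [wc, wd]
@[simp] lemma α_lc {c₁ c : C} {d : D} {c' : C} (f : c₁ ⟶ c) (a : (P.U.obj (op c)).obj d)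
    (w : (P.W.obj (op d)).obj c') : P.α (P.lc f a) w = f ≫ P.α a w := P.α_left f a w
@[simp] lemma α_wc {c : C} {d : D} {c' c₁ : C} (a : (P.U.obj (op c)).obj d)
    (w : (P.W.obj (op d)).obj c') (g : c' ⟶ c₁) : P.α a (P.wc w g) = P.α a w ≫ g :=
  P.α_right a w g
@[simp] lemma α_wd {c : C} {d d' : D} {c' : C} (a : (P.U.obj (op c)).obj d) (h : d ⟶ d')
    (w : (P.W.obj (op d')).obj c') : P.α a (P.wd h w) = P.α (P.ld a h) w :=
  (P.α_middle a h w).symm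

/-- The relation generating the equivalence relation that defines the coend
`(U ⊗_C W)(d,d')`. -/
inductive ThroughRel (d d' : D) :
    (Σ c : C, (P.W.obj (op d)).obj c × (P.U.obj (op c)).obj d') →
    (Σ c : C, (P.W.obj (op d)).obj c × (P.U.obj (op c)).obj d') → Prop
  | mk {c c' : C} (w : (P.W.obj (op d)).obj c) (k : c ⟶ c') (a : (P.U.obj (op c')).obj d') :
    ThroughRel d d' ⟨c', P.wc w k, a⟩ ⟨c, w, P.lc k a⟩

/-- The set `(U ⊗_C W)(d,d')`, the coend over `c` of `W(d,c) × U(c,d')`. -/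
def Through (d d' : D) : Type v := Quot (P.ThroughRel d d')

/-- The class of a pair `d → c → d'` in `(U ⊗_C W)(d,d')`. -/
def through {d d' : D} {c : C} (w : (P.W.obj (op d)).obj c) (a : (P.U.obj (op c)).obj d') :
    P.Through d d' := Quot.mk _ ⟨c, w, a⟩

lemma through_wc {d d' : D} {c c' : C} (w : (P.W.obj (op d)).obj c) (k : c ⟶ c')
    (a : (P.U.obj (op c')).obj d') : P.through (P.wc w k) a = P.through w (P.lc k a) :=
  Quot.sound ⟨w, k, a⟩

/-- The objects of the collage: the disjoint union of those of `C` and those of `D`. -/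
inductive Collage (P : AbstractBigluingData C D) : Type v
  | low (c : C) : Collage P
  | high (d : D) : Collage P

namespace Collage
variable {P}

/-- The hom-sets of the collage. -/
def Hom : P.Collage → P.Collage → Type v
  | low c, low c' => c ⟶ c'
  | low c, high d => (P.U.obj (op c)).obj d
  | high d, low c => (P.W.obj (op d)).obj c
  | high d, high d' => (d ⟶ d') ⊕ P.Through d d'

/-- Identities of the collage. -/
def id : (X : P.Collage) → Hom X X
  | low c => 𝟙 c
  | high d => Sum.inl (𝟙 d)

/-- Composition of the collage. -/
def comp : {X Y Z : P.Collage} → Hom X Y → Hom Y Z → Hom X Z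
  | low _, low _, low _, f, g => CategoryStruct.comp (obj := C) f g
  | low _, low _, high _, f, a => P.lc f a
  | low _, high _, low _, a, w => P.α a w
  | low _, high _, high _, a, Sum.inl h => P.ld a h
  | low _, high _, high _, a, Sum.inr q =>
      Quot.lift (fun t => P.lc (P.α a t.2.1) t.2.2) (by
        rintro _ _ ⟨w, k, b⟩
        exact (congrArg (fun f => P.lc f b) (P.α_wc a w k)).trans (P.lc_comp _ _ _)) q
  | high _, low _, low _, w, f => P.wc w f
  | high _, low _, high _, w, a => Sum.inr (P.through w a)
  | high _, high _, low _, Sum.inl h, w => P.wd h w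
  | high _, high _, low _, Sum.inr q, w =>
      Quot.lift (fun t => P.wc t.2.1 (P.α t.2.2 w)) (by
        rintro _ _ ⟨w', k, b⟩
        exact ((congrArg (P.wc w') (P.α_lc k b w)).trans (P.wc_comp _ _ _)).symm) q
  | high _, high _, high _, Sum.inl h, Sum.inl h' => Sum.inl (h ≫ h')
  | high _, high _, high _, Sum.inl h, Sum.inr q => Sum.inr
      (Quot.lift (fun t => P.through (P.wd h t.2.1) t.2.2)
        (by rintro _ _ ⟨w, k, b⟩; dsimp; rw [← wc_wd, through_wc]) q)
  | high _, high _, high _, Sum.inr q, Sum.inl h' => Sum.inr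
      (Quot.lift (fun t => P.through t.2.1 (P.ld t.2.2 h'))
        (by rintro _ _ ⟨w, k, b⟩; dsimp; rw [through_wc, ld_lc]) q)
  | high _, high _, high _, Sum.inr q, Sum.inr q' => Sum.inr
      (Quot.lift (fun t => Quot.lift (fun t' => P.through t.2.1 (P.lc (P.α t.2.2 t'.2.1) t'.2.2))
          (by rintro _ _ ⟨w, k, b⟩; simp) q')
        (by rintro _ _ ⟨w, k, b⟩; induction q' using Quot.ind
            dsimp; rw [through_wc]; simp) q)

@[elab_as_elim]
lemma through_ind {d d' : D} {m : P.Through d d' → Prop}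
    (h : ∀ {c : C} (w : (P.W.obj (op d)).obj c) (a : (P.U.obj (op c)).obj d'),
      m (P.through w a)) (q : P.Through d d') : m q := by
  rcases q with ⟨c, w, a⟩
  exact h w a

/-- The collage of abstract bigluing data. -/
instance : Category.{v} P.Collage where
  Hom := Hom
  id := id
  comp := comp
  id_comp {X Y} f := by
    rcases X with c | d <;> rcases Y with c' | d'
    · exact Category.id_comp (obj := C) f
    · exact P.lc_id f
    · exact P.wd_id f
    · rcases f with f | q
      · exact congrArg Sum.inl (Category.id_comp f)
      · induction q using through_ind with
        | h w a => exact congrArg (fun w => Sum.inr (P.through w a)) (P.wd_id w)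
  comp_id {X Y} f := by
    rcases X with c | d <;> rcases Y with c' | d'
    · exact Category.comp_id (obj := C) f
    · exact P.ld_id f
    · exact P.wc_id f
    · rcases f with f | q
      · exact congrArg Sum.inl (Category.comp_id f)
      · induction q using through_ind with
        | h w a => exact congrArg (fun a => Sum.inr (P.through w a)) (P.ld_id a)
  assoc {X Y Z T} f g h := by
    rcases X with x | x <;> rcases Y with y | y <;> rcases Z with z | z <;> rcases T with t | t
    · exact Category.assoc (obj := C) f g h
    · exact P.lc_comp f g h
    · exact P.α_lc f g h
    · rcases h with h | h
      · exact P.ld_lc f g h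
      · induction h using through_ind with
        | h w a => exact (congrArg (P.lc · a) (P.α_lc f g w)).trans (P.lc_comp _ _ _)
    · exact (P.α_wc f g h).symm
    · rfl
    · rcases g with g | g
      · exact (P.α_wd f g h).symm
      · induction g using through_ind with
        | h w a => exact (P.α_lc _ a h).trans (P.α_wc f w _).symm
    · rcases g with g | g <;> rcases h with h | h
      · exact (P.ld_comp f g h).symm
      · induction h using through_ind with
        | h w a => exact congrArg (P.lc · a) (P.α_wd f g w).symm
      · induction g using through_ind with
        | h w a => exact P.ld_lc _ a h
      · induction g using through_ind with
        | h w a => induction h using through_ind with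
          | h w' a' => exact (congrArg (P.lc · a') (P.α_lc _ a w')).trans (P.lc_comp _ _ _)
    · exact (P.wc_comp f g h).symm
    · exact congrArg Sum.inr (P.through_wc f g h)
    · rfl
    · rcases h with h | h
      · rfl
      · induction h using through_ind with
        | h w a => rfl
    · rcases f with f | f
      · exact P.wc_wd f g h
      · induction f using through_ind with
        | h w a => exact (P.wc_comp w _ h).symm.trans (congrArg (P.wc w) (P.α_wc a g h).symm)
    · rcases f with f | f
      · rfl
      · induction f using through_ind with
        | h w a => exact congrArg Sum.inr (P.through_wc w _ h)
    · rcases f with f | f <;> rcases g with g | g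
      · exact P.wd_comp f g h
      · induction g using through_ind with
        | h w a => exact P.wc_wd f w _
      · induction f using through_ind with
        | h w a => exact congrArg (P.wc w) (P.α_wd a g h).symm
      · induction f using through_ind with
        | h w a => induction g using through_ind with
          | h w' a' =>
            exact congrArg (P.wc w) ((P.α_lc _ a' h).trans (P.α_wc a w' _).symm)
    · rcases f with f | f <;> rcases g with g | g <;> rcases h with h | h
      · exact congrArg Sum.inl (Category.assoc f g h)
      · induction h using through_ind with
        | h w a => exact congrArg (fun w => Sum.inr (P.through w a)) (P.wd_comp f g w)
      · induction g using through_ind with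
        | h w a => rfl
      · induction g using through_ind with
        | h w a => induction h using through_ind with
          | h w' a' => rfl
      · induction f using through_ind with
        | h w a => exact congrArg (fun a => Sum.inr (P.through w a)) (P.ld_comp a g h).symm
      · induction f using through_ind with
        | h w a => induction h using through_ind with
          | h w' a' =>
            exact congrArg (fun k => Sum.inr (P.through w (P.lc k a'))) (P.α_wd a g w').symm
      · induction f using through_ind with
        | h w a => induction g using through_ind with
          | h w' a' => exact congrArg (fun a => Sum.inr (P.through w a)) (P.ld_lc _ a' h)
      · induction f using through_ind with
        | h w a => induction g using through_ind with
          | h w' a' => induction h using through_ind with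
            | h w'' a'' =>
              exact congrArg (fun a => Sum.inr (P.through w a))
                ((congrArg (P.lc · a'') (P.α_lc _ a' w'')).trans (P.lc_comp _ _ _))
end Collage
end AbstractBigluingData

/-- The projective `L`-maps in `M^D`, for a pre-wfs on `M` with class of right maps `R`: the maps
with the left lifting property with respect to the maps that are objectwise in `R`. -/
def projectiveL {M : Type u} [Category.{v} M] (R : MorphismProperty M)
    (D : Type w) [Category.{w'} D] : MorphismProperty (D ⥤ M) :=
  (R.functorCategory D).llp

/-- A degree function on the objects of `C`, together with a choice, for each ordinal `δ`, of a
subcategory (not necessarily full) whose objects are exactly those of degree `δ`.  These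
subcategories are encoded together by the class `inStratum` of all their morphisms. -/
structure Stratification (C : Type v) [SmallCategory C] where
  deg : C → Ordinal.{v}
  inStratum : MorphismProperty C
  deg_eq {x y : C} (f : x ⟶ y) (hf : inStratum f) : deg x = deg y
  isMultiplicative : inStratum.IsMultiplicative

namespace Stratification

attribute [instance] isMultiplicative

section

variable {C : Type v} [SmallCategory C] (S : Stratification C)

/-- The objects of degree `< δ`. -/
abbrev below (δ : Ordinal.{v}) : ObjectProperty C := fun x => S.deg x < δ

/-- `C_δ`, the full subcategory of objects of degree `< δ`. -/
abbrev Below (δ : Ordinal.{v}) : Type v := (S.below δ).FullSubcategory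

/-- The inclusion of `C_δ` in `C`. -/
abbrev belowι (δ : Ordinal.{v}) : S.Below δ ⥤ C := (S.below δ).ι

/-- The stratification of `C` restricted to `C_δ`. -/
def restrict (δ : Ordinal.{v}) : Stratification (S.Below δ) where
  deg x := S.deg x.obj
  inStratum := S.inStratum.inverseImage (S.belowι δ)
  deg_eq f hf := S.deg_eq ((S.belowι δ).map f) hf
  isMultiplicative := inferInstance

/-- The stratum `C_{=δ}`: the subcategory of objects of degree `δ` and morphisms in the stratum. -/
structure Stratum (δ : Ordinal.{v}) : Type v where
  obj : C
  deg_obj : S.deg obj = δ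

instance (δ : Ordinal.{v}) : Category.{v} (S.Stratum δ) where
  Hom x y := { f : x.obj ⟶ y.obj // S.inStratum f }
  id x := ⟨𝟙 x.obj, S.inStratum.id_mem x.obj⟩
  comp f g := ⟨f.1 ≫ g.1, S.inStratum.comp_mem _ _ f.2 g.2⟩

/-- The (non-full) inclusion of the stratum `C_{=δ}` in `C`. -/
def stratumι (δ : Ordinal.{v}) : S.Stratum δ ⥤ C where
  obj x := x.obj
  map f := f.1

end

/-- The stratification of a collage obtained from one of `C` by letting the objects of `D` have
degree `β` and letting `D` be the corresponding stratum. -/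
def collage {C D : Type v} [SmallCategory C] [SmallCategory D] (T : Stratification C)
    (β : Ordinal.{v}) (P : AbstractBigluingData C D) : Stratification P.Collage where
  deg
    | .low c => T.deg c
    | .high _ => β
  inStratum X Y f := match X, Y, f with
    | .low _, .low _, f => T.inStratum f
    | .high _, .high _, Sum.inl _ => True
    | _, _, _ => False
  deg_eq {X Y} f hf := by
    rcases X with c | d <;> rcases Y with c' | d'
    · exact T.deg_eq f hf
    · exact hf.elim
    · exact hf.elim
    · rfl
  isMultiplicative :=
    { id_mem X := by
        rcases X with c | d
        · exact T.inStratum.id_mem c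
        · trivial
      comp_mem {X Y Z} f g hf hg := by
        rcases X with x | x <;> rcases Y with y | y
        · rcases Z with z | z
          · exact T.inStratum.comp_mem _ _ hf hg
          · exact hg.elim
        · exact hf.elim
        · exact hf.elim
        · rcases Z with z | z
          · exact hg.elim
          · rcases f with f | f
            · rcases g with g | g
              · trivial
              · exact hg.elim
            · exact hf.elim }

/-- Bistratified categories of height `β`, by transfinite recursion.  Height `0`: the empty
category.  Height `β + 1`: up to isomorphism, the collages of abstract bigluing data from a
bistratified category of height `β` to an arbitrary small category `D`, which becomes the `β`-th
stratum.  Limit height `β`: the colimits of the cotowers of full inclusions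
`C_0 ⊆ C_1 ⊆ ⋯ ⊆ C_δ ⊆ ⋯` (`δ < β`) of bistratified categories `C_δ` of height `δ`, i.e. the
categories in which every object has some degree `< β` and whose full subcategory of objects of
degree `< δ` is bistratified of height `δ` for every `δ < β`. -/
inductive IsBistratifiedOfHeight :
    Ordinal.{v} → ∀ {C : Type v} [SmallCategory C], Stratification C → Prop
  | zero {C : Type v} [SmallCategory C] (S : Stratification C) (hC : IsEmpty C) :
      IsBistratifiedOfHeight 0 S
  | succ {β : Ordinal.{v}} {C D E : Type v} [SmallCategory C] [SmallCategory D] [SmallCategory E]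
      (T : Stratification C) (hT : IsBistratifiedOfHeight β T) (P : AbstractBigluingData C D)
      (S : Stratification E) (Φ : P.Collage ⥤ E) (full : Φ.Full) (faithful : Φ.Faithful)
      (bijective : Function.Bijective Φ.obj)
      (deg_eq : ∀ X, S.deg (Φ.obj X) = (T.collage β P).deg X)
      (inStratum_iff : ∀ {X Y : P.Collage} (f : X ⟶ Y),
        S.inStratum (Φ.map f) ↔ (T.collage β P).inStratum f) :
      IsBistratifiedOfHeight (β + 1) S
  | limit {β : Ordinal.{v}} (hβ : Order.IsSuccLimit β) {C : Type v} [SmallCategory C]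
      (S : Stratification C) (deg_lt : ∀ x, S.deg x < β)
      (hS : ∀ δ < β, IsBistratifiedOfHeight δ (S.restrict δ)) :
      IsBistratifiedOfHeight β S

section Reedy

variable {C : Type v} [SmallCategory C] (S : Stratification C)
  {M : Type u} [Category.{v} M]

/-- `C` is bistratified, with the given degrees and strata. -/
def IsBistratified : Prop := ∃ β : Ordinal.{v}, IsBistratifiedOfHeight β S

section Matching

variable [HasLimits M]

/-- The functor `A ↦ M_δ A`, defined on all of `C`: restrict `A` to `C_δ` and take the right Kan
extension along the inclusion of `C_δ` in `C`.  Its value at `x` is the limit of `A` over `C_δ`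
weighted by `C(x,-)`. -/
noncomputable def matching (δ : Ordinal.{v}) : (C ⥤ M) ⥤ (C ⥤ M) :=
  (Functor.whiskeringLeft _ _ M).obj (S.belowι δ) ⋙ (S.belowι δ).ran

/-- The canonical map `A ⟶ M_δ A`. -/
noncomputable def toMatching (δ : Ordinal.{v}) : 𝟭 (C ⥤ M) ⟶ S.matching δ :=
  ((S.belowι δ).ranAdjunction M).unit

/-- The relative matching map `A_x ⟶ M_x A ×_{M_x B} B_x` of `f : A ⟶ B`, where `M_x` is `M_δ`
evaluated at `x`, for `δ` the degree of `x`. -/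
noncomputable def matchingMap {A B : C ⥤ M} (f : A ⟶ B) (x : C) :
    A.obj x ⟶ pullback (((S.matching (S.deg x)).map f).app x)
      (((S.toMatching (S.deg x)).app B).app x) :=
  pullback.lift (((S.toMatching (S.deg x)).app A).app x) (f.app x)
    (by simpa using (congrArg (NatTrans.app · x) ((S.toMatching (S.deg x)).naturality f)).symm)

/-- The `R`-maps of the c-Reedy pre-wfs on `M^C` induced by a pre-wfs on `M` with class of
right maps `R`. -/
def cReedyR (R : MorphismProperty M) : MorphismProperty (C ⥤ M) :=
  fun _ _ f => ∀ x : C, R (S.matchingMap f x)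

end Matching

section Latching

variable [HasColimits M]

/-- The functor `A ↦ L_δ A`, defined on all of `C`: restrict `A` to `C_δ` and take the left Kan
extension along the inclusion of `C_δ` in `C`.  Its value at `x` is the colimit of `A` over `C_δ`
weighted by `C(-,x)`. -/
noncomputable def latching (δ : Ordinal.{v}) : (C ⥤ M) ⥤ (C ⥤ M) :=
  (Functor.whiskeringLeft _ _ M).obj (S.belowι δ) ⋙ (S.belowι δ).lan

/-- The canonical map `L_δ A ⟶ A`. -/
noncomputable def fromLatching (δ : Ordinal.{v}) : S.latching δ ⟶ 𝟭 (C ⥤ M) :=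
  ((S.belowι δ).lanAdjunction M).counit

/-- For `f : A ⟶ B` and a functor `K : D ⥤ C`, the relative latching map
`L_δ B ⊔_{L_δ A} A ⟶ B` of diagrams on `D`, all diagrams being restricted to `D` along `K`. -/
noncomputable def latchingMap (δ : Ordinal.{v}) {D : Type w} [Category.{w'} D] (K : D ⥤ C)
    {A B : C ⥤ M} (f : A ⟶ B) :
    pushout (Functor.whiskerLeft K ((S.latching δ).map f))
      (Functor.whiskerLeft K ((S.fromLatching δ).app A)) ⟶ K ⋙ B :=
  pushout.desc (Functor.whiskerLeft K ((S.fromLatching δ).app B)) (Functor.whiskerLeft K f)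
    (by
      rw [← Functor.whiskerLeft_comp, ← Functor.whiskerLeft_comp]
      exact congrArg (Functor.whiskerLeft K) ((S.fromLatching δ).naturality f))

/-- The relative latching map `L_δ B ⊔_{L_δ A} A_δ ⟶ B_δ` in `M^{C_{=δ}}`. -/
noncomputable abbrev stratumLatchingMap (δ : Ordinal.{v}) {A B : C ⥤ M} (f : A ⟶ B) :=
  S.latchingMap δ (S.stratumι δ) f

/-- The inclusion of the automorphism group of `x`, as a category with one object, in `C`. -/
def autι (x : C) : SingleObj (Aut x) ⥤ C := SingleObj.functor (Aut.toEnd x)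

/-- The relative latching map `L_x B ⊔_{L_x A} A_x ⟶ B_x` in `M^{aut(x)}`. -/
noncomputable abbrev autLatchingMap (x : C) {A B : C ⥤ M} (f : A ⟶ B) :=
  S.latchingMap (S.deg x) (autι x) f

/-- The `L`-maps of the c-Reedy pre-wfs on `M^C` induced by a pre-wfs on `M` with class of
right maps `R`. -/
def cReedyL (R : MorphismProperty M) : MorphismProperty (C ⥤ M) :=
  fun _ _ f => ∀ δ : Ordinal.{v}, projectiveL R (S.Stratum δ) (S.stratumLatchingMap δ f)

end Latching

/-- A bistratified category is almost c-Reedy if, for every object `x` of degree `β`, the functors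
`C(-,x)` and `C(x,-)` on `C_β` are `L`-objects, where `Set` has the wfs (injections, surjections):
* `C(-,x)` for the opposite of the c-Reedy wfs on `(Set^op)^{C_β}`, so that the map from `C(-,x)`
  to the terminal object of `(Set^op)^{C_β}` is an `R`-map; the right maps of `Set^op` are the
  opposites of the injections;
* `C(x,-)` for the c-Reedy wfs on `Set^{C_β}`. -/
structure IsAlmostCReedy : Prop where
  isBistratified : S.IsBistratified
  yoneda (x : C) :
    (S.restrict (S.deg x)).cReedyR (MorphismProperty.monomorphisms (Type v)).op
      (terminal.from ((S.belowι (S.deg x)).op ⋙ CategoryTheory.yoneda.obj x).rightOp)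
  coyoneda (x : C) :
    (S.restrict (S.deg x)).cReedyL (MorphismProperty.epimorphisms (Type v))
      (initial.to (S.belowι (S.deg x) ⋙ CategoryTheory.coyoneda.obj (op x)))

/-- An almost c-Reedy category is almost g-Reedy if all its strata are groupoids. -/
structure IsAlmostGReedy : Prop extends S.IsAlmostCReedy where
  isGroupoid (δ : Ordinal.{v}) : IsGroupoid (S.Stratum δ)

end Reedy

end Stratification

section Projective

variable (D : Type w) [Category.{w'} D] (M : Type u) [Category.{v} M] [ModelCategory M]

/-- `M^D` has a projective model structure: one whose weak equivalences and fibrations are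
objectwise. -/
def HasProjectiveModelStructure : Prop :=
  ∃ _ : ModelCategory (D ⥤ M),
    weakEquivalences (D ⥤ M) = (weakEquivalences M).functorCategory D ∧
    fibrations (D ⥤ M) = (fibrations M).functorCategory D

/-- The projective-cofibrations in `M^D`. -/
def projectiveCofibrations : MorphismProperty (D ⥤ M) := projectiveL (trivialFibrations M) D

/-- The acyclic projective-cofibrations in `M^D`. -/
def acyclicProjectiveCofibrations : MorphismProperty (D ⥤ M) :=
  projectiveCofibrations D M ⊓ (weakEquivalences M).functorCategory D

end Projective

/-!
c-Reedy `L`- and `R`-maps form a weak factorization system: lifts and factorizations are built by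
transfinite recursion on the degree. Extending them to degree `δ` over the stratum is a projective
lifting or factorization problem on the stratum between relative latching and relative matching
objects. The solution is automatically compatible with the remaining morphisms of degree `δ`, since
these factor through lower degrees, in an essentially unique way.

Powers and copowers by representables turn the almost c-Reedy condition into the statement that the
matching functors preserve c-Reedy (trivial) fibrations and the latching functors preserve c-Reedy
(trivial) cofibrations. So the two weak factorization systems obtained from the model structure of
`M` are compatible with the objectwise weak equivalences, by induction on the degree and
two-out-of-three. If the strata are groupoids, lifts on a stratum can be constructed one
automorphism group at a time.
-/

/-! ### Morphisms between objects of the same degree -/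

namespace Stratification

/-- The description of the hom-sets of a collage from the new stratum to itself, at all degrees: a
morphism between objects of the same degree either belongs to the stratum or factors through an
object of smaller degree, but not both, and any two such factorizations are connected by a zigzag.
The zigzag is encoded by the predicates `φ` on factorizations that are invariant under sliding a
morphism across the middle object. -/
structure HasThroughDecomposition {C : Type v} [SmallCategory C] (S : Stratification C) : Prop where
  exists_fac {x y : C} (f : x ⟶ y) (hxy : S.deg x = S.deg y) (hf : ¬ S.inStratum f) :
    ∃ (z : C) (g : x ⟶ z) (h : z ⟶ y), S.deg z < S.deg x ∧ g ≫ h = f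
  not_inStratum {x y z : C} (g : x ⟶ z) (h : z ⟶ y) (hz : S.deg z < S.deg x) :
    ¬ S.inStratum (g ≫ h)
  connected {x y : C} (hxy : S.deg x = S.deg y)
    (φ : ∀ z : C, S.deg z < S.deg x → (x ⟶ z) → (z ⟶ y) → Prop)
    (hφ : ∀ (z z' : C) (hz : S.deg z < S.deg x) (hz' : S.deg z' < S.deg x) (g : x ⟶ z)
      (k : z ⟶ z') (h : z' ⟶ y), φ z hz g (k ≫ h) ↔ φ z' hz' (g ≫ k) h)
    {z z' : C} (hz : S.deg z < S.deg x) (hz' : S.deg z' < S.deg x)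
    (g : x ⟶ z) (h : z ⟶ y) (g' : x ⟶ z') (h' : z' ⟶ y) (e : g ≫ h = g' ≫ h') :
    φ z hz g h → φ z' hz' g' h'

namespace HasThroughDecomposition

lemma of_isomorphism {C E : Type v} [SmallCategory C] [SmallCategory E] {T : Stratification C}
    (hT : T.HasThroughDecomposition) {S : Stratification E} (Φ : C ⥤ E) [Φ.Full] [Φ.Faithful]
    (surj : Function.Surjective Φ.obj) (deg_eq : ∀ X, S.deg (Φ.obj X) = T.deg X)
    (inStratum_iff : ∀ {X Y : C} (f : X ⟶ Y), S.inStratum (Φ.map f) ↔ T.inStratum f) :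
    S.HasThroughDecomposition where
  exists_fac {x y} f hxy hf := by
    obtain ⟨X, rfl⟩ := surj x
    obtain ⟨Y, rfl⟩ := surj y
    obtain ⟨f, rfl⟩ := Φ.map_surjective f
    rw [inStratum_iff] at hf
    obtain ⟨z, g, h, hz, rfl⟩ := hT.exists_fac f (by rwa [deg_eq, deg_eq] at hxy) hf
    exact ⟨Φ.obj z, Φ.map g, Φ.map h, by rwa [deg_eq, deg_eq], by simp⟩
  not_inStratum {x y z} g h hz := by
    obtain ⟨X, rfl⟩ := surj x
    obtain ⟨Y, rfl⟩ := surj y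
    obtain ⟨Z, rfl⟩ := surj z
    obtain ⟨g, rfl⟩ := Φ.map_surjective g
    obtain ⟨h, rfl⟩ := Φ.map_surjective h
    rw [← Φ.map_comp, inStratum_iff]
    exact hT.not_inStratum g h (by rwa [deg_eq, deg_eq] at hz)
  connected {x y} hxy φ hφ z z' hz hz' g h g' h' e := by
    obtain ⟨X, rfl⟩ := surj x
    obtain ⟨Y, rfl⟩ := surj y
    obtain ⟨Z, rfl⟩ := surj z
    obtain ⟨Z', rfl⟩ := surj z'
    obtain ⟨g, rfl⟩ := Φ.map_surjective g
    obtain ⟨h, rfl⟩ := Φ.map_surjective h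
    obtain ⟨g', rfl⟩ := Φ.map_surjective g'
    obtain ⟨h', rfl⟩ := Φ.map_surjective h'
    refine hT.connected (by rwa [deg_eq, deg_eq] at hxy)
      (fun z hz g h => φ (Φ.obj z) (by rwa [deg_eq, deg_eq]) (Φ.map g) (Φ.map h)) ?_
      (by rwa [deg_eq, deg_eq] at hz) (by rwa [deg_eq, deg_eq] at hz') g h g' h'
      (Φ.map_injective (by simpa using e))
    intro z z' hz hz' g k h
    simpa using hφ (Φ.obj z) (Φ.obj z') (by rwa [deg_eq, deg_eq]) (by rwa [deg_eq, deg_eq])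
      (Φ.map g) (Φ.map k) (Φ.map h)

lemma not_collage_deg_high_lt {C D : Type v} [SmallCategory C] [SmallCategory D]
    {T : Stratification C} {β : Ordinal.{v}} (hβ : ∀ x, T.deg x < β) {P : AbstractBigluingData C D}
    {x : P.Collage} {z : D} : ¬ (T.collage β P).deg (.high z) < (T.collage β P).deg x := by
  rcases x with x | _
  · exact (hβ x).not_gt
  · exact lt_irrefl _

lemma collage {C D : Type v} [SmallCategory C] [SmallCategory D] {T : Stratification C}
    (hT : T.HasThroughDecomposition) {β : Ordinal.{v}} (hβ : ∀ x, T.deg x < β)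
    (P : AbstractBigluingData C D) : (T.collage β P).HasThroughDecomposition where
  exists_fac {x y} f hxy hf := by
    rcases x with x | x <;> rcases y with y | y
    · obtain ⟨z, g, h, hz, e⟩ := hT.exists_fac f hxy hf
      exact ⟨.low z, g, h, hz, e⟩
    · exact ((hβ x).ne hxy).elim
    · exact ((hβ y).ne hxy.symm).elim
    · rcases f with f | f
      · exact (hf trivial).elim
      · induction f using AbstractBigluingData.Collage.through_ind with
        | @h c w a => exact ⟨.low c, w, a, hβ c, rfl⟩
  not_inStratum {x y z} g h hz := by
    intro H
    rcases z with z | z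
    · rcases x with x | x <;> rcases y with y | y
      · exact hT.not_inStratum (x := x) (y := y) (z := z) g h hz H
      · exact H
      · exact H
      · exact H
    · exact not_collage_deg_high_lt hβ hz
  connected {x y} hxy φ hφ z z' hz hz' g h g' h' e := by
    rcases z with z | z
    swap
    · exact (not_collage_deg_high_lt hβ hz).elim
    rcases z' with z' | z'
    swap
    · exact (not_collage_deg_high_lt hβ hz').elim
    rcases x with x | x <;> rcases y with y | y
    · exact hT.connected (x := x) (y := y) hxy (fun z hz g h => φ (.low z) hz g h)
        (fun z z' hz hz' g k h => hφ (.low z) (.low z') hz hz' g k h) hz hz' g h g' h' e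
    · exact ((hβ x).ne hxy).elim
    · exact ((hβ y).ne hxy.symm).elim
    · have e' : P.through (d := x) (d' := y) g h = P.through g' h' := Sum.inr_injective e
      let ψ : P.Through x y → Prop := Quot.lift
        (fun t => φ (.low t.1) (hβ t.1) t.2.1 t.2.2) (by
          rintro _ _ ⟨w, k, a⟩
          exact propext (hφ (.low _) (.low _) (hβ _) (hβ _) w k a).symm)
      exact (congrArg ψ e').mp

lemma restrict {C : Type v} [SmallCategory C] {S : Stratification C}
    (hS : S.HasThroughDecomposition) (δ : Ordinal.{v}) :
    (S.restrict δ).HasThroughDecomposition where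
  exists_fac {x y} f hxy hf := by
    obtain ⟨z, g, h, hz, e⟩ := hS.exists_fac f.hom hxy hf
    exact ⟨⟨z, hz.trans x.property⟩, ⟨g⟩, ⟨h⟩, hz, InducedCategory.hom_ext e⟩
  not_inStratum {x y z} g h hz := hS.not_inStratum g.hom h.hom hz
  connected {x y} hxy φ hφ z z' hz hz' g h g' h' e :=
    hS.connected hxy
      (fun z hz g h => φ ⟨z, hz.trans x.property⟩ hz ⟨g⟩ ⟨h⟩)
      (fun z z' hz hz' g k h => hφ ⟨z, hz.trans x.property⟩ ⟨z', hz'.trans x.property⟩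
        hz hz' ⟨g⟩ ⟨k⟩ ⟨h⟩) hz hz' g.hom h.hom g'.hom h'.hom
      (congrArg InducedCategory.Hom.hom e)

lemma of_restrict {C : Type v} [SmallCategory C] {S : Stratification C}
    (hS : ∀ x : C, ∃ δ, S.deg x < δ ∧ (S.restrict δ).HasThroughDecomposition) :
    S.HasThroughDecomposition where
  exists_fac {x y} f hxy hf := by
    obtain ⟨δ, hδ, H⟩ := hS x
    obtain ⟨z, g, h, hz, e⟩ :=
      H.exists_fac (x := ⟨x, hδ⟩) (y := ⟨y, hxy.symm.trans_lt hδ⟩) ⟨f⟩ hxy hf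
    exact ⟨z.obj, g.hom, h.hom, hz, congrArg InducedCategory.Hom.hom e⟩
  not_inStratum {x y z} g h hz := by
    intro hgh
    obtain ⟨δ, hδ, H⟩ := hS x
    exact H.not_inStratum (x := ⟨x, hδ⟩) (y := ⟨y, (S.deg_eq _ hgh).symm.trans_lt hδ⟩)
      (z := ⟨z, hz.trans hδ⟩) ⟨g⟩ ⟨h⟩ hz hgh
  connected {x y} hxy φ hφ z z' hz hz' g h g' h' e := by
    obtain ⟨δ, hδ, H⟩ := hS x
    exact H.connected (x := ⟨x, hδ⟩) (y := ⟨y, hxy.symm.trans_lt hδ⟩) hxy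
      (fun z hz g h => φ z.obj hz g.hom h.hom)
      (fun z z' hz hz' g k h => hφ z.obj z'.obj hz hz' g.hom k.hom h.hom)
      (z := ⟨z, hz.trans hδ⟩) (z' := ⟨z', hz'.trans hδ⟩) hz hz' ⟨g⟩ ⟨h⟩ ⟨g'⟩ ⟨h'⟩
      (InducedCategory.hom_ext e)

end HasThroughDecomposition

lemma IsBistratifiedOfHeight.deg_lt_and_hasThroughDecomposition {β : Ordinal.{v}} {C : Type v}
    [SmallCategory C] {S : Stratification C} (h : IsBistratifiedOfHeight β S) :
    (∀ x, S.deg x < β) ∧ S.HasThroughDecomposition := by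
  induction h with
  | zero S hC =>
    exact ⟨fun x => hC.elim x, ⟨fun {x} => hC.elim x, fun {x} => hC.elim x, fun {x} => hC.elim x⟩⟩
  | @succ β C D E _ _ _ T _ P S Φ full faithful bijective deg_eq inStratum_iff ih =>
    refine ⟨fun x => ?_, (ih.2.collage ih.1 P).of_isomorphism Φ bijective.2 deg_eq inStratum_iff⟩
    obtain ⟨X, rfl⟩ := bijective.2 x
    rw [deg_eq]
    rcases X with c | _
    · exact (ih.1 c).trans (lt_add_one β)
    · exact lt_add_one β
  | @limit β hβ C _ S deg_lt _ ih =>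
    refine ⟨deg_lt, .of_restrict fun x => ⟨Order.succ (S.deg x), Order.lt_succ _, ?_⟩⟩
    exact (ih _ (hβ.succ_lt (deg_lt x))).2

lemma IsBistratified.hasThroughDecomposition {C : Type v} [SmallCategory C] {S : Stratification C}
    (h : S.IsBistratified) : S.HasThroughDecomposition :=
  h.choose_spec.deg_lt_and_hasThroughDecomposition.2

end Stratification

/-! ### Kan extensions as weighted limits and colimits -/

namespace KanExtension

variable {C : Type v} [SmallCategory C] {D : Type w} [Category.{v} D] (ι : D ⥤ C)
  {M : Type u} [Category.{v} M]

section Ran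

variable [∀ x, HasLimitsOfShape (StructuredArrow x ι) M]

/-- The projection of a right Kan extension along `ι`, viewed as a weighted limit, indexed by
`g : x ⟶ ι z`. -/
noncomputable def ranπ (E : D ⥤ M) {x : C} {z : D} (g : x ⟶ ι.obj z) :
    (ι.ran.obj E).obj x ⟶ E.obj z :=
  (ι.ran.obj E).map g ≫ (ι.ranCounit.app E).app z

variable {ι}

lemma ran_map_ranπ (E : D ⥤ M) {x y : C} (u : x ⟶ y) {z : D} (g : y ⟶ ι.obj z) :
    (ι.ran.obj E).map u ≫ ranπ ι E g = ranπ ι E (u ≫ g) := by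
  simp [ranπ]

lemma ranπ_map (E : D ⥤ M) {x : C} {z z' : D} (g : x ⟶ ι.obj z) (k : z ⟶ z') :
    ranπ ι E g ≫ E.map k = ranπ ι E (g ≫ ι.map k) := by
  have := (ι.ranCounit.app E).naturality k
  simp_all [ranπ]

lemma ran_map_app_ranπ {E E' : D ⥤ M} (φ : E ⟶ E') {x : C} {z : D} (g : x ⟶ ι.obj z) :
    (ι.ran.map φ).app x ≫ ranπ ι E' g = ranπ ι E g ≫ φ.app z := by
  have := congr_app (ι.ranCounit.naturality φ) z
  dsimp at this
  simp [ranπ, ← this]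

lemma ranAdjunction_unit_ranπ (A : C ⥤ M) {x : C} {z : D} (g : x ⟶ ι.obj z) :
    ((ι.ranAdjunction M).unit.app A).app x ≫ ranπ ι (ι ⋙ A) g = A.map g := by
  have unit_counit := ι.ranCounit_app_app_ranAdjunction_unit_app_app A z
  have naturality := ((ι.ranAdjunction M).unit.app A).naturality g
  dsimp at unit_counit naturality
  dsimp [ranπ]
  rw [← reassoc_of% naturality]
  erw [unit_counit, Category.comp_id]

lemma ran_hom_ext (E : D ⥤ M) {x : C} {T : M} {l l' : T ⟶ (ι.ran.obj E).obj x}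
    (h : ∀ (z : D) (g : x ⟶ ι.obj z), l ≫ ranπ ι E g = l' ≫ ranπ ι E g) : l = l' :=
  (ι.isPointwiseRightKanExtensionRanCounit E x).hom_ext fun j => h j.right j.hom

lemma exists_ran_lift (E : D ⥤ M) {x : C} {T : M} (m : ∀ (z : D), (x ⟶ ι.obj z) → (T ⟶ E.obj z))
    (hm : ∀ (z z' : D) (g : x ⟶ ι.obj z) (k : z ⟶ z'), m z g ≫ E.map k = m z' (g ≫ ι.map k)) :
    ∃ l : T ⟶ (ι.ran.obj E).obj x, ∀ z g, l ≫ ranπ ι E g = m z g := by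
  let c : Cone (StructuredArrow.proj x ι ⋙ E) :=
    { pt := T
      π :=
        { app j := m j.right j.hom
          naturality j j' f := by
            have := hm j.right j'.right j.hom f.right
            rw [StructuredArrow.w] at this
            exact (Category.id_comp _).trans this.symm } }
  exact ⟨(ι.isPointwiseRightKanExtensionRanCounit E x).lift c, fun z g =>
    (ι.isPointwiseRightKanExtensionRanCounit E x).fac c (StructuredArrow.mk g)⟩

end Ran

section Lan

variable [∀ x, HasColimitsOfShape (CostructuredArrow ι x) M]

/-- The inclusion in a left Kan extension along `ι`, viewed as a weighted colimit, indexed by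
`h : ι z ⟶ x`. -/
noncomputable def lanι (E : D ⥤ M) {x : C} {z : D} (h : ι.obj z ⟶ x) :
    E.obj z ⟶ (ι.lan.obj E).obj x :=
  (ι.lanUnit.app E).app z ≫ (ι.lan.obj E).map h

variable {ι}

lemma lanι_lan_map (E : D ⥤ M) {x y : C} (u : x ⟶ y) {z : D} (h : ι.obj z ⟶ x) :
    lanι ι E h ≫ (ι.lan.obj E).map u = lanι ι E (h ≫ u) := by
  simp [lanι]

lemma map_lanι (E : D ⥤ M) {x : C} {z z' : D} (k : z ⟶ z') (h : ι.obj z' ⟶ x) :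
    E.map k ≫ lanι ι E h = lanι ι E (ι.map k ≫ h) := by
  have := (ι.lanUnit.app E).naturality k
  dsimp at this
  simp [lanι, reassoc_of% this]

lemma lanι_lan_map_app {E E' : D ⥤ M} (φ : E ⟶ E') {x : C} {z : D} (h : ι.obj z ⟶ x) :
    lanι ι E h ≫ (ι.lan.map φ).app x = φ.app z ≫ lanι ι E' h := by
  have := congr_app (ι.lanUnit.naturality φ) z
  dsimp at this
  simp [lanι, reassoc_of% this]

lemma lanι_lanAdjunction_counit (A : C ⥤ M) {x : C} {z : D} (h : ι.obj z ⟶ x) :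
    lanι ι (ι ⋙ A) h ≫ ((ι.lanAdjunction M).counit.app A).app x = A.map h := by
  have unit_counit := ι.lanUnit_app_app_lanAdjunction_counit_app_app A z
  have naturality := ((ι.lanAdjunction M).counit.app A).naturality h
  dsimp at unit_counit naturality
  dsimp [lanι]
  rw [Category.assoc, naturality]
  erw [reassoc_of% unit_counit]

lemma lan_hom_ext (E : D ⥤ M) {x : C} {T : M} {l l' : (ι.lan.obj E).obj x ⟶ T}
    (h : ∀ (z : D) (g : ι.obj z ⟶ x), lanι ι E g ≫ l = lanι ι E g ≫ l') : l = l' :=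
  (ι.isPointwiseLeftKanExtensionLeftKanExtensionUnit E x).hom_ext fun j => h j.left j.hom

lemma exists_lan_desc (E : D ⥤ M) {x : C} {T : M} (m : ∀ (z : D), (ι.obj z ⟶ x) → (E.obj z ⟶ T))
    (hm : ∀ (z z' : D) (k : z ⟶ z') (h : ι.obj z' ⟶ x), E.map k ≫ m z' h = m z (ι.map k ≫ h)) :
    ∃ l : (ι.lan.obj E).obj x ⟶ T, ∀ z h, lanι ι E h ≫ l = m z h := by
  let c : Cocone (CostructuredArrow.proj ι x ⋙ E) :=
    { pt := T
      ι :=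
        { app j := m j.left j.hom
          naturality j j' f := by
            have := hm j.left j'.left f.left j'.hom
            rw [CostructuredArrow.w] at this
            exact this.trans (Category.comp_id _).symm } }
  exact ⟨(ι.isPointwiseLeftKanExtensionLeftKanExtensionUnit E x).desc c, fun z h =>
    (ι.isPointwiseLeftKanExtensionLeftKanExtensionUnit E x).fac c (CostructuredArrow.mk h)⟩

end Lan

end KanExtension

/-! ### Relative matching and latching objects -/

section Cones

variable {C : Type v} [SmallCategory C] {P : ObjectProperty C} {M : Type u} [Category.{v} M]

/-- A cone with vertex `T` over the diagram whose limit is the relative matching object at `x` of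
`p : E ⟶ B|_P`. -/
@[ext]
structure MatchingCone {E : P.FullSubcategory ⥤ M} {B : C ⥤ M} (p : E ⟶ P.ι ⋙ B)
    (x : C) (T : M) where
  base : T ⟶ B.obj x
  proj (z : P.FullSubcategory) (g : x ⟶ z.obj) : T ⟶ E.obj z
  proj_map {z z' : P.FullSubcategory} (g : x ⟶ z.obj) (k : z ⟶ z') :
    proj z g ≫ E.map k = proj z' (g ≫ k.hom)
  proj_app (z : P.FullSubcategory) (g : x ⟶ z.obj) : proj z g ≫ p.app z = base ≫ B.map g

namespace MatchingCone

variable {E E' : P.FullSubcategory ⥤ M} {B B' : C ⥤ M} {p : E ⟶ P.ι ⋙ B}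
  {p' : E' ⟶ P.ι ⋙ B'} {x y : C} {T Q : M}

/-- Precomposition of a matching cone with a morphism to its vertex. -/
@[simps]
def precomp (c : MatchingCone p x T) {T' : M} (l : T' ⟶ T) : MatchingCone p x T' where
  base := l ≫ c.base
  proj z g := l ≫ c.proj z g
  proj_map g k := by rw [Category.assoc, c.proj_map]
  proj_app z g := by rw [Category.assoc, Category.assoc, c.proj_app]

lemma precomp_comp (c : MatchingCone p x T) {T' T'' : M} (l : T' ⟶ T) (l' : T'' ⟶ T') :
    c.precomp (l' ≫ l) = (c.precomp l).precomp l' := by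
  ext <;> simp

/-- The functoriality of matching cones in the object at which they are taken. -/
@[simps]
def along (c : MatchingCone p x T) (k : x ⟶ y) : MatchingCone p y T where
  base := c.base ≫ B.map k
  proj z g := c.proj z (k ≫ g)
  proj_map g l := by rw [c.proj_map, Category.assoc]
  proj_app z g := by rw [c.proj_app, Category.assoc, B.map_comp]

lemma precomp_along (c : MatchingCone p x T) {T' : M} (l : T' ⟶ T) (k : x ⟶ y) :
    (c.precomp l).along k = (c.along k).precomp l := by
  ext <;> simp

/-- The functoriality of matching cones in the morphism of diagrams. -/
@[simps]
def postcomp (c : MatchingCone p x T) (a : E ⟶ E') (b : B ⟶ B')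
    (w : a ≫ p' = p ≫ Functor.whiskerLeft P.ι b) : MatchingCone p' x T where
  base := c.base ≫ b.app x
  proj z g := c.proj z g ≫ a.app z
  proj_map g k := by rw [Category.assoc, ← a.naturality, ← Category.assoc, c.proj_map]
  proj_app z g := by
    have := congr_app w z
    dsimp at this
    rw [Category.assoc, this, ← Category.assoc, c.proj_app, Category.assoc, Category.assoc,
      b.naturality]

lemma precomp_postcomp (c : MatchingCone p x T) {T' : M} (l : T' ⟶ T) (a : E ⟶ E') (b : B ⟶ B')
    (w : a ≫ p' = p ≫ Functor.whiskerLeft P.ι b) :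
    (c.precomp l).postcomp a b w = (c.postcomp a b w).precomp l := by
  ext <;> simp

lemma postcomp_postcomp_eq_self {c : MatchingCone p x T} {a : E ⟶ E'} {b : B ⟶ B'} {a' : E' ⟶ E}
    {b' : B' ⟶ B} (w : a ≫ p' = p ≫ Functor.whiskerLeft P.ι b)
    (w' : a' ≫ p = p' ≫ Functor.whiskerLeft P.ι b') (ha : a ≫ a' = 𝟙 E) (hb : b ≫ b' = 𝟙 B) :
    (c.postcomp a b w).postcomp a' b' w' = c := by
  ext z g
  · simp [← NatTrans.comp_app, hb]
  · simp [← NatTrans.comp_app, ha]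

/-- A matching cone is universal if it is a relative matching object. -/
def IsUniversal (c : MatchingCone p x Q) : Prop :=
  ∀ ⦃T : M⦄ (c' : MatchingCone p x T), ∃! l : T ⟶ Q, c.precomp l = c'

lemma IsUniversal.hom_ext {c : MatchingCone p x Q} (hc : c.IsUniversal) {l l' : T ⟶ Q}
    (h : c.precomp l = c.precomp l') : l = l' :=
  (hc _).unique h rfl

/-- The lifting problems against the map from `T` to the relative matching object, in terms of the
matching cone with vertex `T`. -/
def Lifts (c : MatchingCone p x T) {K L : M} (i : K ⟶ L) : Prop :=
  ∀ (t : K ⟶ T) (c' : MatchingCone p x L), c.precomp t = c'.precomp i →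
    ∃ l : L ⟶ T, i ≫ l = t ∧ c.precomp l = c'

/-- The map from `T` to the relative matching object is in the class `R`, assuming that
`R.llp.rlp = R`, in terms of the matching cone with vertex `T`. -/
def IsRight (c : MatchingCone p x T) (R : MorphismProperty M) : Prop :=
  ∀ ⦃K L : M⦄ (i : K ⟶ L), R.llp i → c.Lifts i

section

variable {cQ : MatchingCone p x Q} {c : MatchingCone p x T} {φ : T ⟶ Q}

lemma IsUniversal.hasLiftingProperty_iff (hQ : cQ.IsUniversal) (hφ : cQ.precomp φ = c) {K L : M}
    (i : K ⟶ L) : HasLiftingProperty i φ ↔ c.Lifts i := by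
  constructor
  · intro H t c' hc'
    obtain ⟨q, rfl, -⟩ := hQ c'
    have sq : CommSq t i φ q :=
      ⟨hQ.hom_ext (by rw [precomp_comp, precomp_comp, hφ, hc'])⟩
    exact ⟨sq.lift, sq.fac_left, by rw [← hφ, ← precomp_comp, sq.fac_right]⟩
  · intro H
    refine ⟨fun {t q} sq => ?_⟩
    obtain ⟨l, hl, hl'⟩ := H t (cQ.precomp q) (by
      rw [← hφ, ← precomp_comp, ← precomp_comp, sq.w])
    exact ⟨⟨⟨l, hl, hQ.hom_ext (by rw [precomp_comp, hφ, hl'])⟩⟩⟩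

lemma IsUniversal.isRight_iff (hQ : cQ.IsUniversal) (hφ : cQ.precomp φ = c)
    {R : MorphismProperty M} (hR : R.llp.rlp = R) : c.IsRight R ↔ R φ := by
  conv_rhs => rw [← hR]
  exact forall₃_congr fun _ _ i => imp_congr_right fun _ => (hQ.hasLiftingProperty_iff hφ i).symm

end

section OfSq

variable [HasLimits M]

/-- The matching cone determined by a commutative square over the matching objects. -/
noncomputable def ofSq (p : E ⟶ P.ι ⋙ B) {fst : Q ⟶ (P.ι.ran.obj E).obj x} {snd : Q ⟶ B.obj x}
    (h : CommSq fst snd ((P.ι.ran.map p).app x) (((P.ι.ranAdjunction M).unit.app B).app x)) :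
    MatchingCone p x Q where
  base := snd
  proj z g := fst ≫ KanExtension.ranπ P.ι E g
  proj_map g k := by rw [Category.assoc, KanExtension.ranπ_map]; rfl
  proj_app z g := by
    rw [Category.assoc, ← KanExtension.ran_map_app_ranπ, reassoc_of% h.w]
    exact congrArg _ (KanExtension.ranAdjunction_unit_ranπ (ι := P.ι) B (z := z) g)

lemma isUniversal_ofSq {fst : Q ⟶ (P.ι.ran.obj E).obj x} {snd : Q ⟶ B.obj x}
    (h : IsPullback fst snd ((P.ι.ran.map p).app x) (((P.ι.ranAdjunction M).unit.app B).app x)) :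
    (ofSq p h.toCommSq).IsUniversal := by
  intro T c
  obtain ⟨m, hm⟩ := KanExtension.exists_ran_lift (ι := P.ι) E c.proj
    fun _ _ g k => c.proj_map g k
  have w : m ≫ (P.ι.ran.map p).app x = c.base ≫ ((P.ι.ranAdjunction M).unit.app B).app x := by
    refine KanExtension.ran_hom_ext _ fun z g => ?_
    rw [Category.assoc, KanExtension.ran_map_app_ranπ, reassoc_of% hm, c.proj_app, Category.assoc]
    exact congrArg _ (KanExtension.ranAdjunction_unit_ranπ (ι := P.ι) B (z := z) g).symm
  refine ⟨h.lift m c.base w, ?_, fun l hl => h.hom_ext ?_ ?_⟩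
  · ext z g
    · exact h.lift_snd _ _ _
    · simp [ofSq, ← hm]
  · refine KanExtension.ran_hom_ext _ fun z g => ?_
    simp [hm, ← hl, ofSq]
  · simp [← hl, ofSq]

end OfSq

end MatchingCone

/-- A cocone with vertex `X` over the diagram whose colimit is the relative latching object, as a
diagram on `D` via `K`, of `i : A|_P ⟶ E`. -/
@[ext]
structure LatchingCocone {E : P.FullSubcategory ⥤ M} {A : C ⥤ M} (i : P.ι ⋙ A ⟶ E)
    {D : Type w} [Category.{w'} D] (K : D ⥤ C) (X : D ⥤ M) where
  base : K ⋙ A ⟶ X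
  incl (z : P.FullSubcategory) (d : D) (h : z.obj ⟶ K.obj d) : E.obj z ⟶ X.obj d
  map_incl {z z' : P.FullSubcategory} (k : z ⟶ z') {d : D} (h : z'.obj ⟶ K.obj d) :
    E.map k ≫ incl z' d h = incl z d (k.hom ≫ h)
  incl_map (z : P.FullSubcategory) {d d' : D} (h : z.obj ⟶ K.obj d) (e : d ⟶ d') :
    incl z d h ≫ X.map e = incl z d' (h ≫ K.map e)
  app_incl (z : P.FullSubcategory) {d : D} (h : z.obj ⟶ K.obj d) :
    i.app z ≫ incl z d h = A.map h ≫ base.app d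

namespace LatchingCocone

variable {E E' : P.FullSubcategory ⥤ M} {A A' : C ⥤ M} {i : P.ι ⋙ A ⟶ E}
  {i' : P.ι ⋙ A' ⟶ E'} {D : Type w} [Category.{w'} D] {K : D ⥤ C}
  {X Q : D ⥤ M}

/-- Postcomposition of a latching cocone with a morphism from its vertex. -/
@[simps]
def postcomp (c : LatchingCocone i K X) {X' : D ⥤ M} (l : X ⟶ X') : LatchingCocone i K X' where
  base := c.base ≫ l
  incl z d h := c.incl z d h ≫ l.app d
  map_incl k d h := by rw [← Category.assoc, c.map_incl]
  incl_map z d d' h e := by rw [Category.assoc, ← l.naturality, ← Category.assoc, c.incl_map]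
  app_incl z d h := by rw [← Category.assoc, c.app_incl, NatTrans.comp_app, Category.assoc]

lemma postcomp_comp (c : LatchingCocone i K X) {X' X'' : D ⥤ M} (l : X ⟶ X') (l' : X' ⟶ X'') :
    c.postcomp (l ≫ l') = (c.postcomp l).postcomp l' := by
  ext <;> simp

/-- The functoriality of latching cocones in the morphism of diagrams. -/
@[simps]
def precomp (c : LatchingCocone i' K X) (a : E ⟶ E') (b : A ⟶ A')
    (w : i ≫ a = Functor.whiskerLeft P.ι b ≫ i') : LatchingCocone i K X where
  base := Functor.whiskerLeft K b ≫ c.base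
  incl z d h := a.app z ≫ c.incl z d h
  map_incl k d h := by rw [← Category.assoc, a.naturality, Category.assoc, c.map_incl]
  incl_map z d d' h e := by rw [Category.assoc, c.incl_map]
  app_incl z d h := by
    have := congr_app w z
    dsimp at this
    rw [← Category.assoc, this, Category.assoc, c.app_incl, ← Category.assoc, ← b.naturality,
      Category.assoc]
    rfl

lemma postcomp_precomp (c : LatchingCocone i' K X) {X' : D ⥤ M} (l : X ⟶ X') (a : E ⟶ E')
    (b : A ⟶ A') (w : i ≫ a = Functor.whiskerLeft P.ι b ≫ i') :
    (c.postcomp l).precomp a b w = (c.precomp a b w).postcomp l := by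
  ext <;> simp

lemma precomp_precomp_eq_self {c : LatchingCocone i K X} {a : E ⟶ E'} {b : A ⟶ A'} {a' : E' ⟶ E}
    {b' : A' ⟶ A} (w : i ≫ a = Functor.whiskerLeft P.ι b ≫ i')
    (w' : i' ≫ a' = Functor.whiskerLeft P.ι b' ≫ i) (ha : a ≫ a' = 𝟙 E) (hb : b ≫ b' = 𝟙 A) :
    (c.precomp a' b' w').precomp a b w = c := by
  ext1
  · ext d
    simpa using congrArg (· ≫ c.base.app d) (congr_app hb (K.obj d))
  · funext z d h
    simpa using congrArg (· ≫ c.incl z d h) (congr_app ha z)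

/-- A latching cocone is universal if it is a relative latching object. -/
def IsUniversal (c : LatchingCocone i K Q) : Prop :=
  ∀ ⦃X : D ⥤ M⦄ (c' : LatchingCocone i K X), ∃! l : Q ⟶ X, c.postcomp l = c'

lemma IsUniversal.hom_ext {c : LatchingCocone i K Q} (hc : c.IsUniversal) {l l' : Q ⟶ X}
    (h : c.postcomp l = c.postcomp l') : l = l' :=
  (hc _).unique h rfl

/-- The lifting problems against the map to `X` from the relative latching object, in terms of the
latching cocone with vertex `X`. -/
def Lifts (c : LatchingCocone i K X) {Y Z : D ⥤ M} (p : Y ⟶ Z) : Prop :=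
  ∀ (b : X ⟶ Z) (c' : LatchingCocone i K Y), c'.postcomp p = c.postcomp b →
    ∃ l : X ⟶ Y, l ≫ p = b ∧ c.postcomp l = c'

/-- The map to `X` from the relative latching object is in `projectiveL R D`, in terms of the
latching cocone with vertex `X`. -/
def IsLeft (c : LatchingCocone i K X) (R : MorphismProperty M) : Prop :=
  ∀ ⦃Y Z : D ⥤ M⦄ (p : Y ⟶ Z), R.functorCategory D p → c.Lifts p

lemma IsLeft.postcomp_iso {c : LatchingCocone i K X} {R : MorphismProperty M} (hc : c.IsLeft R)
    {X' : D ⥤ M} (e : X ≅ X') : (c.postcomp e.hom).IsLeft R := by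
  intro Y Z q hq b c' h
  obtain ⟨l, hl, hl'⟩ := hc q hq (e.hom ≫ b) c' (by rw [h, postcomp_comp])
  refine ⟨e.inv ≫ l, ?_, ?_⟩
  · rw [Category.assoc, hl, e.inv_hom_id_assoc]
  · rw [← postcomp_comp, e.hom_inv_id_assoc, hl']

section

variable {cQ : LatchingCocone i K Q} {c : LatchingCocone i K X} {φ : Q ⟶ X}

lemma IsUniversal.hasLiftingProperty_iff (hQ : cQ.IsUniversal) (hφ : cQ.postcomp φ = c)
    {Y Z : D ⥤ M} (p : Y ⟶ Z) : HasLiftingProperty φ p ↔ c.Lifts p := by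
  constructor
  · intro H b c' hc'
    obtain ⟨q, rfl, -⟩ := hQ c'
    have sq : CommSq q φ p b :=
      ⟨hQ.hom_ext (by rw [postcomp_comp, postcomp_comp, hφ, hc'])⟩
    exact ⟨sq.lift, sq.fac_right, by rw [← hφ, ← postcomp_comp, sq.fac_left]⟩
  · intro H
    refine ⟨fun {q b} sq => ?_⟩
    obtain ⟨l, hl, hl'⟩ := H b (cQ.postcomp q) (by
      rw [← hφ, ← postcomp_comp, ← postcomp_comp, sq.w])
    exact ⟨⟨⟨l, hQ.hom_ext (by rw [postcomp_comp, hφ, hl']), hl⟩⟩⟩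

lemma IsUniversal.isLeft_iff (hQ : cQ.IsUniversal) (hφ : cQ.postcomp φ = c)
    (R : MorphismProperty M) : c.IsLeft R ↔ projectiveL R D φ :=
  forall₃_congr fun _ _ p => imp_congr_right fun _ => (hQ.hasLiftingProperty_iff hφ p).symm

end

section OfSq

variable [HasColimits M]

/-- The latching cocone determined by a commutative square under the latching objects. -/
noncomputable def ofSq (i : P.ι ⋙ A ⟶ E) (K : D ⥤ C) {inl : K ⋙ P.ι.lan.obj E ⟶ Q}
    {inr : K ⋙ A ⟶ Q}
    (h : CommSq (Functor.whiskerLeft K (P.ι.lan.map i))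
      (Functor.whiskerLeft K ((P.ι.lanAdjunction M).counit.app A)) inl inr) :
    LatchingCocone i K Q where
  base := inr
  incl z d h := KanExtension.lanι P.ι E h ≫ inl.app d
  map_incl k d h := by rw [reassoc_of% KanExtension.map_lanι]; rfl
  incl_map z d d' h e := by
    have := KanExtension.lanι_lan_map E (K.map e) (ι := P.ι) (z := z) h
    rw [Category.assoc, ← inl.naturality]
    exact (reassoc_of% this) _
  app_incl z d g := by
    have w := congr_app h.w d
    have counit := KanExtension.lanι_lanAdjunction_counit (ι := P.ι) A (z := z) g
    dsimp at w counit
    rw [← reassoc_of% KanExtension.lanι_lan_map_app, w, ← counit, Category.assoc]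

lemma isUniversal_ofSq {inl : K ⋙ P.ι.lan.obj E ⟶ Q} {inr : K ⋙ A ⟶ Q}
    (h : IsPushout (Functor.whiskerLeft K (P.ι.lan.map i))
      (Functor.whiskerLeft K ((P.ι.lanAdjunction M).counit.app A)) inl inr) :
    (ofSq i K h.toCommSq).IsUniversal := by
  intro X c
  choose m hm using fun d : D => KanExtension.exists_lan_desc (ι := P.ι) E (x := K.obj d)
    (fun z h => c.incl z d h) fun z z' k h => c.map_incl k h
  let m' : K ⋙ P.ι.lan.obj E ⟶ X :=
    { app := m
      naturality d d' e := KanExtension.lan_hom_ext _ fun z h => by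
        dsimp
        rw [reassoc_of% KanExtension.lanι_lan_map, hm, reassoc_of% hm, c.incl_map] }
  have w : Functor.whiskerLeft K (P.ι.lan.map i) ≫ m' =
      Functor.whiskerLeft K ((P.ι.lanAdjunction M).counit.app A) ≫ c.base := by
    ext d
    refine KanExtension.lan_hom_ext _ fun z g => ?_
    have counit := KanExtension.lanι_lanAdjunction_counit (ι := P.ι) A (z := z) g
    dsimp at counit
    dsimp [m']
    rw [reassoc_of% KanExtension.lanι_lan_map_app, hm, c.app_incl, ← counit, Category.assoc]
  refine ⟨h.desc m' c.base w, ?_, fun l hl => h.hom_ext ?_ ?_⟩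
  · ext1
    · exact h.inr_desc _ _ _
    · funext z d g
      have inl_desc := congr_app (h.inl_desc _ _ w) d
      dsimp at inl_desc
      simp [ofSq, inl_desc, m', hm]
  · rw [h.inl_desc]
    ext d
    refine KanExtension.lan_hom_ext _ fun z g => ?_
    simp [m', hm, ← hl, ofSq]
  · rw [h.inr_desc, ← hl]
    rfl

end OfSq

lemma exists_isUniversal [HasColimits M] (i : P.ι ⋙ A ⟶ E) (K : D ⥤ C) :
    ∃ (Q : D ⥤ M) (c : LatchingCocone i K Q), c.IsUniversal :=
  ⟨_, _, isUniversal_ofSq (i := i) (K := K) (IsPushout.of_hasPushout _ _)⟩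

end LatchingCocone

end Cones

namespace Stratification

variable {C : Type v} [SmallCategory C] (S : Stratification C) {M : Type u} [Category.{v} M]

section Canonical

variable (P : ObjectProperty C) {A B A' B' : C ⥤ M}

/-- The canonical matching cone of a morphism of diagrams. -/
@[simps]
def matchingCone (f : A ⟶ B) (x : C) :
    MatchingCone (Functor.whiskerLeft P.ι f) x (A.obj x) where
  base := f.app x
  proj _ g := A.map g
  proj_map _ _ := (A.map_comp _ _).symm
  proj_app _ g := f.naturality g

/-- The canonical latching cocone of a morphism of diagrams. -/
@[simps]
def latchingCocone (f : A ⟶ B) {D : Type w} [Category.{w'} D] (K : D ⥤ C) :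
    LatchingCocone (Functor.whiskerLeft P.ι f) K (K ⋙ B) where
  base := Functor.whiskerLeft K f
  incl _ _ h := B.map h
  map_incl _ _ _ := (B.map_comp _ _).symm
  incl_map _ _ _ _ _ := (B.map_comp _ _).symm
  app_incl _ _ h := (f.naturality h).symm

end Canonical

section Matching

variable [HasLimits M] {A B : C ⥤ M} (f : A ⟶ B)

/-- The relative matching object, as a matching cone. -/
noncomputable def universalMatchingCone (x : C) :
    MatchingCone (Functor.whiskerLeft (S.belowι (S.deg x)) f) x
      (pullback (((S.matching (S.deg x)).map f).app x) (((S.toMatching (S.deg x)).app B).app x)) :=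
  .ofSq (Functor.whiskerLeft (S.belowι (S.deg x)) f)
    (IsPullback.of_hasPullback (((S.matching _).map f).app x)
      (((S.toMatching _).app B).app x)).toCommSq

lemma isUniversal_universalMatchingCone (x : C) : (S.universalMatchingCone f x).IsUniversal :=
  MatchingCone.isUniversal_ofSq (p := Functor.whiskerLeft (S.belowι (S.deg x)) f)
    (IsPullback.of_hasPullback (((S.matching _).map f).app x) (((S.toMatching _).app B).app x))

lemma universalMatchingCone_precomp_matchingMap (x : C) :
    (S.universalMatchingCone f x).precomp (S.matchingMap f x) = matchingCone _ f x := by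
  ext z g
  · exact pullback.lift_snd _ _ _
  · refine (pullback.lift_fst_assoc _ _ _ _).trans ?_
    exact KanExtension.ranAdjunction_unit_ranπ (ι := S.belowι _) A (z := z) g

lemma hasLiftingProperty_matchingMap_iff (x : C) {K L : M} (i : K ⟶ L) :
    HasLiftingProperty i (S.matchingMap f x) ↔ (matchingCone (S.below (S.deg x)) f x).Lifts i :=
  (S.isUniversal_universalMatchingCone f x).hasLiftingProperty_iff
    (S.universalMatchingCone_precomp_matchingMap f x) i

lemma matchingMap_mem_iff {R : MorphismProperty M} (hR : R.llp.rlp = R) (x : C) :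
    R (S.matchingMap f x) ↔ (matchingCone (S.below (S.deg x)) f x).IsRight R :=
  ((S.isUniversal_universalMatchingCone f x).isRight_iff
    (S.universalMatchingCone_precomp_matchingMap f x) hR).symm

end Matching

section Latching

variable [HasColimits M] (δ : Ordinal.{v}) {A B : C ⥤ M} (f : A ⟶ B) {D : Type w} [Category.{w'} D]
  (K : D ⥤ C)

/-- The restriction along `K'` of the relative latching object along `K`, as a latching cocone. -/
noncomputable def universalLatchingCocone {D' : Type*} [Category* D'] (K' : D' ⥤ D) :
    LatchingCocone (Functor.whiskerLeft (S.belowι δ) f) (K' ⋙ K)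
      (K' ⋙ pushout (Functor.whiskerLeft K ((S.latching δ).map f))
        (Functor.whiskerLeft K ((S.fromLatching δ).app A))) :=
  .ofSq (Functor.whiskerLeft (S.belowι δ) f) (K' ⋙ K)
    ((IsPushout.of_hasPushout (Functor.whiskerLeft K ((S.latching δ).map f))
      (Functor.whiskerLeft K ((S.fromLatching δ).app A))).map
        ((Functor.whiskeringLeft D' D M).obj K')).toCommSq

variable {D' : Type*} [Category* D'] (K' : D' ⥤ D)

lemma isUniversal_universalLatchingCocone :
    (S.universalLatchingCocone δ f K K').IsUniversal :=
  LatchingCocone.isUniversal_ofSq (i := Functor.whiskerLeft (S.belowι δ) f) (K := K' ⋙ K)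
    ((IsPushout.of_hasPushout (Functor.whiskerLeft K ((S.latching δ).map f))
      (Functor.whiskerLeft K ((S.fromLatching δ).app A))).map
        ((Functor.whiskeringLeft D' D M).obj K'))

lemma universalLatchingCocone_postcomp_latchingMap :
    (S.universalLatchingCocone δ f K K').postcomp (Functor.whiskerLeft K' (S.latchingMap δ K f)) =
      latchingCocone (S.below δ) f (K' ⋙ K) := by
  have inr_desc : pushout.inr _ _ ≫ S.latchingMap δ K f = Functor.whiskerLeft K f :=
    pushout.inr_desc _ _ _
  have inl_desc : pushout.inl _ _ ≫ S.latchingMap δ K f =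
      Functor.whiskerLeft K ((S.fromLatching δ).app B) := pushout.inl_desc _ _ _
  ext1
  · exact congrArg (Functor.whiskerLeft K') inr_desc
  · funext z d h
    refine (Category.assoc _ _ _).trans ((congrArg (KanExtension.lanι (S.belowι δ) _ h ≫ ·)
      (congr_app inl_desc (K'.obj d))).trans ?_)
    exact KanExtension.lanι_lanAdjunction_counit (ι := S.belowι _) B (z := z) h

lemma hasLiftingProperty_whiskerLeft_latchingMap_iff {X Y : D' ⥤ M} (p : X ⟶ Y) :
    HasLiftingProperty (Functor.whiskerLeft K' (S.latchingMap δ K f)) p ↔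
      (latchingCocone (S.below δ) f (K' ⋙ K)).Lifts p :=
  (S.isUniversal_universalLatchingCocone δ f K K').hasLiftingProperty_iff
    (S.universalLatchingCocone_postcomp_latchingMap δ f K K') p

lemma projectiveL_latchingMap_iff (R : MorphismProperty M) :
    projectiveL R D (S.latchingMap δ K f) ↔ (latchingCocone (S.below δ) f K).IsLeft R :=
  ((S.isUniversal_universalLatchingCocone δ f K (𝟭 D)).isLeft_iff
    (S.universalLatchingCocone_postcomp_latchingMap δ f K (𝟭 D)) R).symm

end Latching

end Stratification

/-! ### Lifts by transfinite recursion -/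

lemma nonempty_of_transfinite {T : Ordinal.{v} → Type w}
    (r : ∀ {i j : Ordinal.{v}}, i ≤ j → T j → T i)
    (r_refl : ∀ {i : Ordinal.{v}} (x : T i), r le_rfl x = x)
    (r_trans : ∀ {i j k : Ordinal.{v}} (hij : i ≤ j) (hjk : j ≤ k) (x : T k),
      r hij (r hjk x) = r (hij.trans hjk) x)
    (zero : Nonempty (T 0))
    (succ : ∀ (j : Ordinal.{v}) (x : T j), ∃ y : T (Order.succ j), r (Order.le_succ j) y = x)
    (limit : ∀ (j : Ordinal.{v}), Order.IsSuccLimit j → ∀ x : ∀ i, i < j → T i,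
      (∀ (i k : Ordinal.{v}) (hk : k < j) (hik : i ≤ k), r hik (x k hk) = x i (hik.trans_lt hk)) →
      ∃ y : T j, ∀ (i : Ordinal.{v}) (hi : i < j), r hi.le y = x i hi) (β : Ordinal.{v}) :
    Nonempty (T β) := by
  let F : (Ordinal.{v})ᵒᵖ ⥤ Type w :=
    { obj j := T j.unop
      map f := ↾ (r (leOfHom f.unop))
      map_id j := by ext x; exact r_refl x
      map_comp f g := by ext x; exact (r_trans _ _ x).symm }
  let d : F.WellOrderInductionData := .ofExists (fun j _ x => succ j x) fun j hj x => by
    obtain ⟨y, hy⟩ := limit j hj (fun i hi => x.val (op ⟨i, hi⟩)) fun i k hk hik =>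
      x.property (Quiver.Hom.op
        (show (⟨i, hik.trans_lt hk⟩ : Set.Iio j) ⟶ ⟨k, hk⟩ from homOfLE hik))
    exact ⟨y, hy⟩
  obtain ⟨s, -⟩ := d.surjective (show F.obj (op ⊥) from zero.some)
  exact ⟨s.val (op β)⟩

section RelMatching

variable {C : Type v} [SmallCategory C] {P : ObjectProperty C} {M : Type u} [Category.{v} M]
  [HasLimits M] {E : P.FullSubcategory ⥤ M} {B : C ⥤ M} (p : E ⟶ P.ι ⋙ B)

/-- The relative matching objects of `p`, as a diagram on `C`. -/
noncomputable def relMatching : C ⥤ M :=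
  pullback (P.ι.ran.map p) ((P.ι.ranAdjunction M).unit.app B)

lemma isPullback_relMatching (x : C) :
    IsPullback ((pullback.fst (P.ι.ran.map p) ((P.ι.ranAdjunction M).unit.app B)).app x)
      ((pullback.snd (P.ι.ran.map p) ((P.ι.ranAdjunction M).unit.app B)).app x)
      ((P.ι.ran.map p).app x) (((P.ι.ranAdjunction M).unit.app B).app x) :=
  (IsPullback.of_hasPullback (P.ι.ran.map p) ((P.ι.ranAdjunction M).unit.app B)).map
    ((evaluation C M).obj x)

/-- The universal matching cone, with vertex the relative matching object. -/
noncomputable def relMatchingCone (x : C) : MatchingCone p x ((relMatching p).obj x) :=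
  MatchingCone.ofSq p (isPullback_relMatching p x).toCommSq

lemma isUniversal_relMatchingCone (x : C) : (relMatchingCone p x).IsUniversal :=
  MatchingCone.isUniversal_ofSq (isPullback_relMatching p x)

lemma relMatchingCone_precomp_map {x y : C} (k : x ⟶ y) :
    (relMatchingCone p y).precomp ((relMatching p).map k) = (relMatchingCone p x).along k := by
  ext z g
  · exact (pullback.snd (P.ι.ran.map p) ((P.ι.ranAdjunction M).unit.app B)).naturality k
  · have naturality :=
      (pullback.fst (P.ι.ran.map p) ((P.ι.ranAdjunction M).unit.app B)).naturality k
    refine (reassoc_of% naturality) _ |>.trans (congrArg (_ ≫ ·) ?_)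
    exact KanExtension.ran_map_ranπ (ι := P.ι) E k (z := z) g

variable {D : Type w} [Category.{w'} D] {K : D ⥤ C} {F G : D ⥤ M}

lemma relMatching_hom_ext {φ φ' : F ⟶ K ⋙ relMatching p}
    (h : ∀ d, (relMatchingCone p (K.obj d)).precomp (φ.app d) =
      (relMatchingCone p (K.obj d)).precomp (φ'.app d)) : φ = φ' := by
  ext d
  exact (isUniversal_relMatchingCone p (K.obj d)).hom_ext (h d)

lemma exists_relMatching_lift (c : ∀ d : D, MatchingCone p (K.obj d) (F.obj d))
    (hc : ∀ {d d' : D} (e : d ⟶ d'), (c d').precomp (F.map e) = (c d).along (K.map e)) :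
    ∃ φ : F ⟶ K ⋙ relMatching p, ∀ d, (relMatchingCone p (K.obj d)).precomp (φ.app d) = c d := by
  choose φ hφ _ using fun d => isUniversal_relMatchingCone p (K.obj d) (c d)
  refine ⟨{ app := φ, naturality d d' e := ?_ }, hφ⟩
  refine (isUniversal_relMatchingCone p (K.obj d')).hom_ext ?_
  dsimp
  rw [MatchingCone.precomp_comp, hφ, hc, MatchingCone.precomp_comp, relMatchingCone_precomp_map,
    ← MatchingCone.precomp_along, hφ]

variable {p}

lemma exists_lift_of_isLeft_of_isRight {R : MorphismProperty M} (hR : R.llp.rlp = R)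
    {E' : P.FullSubcategory ⥤ M} {A : C ⥤ M} {i : P.ι ⋙ A ⟶ E'}
    {c : LatchingCocone i K G} (hc : c.IsLeft R) (c' : LatchingCocone i K F)
    {m : ∀ d, MatchingCone p (K.obj d) (F.obj d)} (hm : ∀ d, (m d).IsRight R)
    (m_map : ∀ {d d' : D} (e : d ⟶ d'), (m d').precomp (F.map e) = (m d).along (K.map e))
    (m' : ∀ d, MatchingCone p (K.obj d) (G.obj d))
    (m'_map : ∀ {d d' : D} (e : d ⟶ d'), (m' d').precomp (G.map e) = (m' d).along (K.map e))
    (base : ∀ d, (m d).precomp (c'.base.app d) = (m' d).precomp (c.base.app d))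
    (incl : ∀ z d h, (m d).precomp (c'.incl z d h) = (m' d).precomp (c.incl z d h)) :
    ∃ l : G ⟶ F, c.postcomp l = c' ∧ ∀ d, (m d).precomp (l.app d) = m' d := by
  obtain ⟨q, hq⟩ := exists_relMatching_lift p m m_map
  obtain ⟨q', hq'⟩ := exists_relMatching_lift p m' m'_map
  have q_mem : R.functorCategory D q := fun d =>
    ((isUniversal_relMatchingCone p _).isRight_iff (hq d) hR).1 (hm d)
  obtain ⟨l, hl, hl'⟩ := hc q q_mem q' c' (by
    ext1
    · refine relMatching_hom_ext p fun d => ?_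
      rw [LatchingCocone.postcomp_base, LatchingCocone.postcomp_base, NatTrans.comp_app,
        NatTrans.comp_app, MatchingCone.precomp_comp, MatchingCone.precomp_comp, hq, hq', base]
    · funext z d h
      refine (isUniversal_relMatchingCone p _).hom_ext ?_
      rw [LatchingCocone.postcomp_incl, LatchingCocone.postcomp_incl, MatchingCone.precomp_comp,
        MatchingCone.precomp_comp, hq, hq', incl])
  refine ⟨l, hl', fun d => ?_⟩
  rw [← hq, ← hq', ← hl, NatTrans.comp_app, MatchingCone.precomp_comp]

end RelMatching

namespace Stratification

variable {C : Type v} [SmallCategory C] {S : Stratification C} {M : Type u} [Category.{v} M]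

lemma isRight_matchingCone_of_deg_eq {X Y : C ⥤ M} {p : X ⟶ Y} {R : MorphismProperty M} {x : C}
    {δ : Ordinal.{v}} (hx : S.deg x = δ)
    (h : (matchingCone (S.below (S.deg x)) p x).IsRight R) :
    (matchingCone (S.below δ) p x).IsRight R := by
  subst hx
  exact h

/-- The inclusion of `C_δ` in `C_ε` for `δ ≤ ε`. -/
@[simps, reducible]
def belowOfLE (S : Stratification C) {δ ε : Ordinal.{v}} (h : δ ≤ ε) : S.Below δ ⥤ S.Below ε where
  obj z := ⟨z.obj, z.property.trans_le h⟩
  map k := ⟨k.hom⟩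

/-- The inclusion of the stratum of degree `δ` in `C_ε` for `δ < ε`. -/
@[simps, reducible]
def stratumToBelow (S : Stratification C) {δ ε : Ordinal.{v}} (h : δ < ε) :
    S.Stratum δ ⥤ S.Below ε where
  obj d := ⟨d.obj, d.deg_obj.trans_lt h⟩
  map k := ⟨k.1⟩

/-- A lift, defined on the objects of degree less than both `β` and `δ`, in a square of diagrams. -/
@[ext]
structure PartialLift (S : Stratification C) {β : Ordinal.{v}} {A B X Y : C ⥤ M} (f : A ⟶ B)
    (p : X ⟶ Y) (a : S.belowι β ⋙ A ⟶ S.belowι β ⋙ X) (b : S.belowι β ⋙ B ⟶ S.belowι β ⋙ Y)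
    (δ : Ordinal.{v}) where
  app (x : S.Below β) (hx : S.deg x.obj < δ) : B.obj x.obj ⟶ X.obj x.obj
  naturality {x y : S.Below β} (hx : S.deg x.obj < δ) (hy : S.deg y.obj < δ) (k : x ⟶ y) :
    B.map k.hom ≫ app y hy = app x hx ≫ X.map k.hom
  fac_left (x : S.Below β) (hx : S.deg x.obj < δ) : f.app x.obj ≫ app x hx = a.app x
  fac_right (x : S.Below β) (hx : S.deg x.obj < δ) : app x hx ≫ p.app x.obj = b.app x

namespace PartialLift

variable {β : Ordinal.{v}} {A B X Y : C ⥤ M} {f : A ⟶ B} {p : X ⟶ Y}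
  {a : S.belowι β ⋙ A ⟶ S.belowι β ⋙ X} {b : S.belowι β ⋙ B ⟶ S.belowι β ⋙ Y}

/-- The restriction of a partial lift to the objects of smaller degrees. -/
@[simps]
def restrict {δ ε : Ordinal.{v}} (h : δ ≤ ε) (l : PartialLift S f p a b ε) :
    PartialLift S f p a b δ where
  app x hx := l.app x (hx.trans_le h)
  naturality _ _ k := l.naturality _ _ k
  fac_left x _ := l.fac_left x _
  fac_right x _ := l.fac_right x _

lemma exists_limit {δ : Ordinal.{v}} (hδ : Order.IsSuccLimit δ)
    (l : ∀ i, i < δ → PartialLift S f p a b i)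
    (hl : ∀ (i k : Ordinal.{v}) (hk : k < δ) (hik : i ≤ k),
      (l k hk).restrict hik = l i (hik.trans_lt hk)) :
    ∃ l' : PartialLift S f p a b δ,
      ∀ (i : Ordinal.{v}) (hi : i < δ), l'.restrict hi.le = l i hi := by
  have app_eq {j k : Ordinal.{v}} (hj : j < δ) (hk : k < δ) (x : S.Below β)
      (hxj : S.deg x.obj < j) (hxk : S.deg x.obj < k) :
      (l j hj).app x hxj = (l k hk).app x hxk := by
    wlog hjk : j ≤ k generalizing j k
    · exact (this hk hj hxk hxj (le_of_not_ge hjk)).symm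
    rw [← hl j k hk hjk]
    rfl
  refine ⟨{ app := fun x hx => (l _ (hδ.succ_lt hx)).app x (Order.lt_succ _)
            naturality := fun {x y} hx hy k => ?_
            fac_left := fun x hx => (l _ (hδ.succ_lt hx)).fac_left x _
            fac_right := fun x hx => (l _ (hδ.succ_lt hx)).fac_right x _ }, fun i hi => ?_⟩
  · have hm : max (S.deg x.obj) (S.deg y.obj) < δ := max_lt hx hy
    rw [app_eq _ (hδ.succ_lt hm) x _ (Order.lt_succ_of_le (le_max_left _ _)),
      app_eq _ (hδ.succ_lt hm) y _ (Order.lt_succ_of_le (le_max_right _ _))]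
    exact (l _ (hδ.succ_lt hm)).naturality _ _ k
  · ext x hx
    exact app_eq _ _ _ _ _

section Succ

variable {δ : Ordinal.{v}} (l : PartialLift S f p a b δ) (hδ : δ < β)

/-- The matching cone over `p` with vertex `B_d` that a lift to degree `δ` must induce. -/
@[simps]
def matchingCone (d : S.Stratum δ) :
    MatchingCone (Functor.whiskerLeft (S.below δ).ι p) d.obj (B.obj d.obj) where
  base := b.app ((S.stratumToBelow hδ).obj d)
  proj z g := B.map g ≫ l.app ((S.belowOfLE hδ.le).obj z) z.property
  proj_map {z z'} g k := by
    have := l.naturality z.property z'.property ((S.belowOfLE hδ.le).map k)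
    dsimp at this ⊢
    rw [Category.assoc, ← this, B.map_comp, Category.assoc]
  proj_app z g := by
    have := b.naturality (X := (S.stratumToBelow hδ).obj d) (Y := (S.belowOfLE hδ.le).obj z) ⟨g⟩
    rw [Category.assoc]
    exact (congrArg (_ ≫ ·) (l.fac_right ((S.belowOfLE hδ.le).obj z) z.property)).trans this

lemma matchingCone_precomp_map {d d' : S.Stratum δ} (e : d ⟶ d') :
    (l.matchingCone hδ d').precomp (B.map e.1) = (l.matchingCone hδ d).along e.1 := by
  ext z g
  · exact b.naturality ((S.stratumToBelow hδ).map e)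
  · simp

/-- The latching cocone under `f` with vertex `X` that a lift to degree `δ` must induce. -/
@[simps]
def latchingCocone : LatchingCocone (Functor.whiskerLeft (S.below δ).ι f) (S.stratumι δ)
    (S.stratumι δ ⋙ X) where
  base := Functor.whiskerLeft (S.stratumToBelow hδ) a
  incl z d h := l.app ((S.belowOfLE hδ.le).obj z) z.property ≫ X.map h
  map_incl {z z'} k d h := by
    have := l.naturality z.property z'.property ((S.belowOfLE hδ.le).map k)
    dsimp at this ⊢
    rw [reassoc_of% this, ← X.map_comp]
  incl_map z d d' h e := by
    dsimp
    rw [Category.assoc, ← X.map_comp]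
  app_incl z d h := by
    have := a.naturality (X := (S.belowOfLE hδ.le).obj z) (Y := (S.stratumToBelow hδ).obj d) ⟨h⟩
    exact (Category.assoc _ _ _).symm.trans
      ((congrArg (· ≫ _) (l.fac_left ((S.belowOfLE hδ.le).obj z) _)).trans this.symm)

lemma matchingCone_precomp_latchingCocone_base
    (w : a ≫ Functor.whiskerLeft _ p = Functor.whiskerLeft _ f ≫ b) (d : S.Stratum δ) :
    (Stratification.matchingCone (S.below δ) p d.obj).precomp ((l.latchingCocone hδ).base.app d) =
      (l.matchingCone hδ d).precomp (f.app d.obj) := by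
  ext z g
  · exact congr_app w ((S.stratumToBelow hδ).obj d)
  · have := a.naturality (X := (S.stratumToBelow hδ).obj d) (Y := (S.belowOfLE hδ.le).obj z) ⟨g⟩
    change a.app ((S.stratumToBelow hδ).obj d) ≫ X.map g =
      f.app d.obj ≫ B.map g ≫ l.app ((S.belowOfLE hδ.le).obj z) z.property
    refine this.symm.trans ?_
    rw [← l.fac_left ((S.belowOfLE hδ.le).obj z) z.property, ← f.naturality_assoc]
    rfl

lemma matchingCone_precomp_latchingCocone_incl (z : S.Below δ) (d : S.Stratum δ)
    (h : z.obj ⟶ d.obj) :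
    (Stratification.matchingCone (S.below δ) p d.obj).precomp
        ((l.latchingCocone hδ).incl z d h) =
      (l.matchingCone hδ d).precomp (B.map h) := by
  ext z' g
  · have := b.naturality (X := (S.belowOfLE hδ.le).obj z) (Y := (S.stratumToBelow hδ).obj d) ⟨h⟩
    change (l.app ((S.belowOfLE hδ.le).obj z) z.property ≫ X.map h) ≫ p.app d.obj =
      B.map h ≫ b.app ((S.stratumToBelow hδ).obj d)
    rw [Category.assoc, p.naturality, ← Category.assoc]
    exact (congrArg (· ≫ _) (l.fac_right ((S.belowOfLE hδ.le).obj z) z.property)).trans this.symm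
  · have := l.naturality (x := (S.belowOfLE hδ.le).obj z) (y := (S.belowOfLE hδ.le).obj z')
      z.property z'.property ⟨h ≫ g⟩
    change (l.app ((S.belowOfLE hδ.le).obj z) z.property ≫ X.map h) ≫ X.map g =
      B.map h ≫ B.map g ≫ l.app ((S.belowOfLE hδ.le).obj z') z'.property
    rw [Category.assoc, ← X.map_comp, ← B.map_comp_assoc]
    exact this.symm

variable {l hδ} {m : S.stratumι δ ⋙ B ⟶ S.stratumι δ ⋙ X}

lemma naturality_of_stratum (hS : S.HasThroughDecomposition)
    (hm : (Stratification.latchingCocone (S.below δ) f (S.stratumι δ)).postcomp m =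
      l.latchingCocone hδ)
    (hm' : ∀ d, (Stratification.matchingCone (S.below δ) p d.obj).precomp (m.app d) =
      l.matchingCone hδ d) {d d' : S.Stratum δ} (k : d.obj ⟶ d'.obj) :
    B.map k ≫ m.app d' = m.app d ≫ X.map k := by
  by_cases hk : S.inStratum k
  · exact m.naturality (⟨k, hk⟩ : d ⟶ d')
  · obtain ⟨z, g, h, hz, rfl⟩ := hS.exists_fac k (d.deg_obj.trans d'.deg_obj.symm) hk
    replace hz : S.deg z < δ := hz.trans_eq d.deg_obj
    let z' : S.Below β := ⟨z, hz.trans hδ⟩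
    let m' (d : S.Stratum δ) : B.obj d.obj ⟶ X.obj d.obj := m.app d
    have incl : B.map h ≫ m' d' = l.app z' hz ≫ X.map h :=
      congrArg (fun c => c.incl ⟨z, hz⟩ d' h) hm
    have proj : m' d ≫ X.map g = B.map g ≫ l.app z' hz :=
      congrArg (fun c => c.proj ⟨z, hz⟩ g) (hm' d)
    change B.map (g ≫ h) ≫ m' d' = m' d ≫ X.map (g ≫ h)
    rw [B.map_comp, X.map_comp, Category.assoc, incl, reassoc_of% proj]

lemma exists_extension (hS : S.HasThroughDecomposition)
    (hm : (Stratification.latchingCocone (S.below δ) f (S.stratumι δ)).postcomp m =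
      l.latchingCocone hδ)
    (hm' : ∀ d, (Stratification.matchingCone (S.below δ) p d.obj).precomp (m.app d) =
      l.matchingCone hδ d) :
    ∃ l' : PartialLift S f p a b (Order.succ δ), l'.restrict (Order.le_succ δ) = l := by
  let st (x : S.Below β) (hx : S.deg x.obj < Order.succ δ) (h : ¬ S.deg x.obj < δ) :
      S.Stratum δ := ⟨x.obj, le_antisymm (Order.lt_succ_iff.1 hx) (le_of_not_gt h)⟩
  let app (x : S.Below β) (hx : S.deg x.obj < Order.succ δ) : B.obj x.obj ⟶ X.obj x.obj :=
    if h : S.deg x.obj < δ then l.app x h else m.app (st x hx h)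
  have app_low {x : S.Below β} (hx) (h : S.deg x.obj < δ) : app x hx = l.app x h := dif_pos h
  have app_high {x : S.Below β} (hx) (h : ¬ S.deg x.obj < δ) : app x hx = m.app (st x hx h) :=
    dif_neg h
  refine ⟨{ app := app
            naturality := fun {x y} hx hy k => ?_
            fac_left := fun x hx => ?_
            fac_right := fun x hx => ?_ },
    by ext x hx; exact app_low (hx.trans (Order.lt_succ δ)) hx⟩
  · by_cases h : S.deg x.obj < δ <;> by_cases h' : S.deg y.obj < δ
    · rw [app_low hx h, app_low hy h']
      exact l.naturality h h' k
    · rw [app_low hx h, app_high hy h']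
      exact congrArg (fun c => c.incl ⟨x.obj, h⟩ (st y hy h') k.hom) hm
    · rw [app_high hx h, app_low hy h']
      exact congrArg (fun c => c.proj ⟨y.obj, h'⟩ k.hom) (hm' (st x hx h)).symm
    · rw [app_high hx h, app_high hy h']
      exact naturality_of_stratum hS hm hm' (d := st x hx h) (d' := st y hy h') k.hom
  · by_cases h : S.deg x.obj < δ
    · rw [app_low hx h, l.fac_left x h]
    · rw [app_high hx h]
      exact congr_app (congrArg LatchingCocone.base hm) (st x hx h)
  · by_cases h : S.deg x.obj < δ
    · rw [app_low hx h, l.fac_right x h]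
    · rw [app_high hx h]
      exact congrArg MatchingCone.base (hm' (st x hx h))

variable (l)

lemma exists_succ [HasLimits M] (hS : S.HasThroughDecomposition) {R : MorphismProperty M}
    (hR : R.llp.rlp = R)
    (w : a ≫ Functor.whiskerLeft _ p = Functor.whiskerLeft _ f ≫ b)
    (hf : ∀ δ < β, (Stratification.latchingCocone (S.below δ) f (S.stratumι δ)).IsLeft R)
    (hp : ∀ x, S.deg x < β → (Stratification.matchingCone (S.below (S.deg x)) p x).IsRight R) :
    ∃ l' : PartialLift S f p a b (Order.succ δ), l'.restrict (Order.le_succ δ) = l := by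
  by_cases hδ : δ < β
  · obtain ⟨m, hm, hm'⟩ := exists_lift_of_isLeft_of_isRight hR (hf δ hδ) (l.latchingCocone hδ)
      (m := fun d => Stratification.matchingCone (S.below δ) p d.obj)
      (fun d => isRight_matchingCone_of_deg_eq d.deg_obj (hp _ (d.deg_obj.trans_lt hδ)))
      (fun e => by ext; exacts [p.naturality e.1, (X.map_comp _ _).symm]) (l.matchingCone hδ)
      (l.matchingCone_precomp_map hδ) (l.matchingCone_precomp_latchingCocone_base hδ w)
      (l.matchingCone_precomp_latchingCocone_incl hδ)
    exact exists_extension hS hm hm'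
  · have deg_lt {x : S.Below β} : S.deg x.obj < δ := x.property.trans_le (le_of_not_gt hδ)
    exact ⟨{ app x _ := l.app x deg_lt
             naturality _ _ k := l.naturality _ _ k
             fac_left x _ := l.fac_left x _
             fac_right x _ := l.fac_right x _ }, rfl⟩

end Succ

end PartialLift

theorem HasThroughDecomposition.exists_lift_below [HasLimits M] (hS : S.HasThroughDecomposition)
    {R : MorphismProperty M} (hR : R.llp.rlp = R) {β : Ordinal.{v}} {A B X Y : C ⥤ M} {f : A ⟶ B}
    {p : X ⟶ Y} {a : S.belowι β ⋙ A ⟶ S.belowι β ⋙ X} {b : S.belowι β ⋙ B ⟶ S.belowι β ⋙ Y}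
    (w : a ≫ Functor.whiskerLeft _ p = Functor.whiskerLeft _ f ≫ b)
    (hf : ∀ δ < β, (latchingCocone (S.below δ) f (S.stratumι δ)).IsLeft R)
    (hp : ∀ x, S.deg x < β → (matchingCone (S.below (S.deg x)) p x).IsRight R) :
    ∃ l : S.belowι β ⋙ B ⟶ S.belowι β ⋙ X,
      Functor.whiskerLeft _ f ≫ l = a ∧ l ≫ Functor.whiskerLeft _ p = b := by
  obtain ⟨l⟩ := nonempty_of_transfinite (T := PartialLift S f p a b)
    (fun h l => l.restrict h) (fun _ => rfl) (fun _ _ _ => rfl)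
    ⟨{ app := fun x hx => (not_lt_zero hx).elim
       naturality := fun hx => (not_lt_zero hx).elim
       fac_left := fun x hx => (not_lt_zero hx).elim
       fac_right := fun x hx => (not_lt_zero hx).elim }⟩
    (fun _ l => l.exists_succ hS hR w hf hp) (fun _ hδ => PartialLift.exists_limit hδ) β
  refine ⟨{ app := fun x => l.app x x.property
            naturality := fun x y k => l.naturality _ _ k }, ?_, ?_⟩
  · ext x
    exact l.fac_left x x.property
  · ext x
    exact l.fac_right x x.property

end Stratification

/-! ### Powers and copowers by representables -/

section Squares

variable {M : Type u} [Category.{v} M] {K L : M}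

/-- The commutative squares from `i` to `p`. -/
def Squares (i : K ⟶ L) {X Y : M} (p : X ⟶ Y) : Type v :=
  { q : (K ⟶ X) × (L ⟶ Y) // q.1 ≫ p = i ≫ q.2 }

/-- The commutative square from `i` to `p` with a given diagonal. -/
def diagonalToSquare (i : K ⟶ L) {X Y : M} (p : X ⟶ Y) : (L ⟶ X) ⟶ Squares i p :=
  ↾ fun l => ⟨(i ≫ l, l ≫ p), Category.assoc _ _ _⟩

lemma epi_diagonalToSquare (i : K ⟶ L) {X Y : M} (p : X ⟶ Y) [HasLiftingProperty i p] :
    Epi (diagonalToSquare i p) := by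
  rw [epi_iff_surjective]
  rintro ⟨⟨k, s⟩, w⟩
  have sq : CommSq k i p s := ⟨w⟩
  exact ⟨sq.lift, Subtype.ext (Prod.ext sq.fac_left sq.fac_right)⟩

variable {D : Type w} [Category.{w'} D] {X Y : D ⥤ M}

/-- The diagram of the commutative squares from `i` to the components of `q`. -/
def squares (i : K ⟶ L) (q : X ⟶ Y) : D ⥤ Type v where
  obj d := Squares i (q.app d)
  map e := ↾ fun s => ⟨(s.1.1 ≫ X.map e, s.1.2 ≫ Y.map e), by
    rw [Category.assoc, q.naturality, ← Category.assoc, s.2, Category.assoc]⟩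
  map_id d := by
    refine ConcreteCategory.hom_ext _ _ fun s => Subtype.ext (Prod.ext ?_ ?_)
    · exact (congrArg (s.1.1 ≫ ·) (X.map_id d)).trans (Category.comp_id _)
    · exact (congrArg (s.1.2 ≫ ·) (Y.map_id d)).trans (Category.comp_id _)
  map_comp e e' := by
    refine ConcreteCategory.hom_ext _ _ fun s => Subtype.ext (Prod.ext ?_ ?_)
    · exact (congrArg (s.1.1 ≫ ·) (X.map_comp e e')).trans (Category.assoc _ _ _).symm
    · exact (congrArg (s.1.2 ≫ ·) (Y.map_comp e e')).trans (Category.assoc _ _ _).symm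

/-- The natural transformation from diagonals to commutative squares. -/
def diagonalsToSquares (i : K ⟶ L) (q : X ⟶ Y) :
    X ⋙ coyoneda.obj (op L) ⟶ squares i q where
  app d := diagonalToSquare i (q.app d)
  naturality d d' e := by
    refine ConcreteCategory.hom_ext _ _ fun l => Subtype.ext (Prod.ext ?_ ?_)
    · exact (Category.assoc i l (X.map e)).symm
    · exact (Category.assoc _ _ _).trans
        ((congrArg (l ≫ ·) (q.naturality e)).trans (Category.assoc _ _ _).symm)

lemma functorCategory_epimorphisms_diagonalsToSquares {R : MorphismProperty M} {i : K ⟶ L}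
    (hi : R.llp i) {q : X ⟶ Y} (hq : R.functorCategory D q) :
    (MorphismProperty.epimorphisms (Type v)).functorCategory D (diagonalsToSquares i q) := by
  intro d
  have := hi _ (hq d)
  exact (MorphismProperty.epimorphisms.iff _).2 (epi_diagonalToSquare i (q.app d))

end Squares

lemma hasLiftingProperty_of_mono_of_epi {K L X Y : Type v} (i : K ⟶ L) (p : X ⟶ Y) [Mono i]
    [Epi p] : HasLiftingProperty i p := by
  classical
  have hi := (mono_iff_injective i).1 inferInstance
  choose r hr using (epi_iff_surjective p).1 inferInstance
  refine ⟨fun {t s} sq => ?_⟩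
  let l : L → X := fun y => if h : ∃ k, i k = y then t h.choose else r (s y)
  have l_apply (k : K) : l (i k) = t k := by
    have h : ∃ k', i k' = i k := ⟨k, rfl⟩
    exact (dif_pos h).trans (congrArg _ (hi h.choose_spec))
  refine ⟨⟨⟨↾ l, ConcreteCategory.hom_ext _ _ l_apply, ConcreteCategory.hom_ext _ _ fun y => ?_⟩⟩⟩
  change p (l y) = s y
  by_cases h : ∃ k, i k = y
  · obtain ⟨k, rfl⟩ := h
    rw [l_apply]
    exact ConcreteCategory.congr_hom sq.w k
  · exact (congrArg p (dif_neg h)).trans (hr _)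

section Powers

variable {C : Type v} [SmallCategory C] {M : Type u} [Category.{v} M] [HasProducts.{v} M] {x : C}

/-- The projections of the powers of `Z` by the sets of morphisms to `x`. -/
noncomputable def powerπ (Z : M) {y : C} (h : y ⟶ x) :
    ((evaluationRightAdjoint M x).obj Z).obj y ⟶ Z :=
  Pi.π (fun _ : y ⟶ x => Z) h

lemma map_powerπ (Z : M) {y z : C} (g : y ⟶ z) (h : z ⟶ x) :
    ((evaluationRightAdjoint M x).obj Z).map g ≫ powerπ Z h = powerπ Z (g ≫ h) :=
  Pi.lift_π _ _

lemma app_powerπ {X Y : M} (p : X ⟶ Y) {y : C} (h : y ⟶ x) :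
    ((evaluationRightAdjoint M x).map p).app y ≫ powerπ Y h = powerπ X h ≫ p :=
  Pi.lift_π _ _

lemma power_hom_ext {Z T : M} {y : C} {l l' : T ⟶ ((evaluationRightAdjoint M x).obj Z).obj y}
    (h : ∀ k : y ⟶ x, l ≫ powerπ Z k = l' ≫ powerπ Z k) : l = l' :=
  Pi.hom_ext _ _ h

lemma exists_power_lift {Z T : M} {y : C} (l : (y ⟶ x) → (T ⟶ Z)) :
    ∃ l' : T ⟶ ((evaluationRightAdjoint M x).obj Z).obj y, ∀ h, l' ≫ powerπ Z h = l h :=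
  ⟨Pi.lift l, Pi.lift_π _⟩

end Powers

section Copowers

variable {C : Type v} [SmallCategory C] {M : Type u} [Category.{v} M] [HasCoproducts.{v} M] {x : C}

/-- The inclusions in the copowers of `Z` by the sets of morphisms from `x`. -/
noncomputable def copowerι (Z : M) {y : C} (g : x ⟶ y) :
    Z ⟶ ((evaluationLeftAdjoint M x).obj Z).obj y :=
  Sigma.ι (fun _ : x ⟶ y => Z) g

lemma copowerι_map (Z : M) {y z : C} (g : x ⟶ y) (h : y ⟶ z) :
    copowerι Z g ≫ ((evaluationLeftAdjoint M x).obj Z).map h = copowerι Z (g ≫ h) :=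
  Sigma.ι_desc _ _

lemma copowerι_app {K L : M} (i : K ⟶ L) {y : C} (g : x ⟶ y) :
    copowerι K g ≫ ((evaluationLeftAdjoint M x).map i).app y = i ≫ copowerι L g :=
  Sigma.ι_desc _ _

lemma copower_hom_ext {Z T : M} {y : C} {l l' : ((evaluationLeftAdjoint M x).obj Z).obj y ⟶ T}
    (h : ∀ k : x ⟶ y, copowerι Z k ≫ l = copowerι Z k ≫ l') : l = l' :=
  Sigma.hom_ext _ _ h

lemma exists_copower_desc {Z T : M} {y : C} (l : (x ⟶ y) → (Z ⟶ T)) :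
    ∃ l' : ((evaluationLeftAdjoint M x).obj Z).obj y ⟶ T, ∀ g, copowerι Z g ≫ l' = l g :=
  ⟨Sigma.desc l, Sigma.ι_desc _⟩

lemma exists_copower_natTrans {D : Type w} [Category.{w'} D] {J : D ⥤ C} {Z : M} {Y : D ⥤ M}
    (l : J ⋙ coyoneda.obj (op x) ⟶ Y ⋙ coyoneda.obj (op Z)) :
    ∃ l' : J ⋙ (evaluationLeftAdjoint M x).obj Z ⟶ Y,
      ∀ d (g : x ⟶ J.obj d), copowerι Z g ≫ l'.app d = l.app d g := by
  choose l' hl' using fun d => exists_copower_desc (fun g : x ⟶ J.obj d => l.app d g)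
  refine ⟨{ app := l', naturality := fun d e k => copower_hom_ext fun g => ?_ }, hl'⟩
  calc copowerι Z g ≫ ((evaluationLeftAdjoint M x).obj Z).map (J.map k) ≫ l' e
      = l.app e (g ≫ J.map k) := by rw [← Category.assoc, copowerι_map, hl']
    _ = l.app d g ≫ Y.map k := ConcreteCategory.congr_hom (l.naturality k) g
    _ = copowerι Z g ≫ l' d ≫ Y.map k := by rw [← hl', Category.assoc]

end Copowers

namespace Stratification

variable {C : Type v} [SmallCategory C] {S : Stratification C} {x : C}

lemma exists_yoneda_lift
    (hx : (S.restrict (S.deg x)).cReedyR (MorphismProperty.monomorphisms (Type v)).op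
      (terminal.from ((S.belowι (S.deg x)).op ⋙ yoneda.obj x).rightOp))
    {y : C} (hy : S.deg y < S.deg x) {E Q : Type v} (e : E ⟶ Q) [Epi e] (b : (y ⟶ x) → Q)
    (r : ∀ z : S.Below (S.deg y), (y ⟶ z.obj) → (z.obj ⟶ x) → E)
    (r_comp : ∀ {z z' : S.Below (S.deg y)} (g : y ⟶ z.obj) (k : z ⟶ z') (h : z'.obj ⟶ x),
      r z g (k.hom ≫ h) = r z' (g ≫ k.hom) h)
    (hr : ∀ z g h, e (r z g h) = b (g ≫ h)) :
    ∃ l : (y ⟶ x) → E, (∀ h, e (l h) = b h) ∧ ∀ z g h, l (g ≫ h) = r z g h := by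
  let F := ((S.belowι (S.deg x)).op ⋙ yoneda.obj x).rightOp
  let y' : S.Below (S.deg x) := ⟨y, hy⟩
  have lifts : HasLiftingProperty e.op
      ((S.restrict (S.deg x)).matchingMap (terminal.from F) y') := by
    have : Mono ((S.restrict (S.deg x)).matchingMap (terminal.from F) y').unop := hx y'
    rw [HasLiftingProperty.iff_unop]
    exact hasLiftingProperty_of_mono_of_epi _ _
  rw [hasLiftingProperty_matchingMap_iff] at lifts
  have isTerminal (z : S.Below (S.deg x)) :
      IsTerminal ((⊤_ (S.Below (S.deg x) ⥤ (Type v)ᵒᵖ)).obj z) :=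
    terminalIsTerminal.isTerminalObj ((evaluation _ _).obj z)
  obtain ⟨l, hl, hl'⟩ := lifts (Quiver.Hom.op (↾ b))
    { base := (isTerminal y').from _
      proj := fun z g => Quiver.Hom.op (↾ fun h => r ⟨z.obj.obj, z.property⟩ g.hom h)
      proj_map := fun {z z'} g k => Quiver.Hom.unop_inj (ConcreteCategory.hom_ext _ _ fun h =>
        r_comp (z := ⟨z.obj.obj, z.property⟩) (z' := ⟨z'.obj.obj, z'.property⟩) g.hom
          ⟨k.hom.hom⟩ h)
      proj_app := fun z g => (isTerminal _).hom_ext _ _ } (by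
    ext1
    · exact (isTerminal _).hom_ext _ _
    · funext z g
      exact Quiver.Hom.unop_inj (ConcreteCategory.hom_ext _ _ fun h =>
        (hr ⟨z.obj.obj, z.property⟩ g.hom h).symm))
  refine ⟨fun h => l.unop h, ConcreteCategory.congr_hom (congrArg Quiver.Hom.unop hl),
    fun z g h => ?_⟩
  have proj := congrArg (fun c => c.proj ⟨⟨z.obj, z.property.trans hy⟩, z.property⟩ ⟨g⟩) hl'
  exact ConcreteCategory.congr_hom (congrArg Quiver.Hom.unop proj) h

lemma exists_coyoneda_lift
    (hx : (S.restrict (S.deg x)).cReedyL (MorphismProperty.epimorphisms (Type v))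
      (initial.to (S.belowι (S.deg x) ⋙ coyoneda.obj (op x))))
    {δ : Ordinal.{v}} (hδ : δ < S.deg x) {Y Z : S.Stratum δ ⥤ Type v} (q : Y ⟶ Z)
    (hq : (MorphismProperty.epimorphisms (Type v)).functorCategory _ q)
    (b : S.stratumι δ ⋙ coyoneda.obj (op x) ⟶ Z)
    (r : ∀ (z : S.Below δ) (d : S.Stratum δ), (x ⟶ z.obj) → (z.obj ⟶ d.obj) → Y.obj d)
    (comp_r : ∀ {z z' : S.Below δ} {d : S.Stratum δ} (g : x ⟶ z.obj) (k : z ⟶ z')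
      (h : z'.obj ⟶ d.obj), r z' d (g ≫ k.hom) h = r z d g (k.hom ≫ h))
    (map_r : ∀ {z : S.Below δ} {d d' : S.Stratum δ} (g : x ⟶ z.obj) (h : z.obj ⟶ d.obj)
      (e : d ⟶ d'), Y.map e (r z d g h) = r z d' g (h ≫ e.1))
    (hr : ∀ z d g h, q.app d (r z d g h) = b.app d (g ≫ h)) :
    ∃ l : S.stratumι δ ⋙ coyoneda.obj (op x) ⟶ Y,
      l ≫ q = b ∧ ∀ z d (g : x ⟶ z.obj) (h : z.obj ⟶ d.obj), l.app d (g ≫ h) = r z d g h := by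
  let W : S.Below (S.deg x) ⥤ Type v := S.belowι (S.deg x) ⋙ coyoneda.obj (op x)
  let J : (S.restrict (S.deg x)).Stratum δ ⥤ S.Stratum δ :=
    { obj d := ⟨d.obj.obj, d.deg_obj⟩
      map e := ⟨e.1.hom, e.2⟩ }
  have isInitial (z : S.Below (S.deg x)) : IsInitial ((⊥_ (S.Below (S.deg x) ⥤ Type v)).obj z) :=
    initialIsInitial.isInitialObj ((evaluation _ _).obj z)
  obtain ⟨l, hl, hl'⟩ := ((S.restrict (S.deg x)).projectiveL_latchingMap_iff δ (initial.to W)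
    ((S.restrict (S.deg x)).stratumι δ) _).1 (hx δ) (Functor.whiskerLeft J q) (fun d => hq _)
    (Functor.whiskerLeft J b)
    { base :=
        { app d := (isInitial _).to _
          naturality _ _ _ := (isInitial _).hom_ext _ _ }
      incl z d h := ↾ fun g => r ⟨z.obj.obj, z.property⟩ (J.obj d) g h.hom
      map_incl {z z'} k d h := ConcreteCategory.hom_ext _ _ fun g =>
        comp_r (z := ⟨z.obj.obj, z.property⟩) (z' := ⟨z'.obj.obj, z'.property⟩) (d := J.obj d) g
          ⟨k.hom.hom⟩ h.hom
      incl_map z d d' h e := ConcreteCategory.hom_ext _ _ fun g =>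
        map_r (z := ⟨z.obj.obj, z.property⟩) (d := J.obj d) g h.hom (J.map e)
      app_incl z d h := (isInitial _).hom_ext _ _ } (by
    ext1
    · ext1
      exact funext fun d => (isInitial _).hom_ext _ _
    · funext z d h
      exact ConcreteCategory.hom_ext _ _ fun g =>
        hr ⟨z.obj.obj, z.property⟩ (J.obj d) g h.hom)
  let J' : S.Stratum δ ⥤ (S.restrict (S.deg x)).Stratum δ :=
    { obj d := ⟨⟨d.obj, d.deg_obj.trans_lt hδ⟩, d.deg_obj⟩
      map e := ⟨⟨e.1⟩, e.2⟩ }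
  refine ⟨Functor.whiskerLeft J' l, congrArg (Functor.whiskerLeft J') hl, fun z d g h => ?_⟩
  have incl := congrArg (fun c => c.incl ⟨⟨z.obj, z.property.trans hδ⟩, z.property⟩
    (J'.obj d) ⟨h⟩) hl'
  exact ConcreteCategory.congr_hom incl g

section

variable {M : Type u} [Category.{v} M]

lemma isRight_matchingCone_evaluationRightAdjoint_map [HasProducts.{v} M]
    (hx : (S.restrict (S.deg x)).cReedyR (MorphismProperty.monomorphisms (Type v)).op
      (terminal.from ((S.belowι (S.deg x)).op ⋙ yoneda.obj x).rightOp))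
    {y : C} (hy : S.deg y < S.deg x) {R : MorphismProperty M} {X Y : M} {p : X ⟶ Y} (hp : R p) :
    (matchingCone (S.below (S.deg y)) ((evaluationRightAdjoint M x).map p) y).IsRight R := by
  intro K L i hi t c hc
  have := hi p hp
  have := epi_diagonalToSquare i p
  have base : t ≫ ((evaluationRightAdjoint M x).map p).app y = i ≫ c.base :=
    congrArg MatchingCone.base hc
  let proj (z : S.Below (S.deg y)) (g : y ⟶ z.obj) :
    L ⟶ ((evaluationRightAdjoint M x).obj X).obj z.obj := c.proj z g
  have proj_eq (z) (g) : t ≫ ((evaluationRightAdjoint M x).obj X).map g = i ≫ proj z g :=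
    congrArg (fun c => c.proj z g) hc
  have proj_map {z z' : S.Below (S.deg y)} (g : y ⟶ z.obj) (k : z ⟶ z') :
    proj z g ≫ ((evaluationRightAdjoint M x).obj X).map k.hom = proj z' (g ≫ k.hom) :=
    c.proj_map g k
  have proj_app (z) (g) : proj z g ≫ ((evaluationRightAdjoint M x).map p).app z.obj =
    c.base ≫ ((evaluationRightAdjoint M x).obj Y).map g := c.proj_app z g
  obtain ⟨l, hl, hl'⟩ := exists_yoneda_lift hx hy (diagonalToSquare i p)
    (fun h => ⟨(t ≫ powerπ X h, c.base ≫ powerπ Y h), by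
      dsimp only
      rw [Category.assoc, ← app_powerπ, reassoc_of% base]⟩)
    (fun z g h => proj z g ≫ powerπ X h)
    (fun {z z'} g k h => by rw [← map_powerπ, reassoc_of% proj_map])
    (fun z g h => Subtype.ext (Prod.ext
      (show i ≫ proj z g ≫ powerπ X h = t ≫ powerπ X (g ≫ h) by
        rw [← map_powerπ, reassoc_of% proj_eq])
      (show (proj z g ≫ powerπ X h) ≫ p = c.base ≫ powerπ Y (g ≫ h) by
        rw [← map_powerπ, Category.assoc, ← app_powerπ, reassoc_of% proj_app])))
  obtain ⟨l', h_l'⟩ := exists_power_lift l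
  refine ⟨l', power_hom_ext fun h => ?_, MatchingCone.ext (power_hom_ext fun h => ?_)
    (funext₂ fun z g => power_hom_ext fun h => ?_)⟩
  · rw [Category.assoc, h_l']
    exact congrArg (fun q => q.1.1) (hl h)
  · change (l' ≫ ((evaluationRightAdjoint M x).map p).app y) ≫ powerπ Y h = _
    rw [Category.assoc, app_powerπ, reassoc_of% h_l']
    exact congrArg (fun q => q.1.2) (hl h)
  · change (l' ≫ ((evaluationRightAdjoint M x).obj X).map g) ≫ powerπ X h = _
    rw [Category.assoc, map_powerπ, h_l', hl']

lemma exists_coyoneda_lift_of_llp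
    (hx : (S.restrict (S.deg x)).cReedyL (MorphismProperty.epimorphisms (Type v))
      (initial.to (S.belowι (S.deg x) ⋙ coyoneda.obj (op x))))
    {δ : Ordinal.{v}} (hδ : δ < S.deg x) {R : MorphismProperty M} {K L : M} {i : K ⟶ L}
    (hi : R.llp i) {Y Z : S.Stratum δ ⥤ M} {q : Y ⟶ Z} (hq : R.functorCategory _ q)
    (a : ∀ d : S.Stratum δ, (x ⟶ d.obj) → (K ⟶ Y.obj d))
    (b : ∀ d : S.Stratum δ, (x ⟶ d.obj) → (L ⟶ Z.obj d))
    (r : ∀ (z : S.Below δ) (d : S.Stratum δ), (x ⟶ z.obj) → (z.obj ⟶ d.obj) → (L ⟶ Y.obj d))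
    (w : ∀ d g, a d g ≫ q.app d = i ≫ b d g)
    (a_map : ∀ {d d' : S.Stratum δ} (g : x ⟶ d.obj) (e : d ⟶ d'),
      a d' (g ≫ e.1) = a d g ≫ Y.map e)
    (b_map : ∀ {d d' : S.Stratum δ} (g : x ⟶ d.obj) (e : d ⟶ d'),
      b d' (g ≫ e.1) = b d g ≫ Z.map e)
    (comp_r : ∀ {z z' : S.Below δ} {d : S.Stratum δ} (g : x ⟶ z.obj) (k : z ⟶ z')
      (h : z'.obj ⟶ d.obj), r z' d (g ≫ k.hom) h = r z d g (k.hom ≫ h))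
    (map_r : ∀ {z : S.Below δ} {d d' : S.Stratum δ} (g : x ⟶ z.obj) (h : z.obj ⟶ d.obj)
      (e : d ⟶ d'), r z d g h ≫ Y.map e = r z d' g (h ≫ e.1))
    (hr : ∀ z d g h, i ≫ r z d g h = a d (g ≫ h))
    (hr' : ∀ z d g h, r z d g h ≫ q.app d = b d (g ≫ h)) :
    ∃ l : S.stratumι δ ⋙ coyoneda.obj (op x) ⟶ Y ⋙ coyoneda.obj (op L),
      (∀ d (g : x ⟶ d.obj), i ≫ l.app d g = a d g) ∧
      (∀ d (g : x ⟶ d.obj), l.app d g ≫ q.app d = b d g) ∧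
      ∀ z d (g : x ⟶ z.obj) (h : z.obj ⟶ d.obj), l.app d (g ≫ h) = r z d g h := by
  let square : S.stratumι δ ⋙ coyoneda.obj (op x) ⟶ squares i q :=
    { app d := ↾ fun g => ⟨(a d g, b d g), w d g⟩
      naturality _ _ e := ConcreteCategory.hom_ext _ _ fun g =>
        Subtype.ext (Prod.ext (a_map g e) (b_map g e)) }
  obtain ⟨l, hl, hl'⟩ := exists_coyoneda_lift hx hδ (diagonalsToSquares i q)
    (functorCategory_epimorphisms_diagonalsToSquares hi hq) square r comp_r map_r
    (fun z d g h => Subtype.ext (Prod.ext (hr z d g h) (hr' z d g h)))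
  have square_eq (d : S.Stratum δ) (g : x ⟶ d.obj) :
      diagonalToSquare i (q.app d) (l.app d g) = square.app d g :=
    ConcreteCategory.congr_hom (congr_app hl d) g
  exact ⟨l, fun d g => congrArg (fun s => s.1.1) (square_eq d g),
    fun d g => congrArg (fun s => s.1.2) (square_eq d g), hl'⟩

lemma exists_coyoneda_lift_of_latchingCocone [HasCoproducts.{v} M]
    (hx : (S.restrict (S.deg x)).cReedyL (MorphismProperty.epimorphisms (Type v))
      (initial.to (S.belowι (S.deg x) ⋙ coyoneda.obj (op x))))
    {δ : Ordinal.{v}} (hδ : δ < S.deg x) {R : MorphismProperty M} {K L : M} {i : K ⟶ L}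
    (hi : R.llp i) {Y Z : S.Stratum δ ⥤ M} {q : Y ⟶ Z} (hq : R.functorCategory _ q)
    {b : S.stratumι δ ⋙ (evaluationLeftAdjoint M x).obj L ⟶ Z}
    {c : LatchingCocone (Functor.whiskerLeft (S.below δ).ι ((evaluationLeftAdjoint M x).map i))
      (S.stratumι δ) Y}
    (hc : c.postcomp q = (latchingCocone (S.below δ) _ (S.stratumι δ)).postcomp b) :
    ∃ l : S.stratumι δ ⋙ coyoneda.obj (op x) ⟶ Y ⋙ coyoneda.obj (op L),
      (∀ d (g : x ⟶ d.obj), i ≫ l.app d g = copowerι K g ≫ c.base.app d) ∧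
      (∀ d (g : x ⟶ d.obj), l.app d g ≫ q.app d = copowerι L g ≫ b.app d) ∧
      ∀ z d (g : x ⟶ z.obj) (h : z.obj ⟶ d.obj), l.app d (g ≫ h) = copowerι L g ≫ c.incl z d h := by
  let b' (d : S.Stratum δ) : ((evaluationLeftAdjoint M x).obj L).obj d.obj ⟶ Z.obj d := b.app d
  let base (d : S.Stratum δ) : ((evaluationLeftAdjoint M x).obj K).obj d.obj ⟶ Y.obj d :=
    c.base.app d
  let incl (z : S.Below δ) (d : S.Stratum δ) (h : z.obj ⟶ d.obj) :
    ((evaluationLeftAdjoint M x).obj L).obj z.obj ⟶ Y.obj d := c.incl z d h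
  have b'_map {d d' : S.Stratum δ} (e : d ⟶ d') :
    ((evaluationLeftAdjoint M x).obj L).map e.1 ≫ b' d' = b' d ≫ Z.map e := b.naturality e
  have base_map {d d' : S.Stratum δ} (e : d ⟶ d') :
    ((evaluationLeftAdjoint M x).obj K).map e.1 ≫ base d' = base d ≫ Y.map e :=
    c.base.naturality e
  have map_incl {z z' : S.Below δ} {d : S.Stratum δ} (k : z ⟶ z') (h : z'.obj ⟶ d.obj) :
    ((evaluationLeftAdjoint M x).obj L).map k.hom ≫ incl z' d h = incl z d (k.hom ≫ h) :=
    c.map_incl k h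
  have incl_map {z : S.Below δ} {d d' : S.Stratum δ} (h : z.obj ⟶ d.obj) (e : d ⟶ d') :
    incl z d h ≫ Y.map e = incl z d' (h ≫ e.1) := c.incl_map z h e
  have base_app (d : S.Stratum δ) :
    base d ≫ q.app d = ((evaluationLeftAdjoint M x).map i).app d.obj ≫ b' d :=
    congr_app (congrArg LatchingCocone.base hc) d
  have app_incl (z : S.Below δ) (d : S.Stratum δ) (h : z.obj ⟶ d.obj) :
    ((evaluationLeftAdjoint M x).map i).app z.obj ≫ incl z d h =
      ((evaluationLeftAdjoint M x).obj K).map h ≫ base d := c.app_incl z h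
  have incl_app (z : S.Below δ) (d : S.Stratum δ) (h : z.obj ⟶ d.obj) :
    incl z d h ≫ q.app d = ((evaluationLeftAdjoint M x).obj L).map h ≫ b' d :=
    congrArg (fun c => c.incl z d h) hc
  exact exists_coyoneda_lift_of_llp hx hδ hi hq
    (fun d g => copowerι K g ≫ base d) (fun d g => copowerι L g ≫ b' d)
    (fun z d g h => copowerι L g ≫ incl z d h)
    (fun d g => by rw [Category.assoc, base_app, ← Category.assoc, copowerι_app, Category.assoc])
    (fun g e => by rw [← copowerι_map, Category.assoc, base_map, Category.assoc])
    (fun g e => by rw [← copowerι_map, Category.assoc, b'_map, Category.assoc])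
    (fun g k h => by rw [← copowerι_map, Category.assoc, map_incl])
    (fun g h e => by rw [Category.assoc, incl_map])
    (fun z d g h => by
      rw [← copowerι_map, Category.assoc, ← app_incl, ← Category.assoc, ← copowerι_app,
        Category.assoc])
    (fun z d g h => by rw [← copowerι_map, Category.assoc, Category.assoc, incl_app])

lemma isLeft_latchingCocone_evaluationLeftAdjoint_map [HasCoproducts.{v} M]
    (hx : (S.restrict (S.deg x)).cReedyL (MorphismProperty.epimorphisms (Type v))
      (initial.to (S.belowι (S.deg x) ⋙ coyoneda.obj (op x))))
    {δ : Ordinal.{v}} (hδ : δ < S.deg x) {R : MorphismProperty M} {K L : M} {i : K ⟶ L}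
    (hi : R.llp i) :
    (latchingCocone (S.below δ) ((evaluationLeftAdjoint M x).map i) (S.stratumι δ)).IsLeft R := by
  intro Y Z q hq b c hc
  obtain ⟨l, hl, hlq, hl'⟩ := exists_coyoneda_lift_of_latchingCocone hx hδ hi hq hc
  obtain ⟨l', h_l'⟩ := exists_copower_natTrans l
  refine ⟨l', NatTrans.ext (funext fun d => copower_hom_ext fun g => ?_), LatchingCocone.ext
    (NatTrans.ext (funext fun d => copower_hom_ext fun g => ?_))
    (funext fun z => funext₂ fun d h => copower_hom_ext fun g => ?_)⟩
  · change copowerι L g ≫ l'.app d ≫ q.app d = _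
    rw [← Category.assoc, h_l']
    exact hlq d g
  · change copowerι K g ≫ ((evaluationLeftAdjoint M x).map i).app d.obj ≫ l'.app d = _
    refine ((Category.assoc _ _ _).symm.trans
      (congrArg (· ≫ l'.app d) (copowerι_app i g))).trans ((Category.assoc _ _ _).trans ?_)
    exact (congrArg (i ≫ ·) (h_l' d g)).trans (hl d g)
  · change copowerι L g ≫ ((evaluationLeftAdjoint M x).obj L).map h ≫ l'.app d = _
    rw [← Category.assoc, copowerι_map]
    exact (h_l' d (g ≫ h)).trans (hl' z d g h)

end

section

variable {M : Type u} [Category.{v} M] {A B X Y : C ⥤ M} {f : A ⟶ B} {p : X ⟶ Y}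
  {R : MorphismProperty M}

lemma HasThroughDecomposition.hasLiftingProperty [HasLimits M] (hS : S.HasThroughDecomposition)
    (hR : R.llp.rlp = R)
    (hf : ∀ δ, (latchingCocone (S.below δ) f (S.stratumι δ)).IsLeft R)
    (hp : ∀ x, (matchingCone (S.below (S.deg x)) p x).IsRight R) : HasLiftingProperty f p where
  sq_hasLift {a b} sq := by
    let β := ⨆ x, S.deg x + 1
    have hβ (x : C) : S.deg x < β := Ordinal.lt_iSup_add_one S.deg x
    obtain ⟨l, hl₁, hl₂⟩ := hS.exists_lift_below hR (β := β) (f := f) (p := p)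
      (a := Functor.whiskerLeft _ a) (b := Functor.whiskerLeft _ b)
      (by rw [← Functor.whiskerLeft_comp, ← Functor.whiskerLeft_comp, sq.w])
      (fun δ _ => hf δ) (fun x _ => hp x)
    refine ⟨⟨{ l := { app := fun x => l.app ⟨x, hβ x⟩
                      naturality := fun x y k =>
                        l.naturality (X := ⟨x, hβ x⟩) (Y := ⟨y, hβ y⟩) ⟨k⟩ }
               fac_left := ?_, fac_right := ?_ }⟩⟩
    · ext x
      exact congr_app hl₁ ⟨x, hβ x⟩
    · ext x
      exact congr_app hl₂ ⟨x, hβ x⟩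

variable [HasLimits M] [HasColimits M]

lemma IsAlmostCReedy.latching_map_app_mem (hS : S.IsAlmostCReedy) (hR : R.llp.rlp = R) (x : C)
    (hf : ∀ δ < S.deg x, projectiveL R (S.Stratum δ) (S.stratumLatchingMap δ f)) :
    R.llp (((S.latching (S.deg x)).map f).app x) := by
  intro X Y p hp
  let ι := S.belowι (S.deg x)
  have : HasLiftingProperty (Functor.whiskerLeft ι f)
      (Functor.whiskerLeft ι ((evaluationRightAdjoint M x).map p)) := ⟨fun {a b} sq => by
    obtain ⟨l, hl, hl'⟩ := hS.isBistratified.hasThroughDecomposition.exists_lift_below hR sq.w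
      (fun δ hδ => (S.projectiveL_latchingMap_iff δ f _ R).1 (hf δ hδ))
      (fun y hy => isRight_matchingCone_evaluationRightAdjoint_map (hS.yoneda x) hy hp)
    exact ⟨⟨⟨l, hl, hl'⟩⟩⟩⟩
  exact (((ι.lanAdjunction M).comp (evaluationAdjunctionLeft M x)).hasLiftingProperty_iff
    (Functor.whiskerLeft ι f) p).2 this

lemma IsAlmostCReedy.matching_map_app_mem (hS : S.IsAlmostCReedy) (hR : R.llp.rlp = R) (x : C)
    (hp : ∀ y, S.deg y < S.deg x → R (S.matchingMap p y)) :
    R (((S.matching (S.deg x)).map p).app x) := by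
  rw [← hR]
  intro K L i hi
  let ι := S.belowι (S.deg x)
  have : HasLiftingProperty (Functor.whiskerLeft ι ((evaluationLeftAdjoint M x).map i))
      (Functor.whiskerLeft ι p) := ⟨fun {a b} sq => by
    obtain ⟨l, hl, hl'⟩ := hS.isBistratified.hasThroughDecomposition.exists_lift_below hR sq.w
      (fun δ hδ => isLeft_latchingCocone_evaluationLeftAdjoint_map (hS.coyoneda x) hδ hi)
      (fun y hy => (S.matchingMap_mem_iff p hR y).1 (hp y hy))
    exact ⟨⟨⟨l, hl, hl'⟩⟩⟩⟩
  exact (((evaluationAdjunctionRight M x).comp (ι.ranAdjunction M)).hasLiftingProperty_iff i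
    (Functor.whiskerLeft ι p)).1 this

end

end Stratification

/-! ### Factorizations by transfinite recursion -/

namespace Stratification

variable {C : Type v} [SmallCategory C] {S : Stratification C} {M : Type u} [Category.{v} M]

/-- A factorization of `f` over the objects of degree `< δ`. -/
structure PartialFactorization (S : Stratification C) {A B : C ⥤ M} (f : A ⟶ B)
    (δ : Ordinal.{v}) where
  E : S.Below δ ⥤ M
  i : S.belowι δ ⋙ A ⟶ E
  p : E ⟶ S.belowι δ ⋙ B
  fac : i ≫ p = Functor.whiskerLeft _ f

namespace PartialFactorization

variable {A B : C ⥤ M} {f : A ⟶ B} {δ ε : Ordinal.{v}}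

lemma ext_of_eqToHom {l l' : PartialFactorization S f δ} (obj : ∀ z, l.E.obj z = l'.E.obj z)
    (map : ∀ {z z'} (k : z ⟶ z'),
      l.E.map k = eqToHom (obj z) ≫ l'.E.map k ≫ eqToHom (obj z').symm)
    (i : ∀ z, l.i.app z = l'.i.app z ≫ eqToHom (obj z).symm)
    (p : ∀ z, l.p.app z = eqToHom (obj z) ≫ l'.p.app z) : l = l' := by
  obtain ⟨E, il, pl, _⟩ := l
  obtain ⟨E', il', pl', _⟩ := l'
  obtain rfl : E = E' := CategoryTheory.Functor.ext obj fun _ _ => map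
  obtain rfl : il = il' := by
    ext z
    simpa using i z
  obtain rfl : pl = pl' := by
    ext z
    simpa using p z
  rfl

/-- The restriction of a partial factorization to lower degrees. -/
@[simps, reducible]
def restrict (h : ε ≤ δ) (l : PartialFactorization S f δ) : PartialFactorization S f ε where
  E := S.belowOfLE h ⋙ l.E
  i :=
    { app z := l.i.app ((S.belowOfLE h).obj z)
      naturality _ _ k := l.i.naturality ((S.belowOfLE h).map k) }
  p :=
    { app z := l.p.app ((S.belowOfLE h).obj z)
      naturality _ _ k := l.p.naturality ((S.belowOfLE h).map k) }
  fac := by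
    ext z
    exact congr_app l.fac ((S.belowOfLE h).obj z)

/-- The latching cocone of the left factor of `l` over the stratum of degree `γ < δ`. -/
def latchingCocone (l : PartialFactorization S f δ) {γ : Ordinal.{v}} (hγ : γ < δ) :
    LatchingCocone (l.restrict hγ.le).i (S.stratumι γ) (S.stratumToBelow hγ ⋙ l.E) where
  base :=
    { app d := l.i.app ((S.stratumToBelow hγ).obj d)
      naturality _ _ k := l.i.naturality ((S.stratumToBelow hγ).map k) }
  incl z d h := l.E.map (X := (S.belowOfLE hγ.le).obj z) (Y := (S.stratumToBelow hγ).obj d) ⟨h⟩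
  map_incl _ _ _ := (l.E.map_comp _ _).symm
  incl_map _ _ _ _ _ := (l.E.map_comp _ _).symm
  app_incl z d h := (l.i.naturality
    (X := (S.belowOfLE hγ.le).obj z) (Y := (S.stratumToBelow hγ).obj d) ⟨h⟩).symm

/-- The matching cone of the right factor of `l` at `x` over the objects of degree `< γ`. -/
def matchingCone (l : PartialFactorization S f δ) {γ : Ordinal.{v}} (hγ : γ ≤ δ) (x : S.Below δ) :
    MatchingCone (l.restrict hγ).p x.obj (l.E.obj x) where
  base := l.p.app x
  proj z g := l.E.map (Y := (S.belowOfLE hγ).obj z) ⟨g⟩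
  proj_map _ _ := (l.E.map_comp _ _).symm
  proj_app z g := l.p.naturality (Y := (S.belowOfLE hγ).obj z) ⟨g⟩

/-- The left factor is a c-Reedy `R.llp`-map and the right factor a c-Reedy `R`-map, in
degrees `< δ`. -/
structure IsReedy (l : PartialFactorization S f δ) (R : MorphismProperty M) : Prop where
  latching {γ : Ordinal.{v}} (hγ : γ < δ) : (l.latchingCocone hγ).IsLeft R
  matching {γ : Ordinal.{v}} (hγ : γ < δ) (x : S.Below δ) (hx : S.deg x.obj = γ) :
    (l.matchingCone hγ.le x).IsRight R

lemma IsReedy.restrict {l : PartialFactorization S f δ} {R : MorphismProperty M}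
    (h : l.IsReedy R) (hε : ε ≤ δ) : (l.restrict hε).IsReedy R where
  latching hγ := h.latching (hγ.trans_le hε)
  matching hγ x hx := h.matching (hγ.trans_le hε) ((S.belowOfLE hε).obj x) hx

lemma isReedy_of_restrict {l : PartialFactorization S f δ} {R : MorphismProperty M}
    (h : ∀ γ < δ, ∃ (ε : Ordinal.{v}) (hε : ε ≤ δ), γ < ε ∧ (l.restrict hε).IsReedy R) :
    l.IsReedy R where
  latching hγ := by
    obtain ⟨ε, hε, hγ', h⟩ := h _ hγ
    exact h.latching hγ'
  matching hγ x hx := by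
    obtain ⟨ε, hε, hγ', h⟩ := h _ hγ
    exact h.matching hγ' ⟨x.obj, hx.trans_lt hγ'⟩ hx

section RestrictEq

variable {h : ε ≤ δ} {l : PartialFactorization S f δ} {l' : PartialFactorization S f ε}

lemma obj_eq_of_restrict_eq (e : l.restrict h = l') (z : S.Below ε) :
    l'.E.obj z = l.E.obj ((S.belowOfLE h).obj z) := by
  subst e
  rfl

lemma map_eq_of_restrict_eq (e : l.restrict h = l') {z z' : S.Below ε} (k : z ⟶ z') :
    l'.E.map k = eqToHom (obj_eq_of_restrict_eq e z) ≫ l.E.map ((S.belowOfLE h).map k) ≫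
      eqToHom (obj_eq_of_restrict_eq e z').symm := by
  subst e
  exact ((Category.id_comp _).trans (Category.comp_id _)).symm

lemma i_app_eq_of_restrict_eq (e : l.restrict h = l') (z : S.Below ε) :
    l'.i.app z = l.i.app ((S.belowOfLE h).obj z) ≫
      eqToHom (obj_eq_of_restrict_eq e z).symm := by
  subst e
  exact (Category.comp_id _).symm

lemma p_app_eq_of_restrict_eq (e : l.restrict h = l') (z : S.Below ε) :
    l'.p.app z = eqToHom (obj_eq_of_restrict_eq e z) ≫ l.p.app ((S.belowOfLE h).obj z) := by
  subst e
  exact (Category.id_comp _).symm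

end RestrictEq

/-- A coherent family of partial factorizations over all stages below a limit ordinal. -/
structure CoherentFamily (S : Stratification C) (f : A ⟶ B) (δ : Ordinal.{v}) where
  isSuccLimit : Order.IsSuccLimit δ
  stage (j : Ordinal.{v}) (hj : j < δ) : PartialFactorization S f j
  restrict_stage {j j' : Ordinal.{v}} (hj' : j' < δ) (hjj' : j ≤ j') :
    (stage j' hj').restrict hjj' = stage j (hjj'.trans_lt hj')

namespace CoherentFamily

variable (L : CoherentFamily S f δ) (x y z : S.Below δ)

/-- The value of the limit at `x`, read off at the first stage containing `x`. -/
def obj : M :=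
  (L.stage _ (L.isSuccLimit.succ_lt x.property)).E.obj ⟨x.obj, Order.lt_succ _⟩

variable {x y} {j j' : Ordinal.{v}} (hj : j < δ) (hj' : j' < δ)

lemma obj_eq (hx : S.deg x.obj < j) : L.obj x = (L.stage j hj).E.obj ⟨x.obj, hx⟩ :=
  obj_eq_of_restrict_eq (L.restrict_stage hj (Order.succ_le_of_lt hx)) ⟨x.obj, Order.lt_succ _⟩

/-- The action of the limit on a morphism, read off at a stage `j`. -/
def mapAt (k : x ⟶ y) (hx : S.deg x.obj < j) (hy : S.deg y.obj < j) : L.obj x ⟶ L.obj y :=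
  eqToHom (L.obj_eq hj hx) ≫
    (L.stage j hj).E.map (X := ⟨x.obj, hx⟩) (Y := ⟨y.obj, hy⟩) ⟨k.hom⟩ ≫
      eqToHom (L.obj_eq hj hy).symm

lemma mapAt_eq (k : x ⟶ y) (hx : S.deg x.obj < j) (hy : S.deg y.obj < j)
    (hx' : S.deg x.obj < j') (hy' : S.deg y.obj < j') :
    L.mapAt hj k hx hy = L.mapAt hj' k hx' hy' := by
  wlog hjj : j ≤ j' generalizing j j'
  · exact (this hj' hj hx' hy' hx hy (le_of_not_ge hjj)).symm
  · have := map_eq_of_restrict_eq (L.restrict_stage hj' hjj)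
      (z := ⟨x.obj, hx⟩) (z' := ⟨y.obj, hy⟩) ⟨k.hom⟩
    simp only [mapAt, this, Category.assoc, eqToHom_trans, eqToHom_trans_assoc]

variable (x) in
lemma mapAt_id (hx : S.deg x.obj < j) : L.mapAt hj (𝟙 x) hx hx = 𝟙 _ := by
  have := (L.stage j hj).E.map_id ⟨x.obj, hx⟩
  refine (congrArg (fun t => _ ≫ t ≫ _) this).trans ?_
  simp only [Category.id_comp, eqToHom_trans, eqToHom_refl]

variable {z} in
lemma mapAt_comp (k : x ⟶ y) (k' : y ⟶ z) (hx : S.deg x.obj < j) (hy : S.deg y.obj < j)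
    (hz : S.deg z.obj < j) :
    L.mapAt hj (k ≫ k') hx hz = L.mapAt hj k hx hy ≫ L.mapAt hj k' hy hz := by
  simp only [mapAt, Category.assoc, eqToHom_trans_assoc, eqToHom_refl, Category.id_comp]
  rw [← Functor.map_comp_assoc]
  rfl

variable (x) in
/-- The left factor of the limit at `x`, read off at a stage `j`. -/
def iAt (hx : S.deg x.obj < j) : A.obj x.obj ⟶ L.obj x :=
  (L.stage j hj).i.app ⟨x.obj, hx⟩ ≫ eqToHom (L.obj_eq hj hx).symm

variable (x) in
lemma iAt_eq (hx : S.deg x.obj < j) :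
    L.iAt x (L.isSuccLimit.succ_lt x.property) (Order.lt_succ _) = L.iAt x hj hx := by
  have := i_app_eq_of_restrict_eq (L.restrict_stage hj (Order.succ_le_of_lt hx))
    ⟨x.obj, Order.lt_succ _⟩
  rw [iAt, this, iAt, Category.assoc, eqToHom_trans]

lemma iAt_mapAt (k : x ⟶ y) (hx : S.deg x.obj < j) (hy : S.deg y.obj < j) :
    L.iAt x hj hx ≫ L.mapAt hj k hx hy = A.map k.hom ≫ L.iAt y hj hy := by
  have := (L.stage j hj).i.naturality (X := ⟨x.obj, hx⟩) (Y := ⟨y.obj, hy⟩) ⟨k.hom⟩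
  refine Eq.trans ?_ ((congrArg (· ≫ eqToHom (L.obj_eq hj hy).symm) this.symm).trans
    (Category.assoc _ _ _))
  simp only [iAt, mapAt, Category.assoc, eqToHom_trans_assoc, eqToHom_refl, Category.id_comp]

variable (x) in
/-- The right factor of the limit at `x`, read off at a stage `j`. -/
def pAt (hx : S.deg x.obj < j) : L.obj x ⟶ B.obj x.obj :=
  eqToHom (L.obj_eq hj hx) ≫ (L.stage j hj).p.app ⟨x.obj, hx⟩

variable (x) in
lemma pAt_eq (hx : S.deg x.obj < j) :
    L.pAt x (L.isSuccLimit.succ_lt x.property) (Order.lt_succ _) = L.pAt x hj hx := by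
  have := p_app_eq_of_restrict_eq (L.restrict_stage hj (Order.succ_le_of_lt hx))
    ⟨x.obj, Order.lt_succ _⟩
  rw [pAt, this, pAt, eqToHom_trans_assoc]

lemma mapAt_pAt (k : x ⟶ y) (hx : S.deg x.obj < j) (hy : S.deg y.obj < j) :
    L.mapAt hj k hx hy ≫ L.pAt y hj hy = L.pAt x hj hx ≫ B.map k.hom := by
  have := (L.stage j hj).p.naturality (X := ⟨x.obj, hx⟩) (Y := ⟨y.obj, hy⟩) ⟨k.hom⟩
  refine Eq.trans ?_ ((congrArg (eqToHom (L.obj_eq hj hx) ≫ ·) this).trans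
    (Category.assoc _ _ _).symm)
  simp only [pAt, mapAt, Category.assoc, eqToHom_trans_assoc, eqToHom_refl, Category.id_comp]

variable (x) in
lemma iAt_pAt (hx : S.deg x.obj < j) : L.iAt x hj hx ≫ L.pAt x hj hx = f.app x.obj := by
  refine Eq.trans ?_ (congr_app (L.stage j hj).fac ⟨x.obj, hx⟩)
  simp only [iAt, pAt, Category.assoc, eqToHom_trans_assoc, eqToHom_refl, Category.id_comp,
    NatTrans.comp_app]

lemma succ_max_lt (L : CoherentFamily S f δ) (x y : S.Below δ) :
    Order.succ (max (S.deg x.obj) (S.deg y.obj)) < δ :=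
  L.isSuccLimit.succ_lt (max_lt x.property y.property)

/-- The partial factorization over a limit stage glued from a coherent family. -/
noncomputable def limit : PartialFactorization S f δ where
  E :=
    { obj := L.obj
      map {x y} k := L.mapAt (L.succ_max_lt x y) k (Order.lt_succ_of_le (le_max_left _ _))
        (Order.lt_succ_of_le (le_max_right _ _))
      map_id x := L.mapAt_id x _ _
      map_comp {x y z} k k' := by
        let m := max (max (S.deg x.obj) (S.deg y.obj)) (S.deg z.obj)
        have hm : Order.succ m < δ :=
          L.isSuccLimit.succ_lt (max_lt (max_lt x.property y.property) z.property)
        have hx : S.deg x.obj < Order.succ m :=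
          Order.lt_succ_of_le ((le_max_left _ _).trans (le_max_left _ _))
        have hy : S.deg y.obj < Order.succ m :=
          Order.lt_succ_of_le ((le_max_right _ _).trans (le_max_left _ _))
        have hz : S.deg z.obj < Order.succ m := Order.lt_succ_of_le (le_max_right _ _)
        rw [L.mapAt_eq _ hm (k ≫ k') _ _ hx hz, L.mapAt_eq _ hm k _ _ hx hy,
          L.mapAt_eq _ hm k' _ _ hy hz, L.mapAt_comp hm k k' hx hy hz] }
  i :=
    { app x := L.iAt x (L.isSuccLimit.succ_lt x.property) (Order.lt_succ _)
      naturality x y k := by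
        rw [L.iAt_eq y (L.succ_max_lt x y) (Order.lt_succ_of_le (le_max_right _ _)),
          L.iAt_eq x (L.succ_max_lt x y) (Order.lt_succ_of_le (le_max_left _ _))]
        exact (L.iAt_mapAt _ k _ _).symm }
  p :=
    { app x := L.pAt x (L.isSuccLimit.succ_lt x.property) (Order.lt_succ _)
      naturality x y k := by
        rw [L.pAt_eq y (L.succ_max_lt x y) (Order.lt_succ_of_le (le_max_right _ _)),
          L.pAt_eq x (L.succ_max_lt x y) (Order.lt_succ_of_le (le_max_left _ _))]
        exact L.mapAt_pAt _ k _ _ }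
  fac := by
    ext x
    exact L.iAt_pAt x _ _

lemma restrict_limit : L.limit.restrict hj.le = L.stage j hj :=
  ext_of_eqToHom (fun z => L.obj_eq (x := ⟨z.obj, z.property.trans hj⟩) hj z.property)
    (fun {z z'} k =>
      L.mapAt_eq _ hj ((S.belowOfLE hj.le).map k) _ _ z.property z'.property)
    (fun z => L.iAt_eq ⟨z.obj, z.property.trans hj⟩ hj z.property)
    (fun z => L.pAt_eq ⟨z.obj, z.property.trans hj⟩ hj z.property)

end CoherentFamily

end PartialFactorization

variable {A B : C ⥤ M} {f : A ⟶ B} {δ : Ordinal.{v}}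

lemma HasThroughDecomposition.inStratum_or_exists_fac (hS : S.HasThroughDecomposition)
    {d d' : S.Stratum δ} (k : d.obj ⟶ d'.obj) :
    S.inStratum k ∨ ∃ (z : S.Below δ) (g : d.obj ⟶ z.obj) (h : z.obj ⟶ d'.obj),
      g ≫ h = k := by
  by_cases hk : S.inStratum k
  · exact Or.inl hk
  · obtain ⟨z, g, h, hz, H⟩ := hS.exists_fac k (d.deg_obj.trans d'.deg_obj.symm) hk
    exact Or.inr ⟨⟨z, hz.trans_eq d.deg_obj⟩, g, h, H⟩

namespace PartialFactorization

variable (l : PartialFactorization S f δ)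

/-- The matching cone on `A.obj x` corresponding to the canonical map from `A` to the relative
matching object of the right factor of `l`. -/
@[simps]
def matchingConeOfSource (x : C) : MatchingCone l.p x (A.obj x) where
  base := f.app x
  proj z g := A.map g ≫ l.i.app z
  proj_map {z z'} g k := by
    refine (Category.assoc _ _ _).trans ((congrArg (_ ≫ ·) (l.i.naturality k).symm).trans ?_)
    exact (Category.assoc _ _ _).symm.trans (congrArg (· ≫ _) (A.map_comp _ _).symm)
  proj_app z g := by
    refine (Category.assoc _ _ _).trans ((congrArg (_ ≫ ·) (congr_app l.fac z)).trans ?_)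
    exact f.naturality g

/-- The matching cone on `l.E.obj z` at `x` induced by a morphism from `z` to `x`. -/
@[simps]
def matchingConeOfBelow (z : S.Below δ) (x : C) (h : z.obj ⟶ x) :
    MatchingCone l.p x (l.E.obj z) where
  base := l.p.app z ≫ B.map h
  proj z' g := l.E.map ⟨h ≫ g⟩
  proj_map {z z'} g k := by
    refine (l.E.map_comp _ _).symm.trans (congrArg l.E.map ?_)
    exact InducedCategory.hom_ext (Category.assoc _ _ _)
  proj_app z g := by
    refine (l.p.naturality _).trans ?_
    exact (congrArg (_ ≫ ·) (B.map_comp _ _)).trans (Category.assoc _ _ _).symm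

/-- The data on the stratum of degree `δ` extending the partial factorization `l` to the objects
of degree `≤ δ`. -/
structure StratumExtension where
  G : S.Stratum δ ⥤ M
  c : LatchingCocone l.i (S.stratumι δ) G
  m (d : S.Stratum δ) : MatchingCone l.p d.obj (G.obj d)
  precomp_map {d d' : S.Stratum δ} (k : d ⟶ d') : (m d').precomp (G.map k) = (m d).along k.1
  precomp_base (d : S.Stratum δ) :
    (m d).precomp (c.base.app d) = l.matchingConeOfSource d.obj
  precomp_incl (z : S.Below δ) (d : S.Stratum δ) (h : z.obj ⟶ d.obj) :
    (m d).precomp (c.incl z d h) = l.matchingConeOfBelow z d.obj h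

namespace StratumExtension

variable {l} (e : l.StratumExtension)

lemma incl_proj (z z' : S.Below δ) (d : S.Stratum δ) (h : z.obj ⟶ d.obj) (g : d.obj ⟶ z'.obj) :
    e.c.incl z d h ≫ (e.m d).proj z' g = l.E.map ⟨h ≫ g⟩ :=
  congrArg (fun c => c.proj z' g) (e.precomp_incl z d h)

lemma incl_base (z : S.Below δ) (d : S.Stratum δ) (h : z.obj ⟶ d.obj) :
    e.c.incl z d h ≫ (e.m d).base = l.p.app z ≫ B.map h :=
  congrArg MatchingCone.base (e.precomp_incl z d h)

lemma base_proj (z : S.Below δ) (d : S.Stratum δ) (g : d.obj ⟶ z.obj) :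
    e.c.base.app d ≫ (e.m d).proj z g = A.map g ≫ l.i.app z :=
  congrArg (fun c => c.proj z g) (e.precomp_base d)

lemma base_base (d : S.Stratum δ) : e.c.base.app d ≫ (e.m d).base = f.app d.obj :=
  congrArg MatchingCone.base (e.precomp_base d)

lemma exists_map (hS : S.HasThroughDecomposition) {d d' : S.Stratum δ} (k : d.obj ⟶ d'.obj) :
    ∃ t : e.G.obj d ⟶ e.G.obj d', (∀ hk : S.inStratum k, t = e.G.map ⟨k, hk⟩) ∧
      ∀ (z : S.Below δ) (g : d.obj ⟶ z.obj) (h : z.obj ⟶ d'.obj), g ≫ h = k →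
        t = (e.m d).proj z g ≫ e.c.incl z d' h := by
  have hdd : S.deg d.obj = S.deg d'.obj := d.deg_obj.trans d'.deg_obj.symm
  by_cases hk : S.inStratum k
  · refine ⟨e.G.map ⟨k, hk⟩, fun _ => rfl, ?_⟩
    rintro z g h rfl
    exact (hS.not_inStratum g h (z.property.trans_eq d.deg_obj.symm) hk).elim
  · obtain ⟨z, g, h, hz, rfl⟩ := hS.exists_fac k hdd hk
    let t (z : C) (hz : S.deg z < S.deg d.obj) (g : d.obj ⟶ z) (h : z ⟶ d'.obj) :
        e.G.obj d ⟶ e.G.obj d' :=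
      (e.m d).proj ⟨z, hz.trans_eq d.deg_obj⟩ g ≫ e.c.incl ⟨z, hz.trans_eq d.deg_obj⟩ d' h
    have t_comp {z z' : C} (hz : S.deg z < S.deg d.obj) (hz' : S.deg z' < S.deg d.obj)
        (g : d.obj ⟶ z) (k : z ⟶ z') (h : z' ⟶ d'.obj) :
        t z hz g (k ≫ h) = t z' hz' (g ≫ k) h := by
      dsimp only [t]
      rw [← (e.m d).proj_map (z := ⟨z, hz.trans_eq d.deg_obj⟩)
        (z' := ⟨z', hz'.trans_eq d.deg_obj⟩) g ⟨k⟩, Category.assoc]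
      exact congrArg _ (e.c.map_incl (z := ⟨z, hz.trans_eq d.deg_obj⟩)
        (z' := ⟨z', hz'.trans_eq d.deg_obj⟩) ⟨k⟩ h).symm
    refine ⟨t z hz g h, fun hk' => (hk hk').elim, fun z' g' h' H => ?_⟩
    exact hS.connected hdd (fun z' hz' g' h' => t z hz g h = t z' hz' g' h')
      (fun z₁ z₂ hz₁ hz₂ g k h => by rw [t_comp hz₁ hz₂]) hz
      (z'.property.trans_eq d.deg_obj.symm) g h g' h' H.symm rfl

/-- The action of the extended functor on an arbitrary morphism between objects of degree `δ`:
either the morphism belongs to the stratum, or it factors through lower degrees. -/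
noncomputable def map (hS : S.HasThroughDecomposition) {d d' : S.Stratum δ} (k : d.obj ⟶ d'.obj) :
    e.G.obj d ⟶ e.G.obj d' :=
  (e.exists_map hS k).choose

variable (hS : S.HasThroughDecomposition) {d d' d'' : S.Stratum δ}

lemma map_of_inStratum {k : d.obj ⟶ d'.obj} (hk : S.inStratum k) :
    e.map hS k = e.G.map ⟨k, hk⟩ :=
  (e.exists_map hS k).choose_spec.1 hk

lemma map_through (z : S.Below δ) (g : d.obj ⟶ z.obj) (h : z.obj ⟶ d'.obj) :
    e.map hS (g ≫ h) = (e.m d).proj z g ≫ e.c.incl z d' h :=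
  (e.exists_map hS (g ≫ h)).choose_spec.2 z g h rfl

lemma incl_map (z : S.Below δ) (h : z.obj ⟶ d.obj) (k : d.obj ⟶ d'.obj) :
    e.c.incl z d h ≫ e.map hS k = e.c.incl z d' (h ≫ k) := by
  obtain hk | ⟨z', g, h', rfl⟩ := hS.inStratum_or_exists_fac k
  · rw [e.map_of_inStratum hS hk]
    exact e.c.incl_map z h (⟨k, hk⟩ : d ⟶ d')
  · rw [e.map_through, ← Category.assoc, e.incl_proj]
    exact (e.c.map_incl (z := z) (z' := z') ⟨h ≫ g⟩ h').trans
      (congrArg _ (Category.assoc _ _ _))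

lemma precomp_map_eq_along (k : d.obj ⟶ d'.obj) :
    (e.m d').precomp (e.map hS k) = (e.m d).along k := by
  obtain hk | ⟨z, g, h, rfl⟩ := hS.inStratum_or_exists_fac k
  · rw [e.map_of_inStratum hS hk]
    exact e.precomp_map (⟨k, hk⟩ : d ⟶ d')
  · rw [e.map_through, MatchingCone.precomp_comp, e.precomp_incl]
    refine MatchingCone.ext ?_ (funext fun z' => funext fun g' => ?_)
    · refine (Category.assoc _ _ _).symm.trans ((congrArg (· ≫ _) ((e.m d).proj_app z g)).trans ?_)
      exact (Category.assoc _ _ _).trans (congrArg (_ ≫ ·) (B.map_comp _ _).symm)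
    · exact ((e.m d).proj_map (z := z) (z' := z') g ⟨h ≫ g'⟩).trans
        (congrArg _ (Category.assoc _ _ _).symm)

lemma map_proj (k : d.obj ⟶ d'.obj) (z : S.Below δ) (g : d'.obj ⟶ z.obj) :
    e.map hS k ≫ (e.m d').proj z g = (e.m d).proj z (k ≫ g) :=
  congrArg (fun c => c.proj z g) (e.precomp_map_eq_along hS k)

lemma map_base (k : d.obj ⟶ d'.obj) :
    e.map hS k ≫ (e.m d').base = (e.m d).base ≫ B.map k :=
  congrArg MatchingCone.base (e.precomp_map_eq_along hS k)

lemma base_map (k : d.obj ⟶ d'.obj) :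
    e.c.base.app d ≫ e.map hS k = A.map k ≫ e.c.base.app d' := by
  obtain hk | ⟨z, g, h, rfl⟩ := hS.inStratum_or_exists_fac k
  · rw [e.map_of_inStratum hS hk]
    exact (e.c.base.naturality (⟨k, hk⟩ : d ⟶ d')).symm
  · rw [e.map_through, ← Category.assoc, e.base_proj, A.map_comp]
    exact (Category.assoc _ _ _).trans ((congrArg _ (e.c.app_incl z h)).trans
      (Category.assoc _ _ _).symm)

variable (d) in
lemma map_id : e.map hS (𝟙 d.obj) = 𝟙 _ :=
  (e.map_of_inStratum hS (S.inStratum.id_mem _)).trans (e.G.map_id d)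

lemma map_comp (k : d.obj ⟶ d'.obj) (k' : d'.obj ⟶ d''.obj) :
    e.map hS (k ≫ k') = e.map hS k ≫ e.map hS k' := by
  obtain hk' | ⟨z', g', h', rfl⟩ := hS.inStratum_or_exists_fac k'
  · obtain hk | ⟨z, g, h, rfl⟩ := hS.inStratum_or_exists_fac k
    · rw [e.map_of_inStratum hS hk, e.map_of_inStratum hS hk',
        e.map_of_inStratum hS (S.inStratum.comp_mem _ _ hk hk')]
      exact e.G.map_comp (⟨k, hk⟩ : d ⟶ d') (⟨k', hk'⟩ : d' ⟶ d'')
    · rw [e.map_through, Category.assoc, Category.assoc, incl_map]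
      exact e.map_through hS z g _
  · rw [e.map_through, ← Category.assoc, ← Category.assoc, map_proj, e.map_through]

end StratumExtension

end PartialFactorization

/-- An object of degree `≤ δ`, classified as lying below or in the stratum of degree `δ`. -/
inductive Side (S : Stratification C) (δ : Ordinal.{v}) (x : C) : Type
  | low (h : S.deg x < δ)
  | high (h : S.deg x = δ)

namespace Side

variable {x y z : C}

instance : Subsingleton (S.Side δ x) where
  allEq
    | .low _, .low _ => rfl
    | .low h, .high h' => (h.ne h').elim
    | .high h, .low h' => (h'.ne h).elim
    | .high _, .high _ => rfl

lemma nonempty_of_lt_succ (h : S.deg x < Order.succ δ) : Nonempty (S.Side δ x) :=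
  (Order.lt_succ_iff.1 h).lt_or_eq.elim (fun h => ⟨.low h⟩) fun h => ⟨.high h⟩

variable {l : PartialFactorization S f δ} (e : l.StratumExtension)
  (hS : S.HasThroughDecomposition)

/-- The value at `x` of the extension of `l` by `e`. -/
def obj : S.Side δ x → M
  | .low h => l.E.obj ⟨x, h⟩
  | .high h => e.G.obj ⟨x, h⟩

/-- The action on morphisms of the extension of `l` by `e`. -/
noncomputable def map : (s : S.Side δ x) → (t : S.Side δ y) → (x ⟶ y) → (s.obj e ⟶ t.obj e)
  | .low hx, .low hy, k => l.E.map (X := ⟨x, hx⟩) (Y := ⟨y, hy⟩) ⟨k⟩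
  | .low hx, .high hy, k => e.c.incl ⟨x, hx⟩ ⟨y, hy⟩ k
  | .high hx, .low hy, k => (e.m ⟨x, hx⟩).proj ⟨y, hy⟩ k
  | .high hx, .high hy, k => e.map hS (d := ⟨x, hx⟩) (d' := ⟨y, hy⟩) k

lemma map_id (s : S.Side δ x) : map e hS s s (𝟙 x) = 𝟙 _ :=
  match s with
  | .low h => l.E.map_id ⟨x, h⟩
  | .high h => e.map_id hS ⟨x, h⟩

lemma map_comp (s : S.Side δ x) (t : S.Side δ y) (r : S.Side δ z) (k : x ⟶ y) (k' : y ⟶ z) :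
    map e hS s r (k ≫ k') = map e hS s t k ≫ map e hS t r k' :=
  match s, t, r with
  | .low hx, .low hy, .low hz =>
    l.E.map_comp (X := ⟨x, hx⟩) (Y := ⟨y, hy⟩) (Z := ⟨z, hz⟩) ⟨k⟩ ⟨k'⟩
  | .low hx, .low hy, .high hz =>
    (e.c.map_incl (z := ⟨x, hx⟩) (z' := ⟨y, hy⟩) (d := ⟨z, hz⟩) ⟨k⟩ k').symm
  | .low hx, .high hy, .low hz => (e.incl_proj ⟨x, hx⟩ ⟨z, hz⟩ ⟨y, hy⟩ k k').symm
  | .low hx, .high hy, .high hz =>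
    (e.incl_map hS (d := ⟨y, hy⟩) (d' := ⟨z, hz⟩) ⟨x, hx⟩ k k').symm
  | .high hx, .low hy, .low hz =>
    ((e.m ⟨x, hx⟩).proj_map (z := ⟨y, hy⟩) (z' := ⟨z, hz⟩) k ⟨k'⟩).symm
  | .high hx, .low hy, .high hz =>
    e.map_through hS (d := ⟨x, hx⟩) (d' := ⟨z, hz⟩) ⟨y, hy⟩ k k'
  | .high hx, .high hy, .low hz =>
    (e.map_proj hS (d := ⟨x, hx⟩) (d' := ⟨y, hy⟩) k ⟨z, hz⟩ k').symm
  | .high hx, .high hy, .high hz =>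
    e.map_comp hS (d := ⟨x, hx⟩) (d' := ⟨y, hy⟩) (d'' := ⟨z, hz⟩) k k'

/-- The left factor at `x` of the extension of `l` by `e`. -/
def i : (s : S.Side δ x) → (A.obj x ⟶ s.obj e)
  | .low h => l.i.app ⟨x, h⟩
  | .high h => e.c.base.app ⟨x, h⟩

lemma i_map (s : S.Side δ x) (t : S.Side δ y) (k : x ⟶ y) :
    s.i e ≫ map e hS s t k = A.map k ≫ t.i e :=
  match s, t with
  | .low hx, .low hy => (l.i.naturality (X := ⟨x, hx⟩) (Y := ⟨y, hy⟩) ⟨k⟩).symm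
  | .low hx, .high hy => e.c.app_incl ⟨x, hx⟩ (d := ⟨y, hy⟩) k
  | .high hx, .low hy => e.base_proj ⟨y, hy⟩ ⟨x, hx⟩ k
  | .high hx, .high hy => e.base_map hS (d := ⟨x, hx⟩) (d' := ⟨y, hy⟩) k

/-- The right factor at `x` of the extension of `l` by `e`. -/
def p : (s : S.Side δ x) → (s.obj e ⟶ B.obj x)
  | .low h => l.p.app ⟨x, h⟩
  | .high h => (e.m ⟨x, h⟩).base

lemma map_p (s : S.Side δ x) (t : S.Side δ y) (k : x ⟶ y) :
    map e hS s t k ≫ t.p e = s.p e ≫ B.map k :=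
  match s, t with
  | .low hx, .low hy => l.p.naturality (X := ⟨x, hx⟩) (Y := ⟨y, hy⟩) ⟨k⟩
  | .low hx, .high hy => e.incl_base ⟨x, hx⟩ ⟨y, hy⟩ k
  | .high hx, .low hy => (e.m ⟨x, hx⟩).proj_app ⟨y, hy⟩ k
  | .high hx, .high hy => e.map_base hS (d := ⟨x, hx⟩) (d' := ⟨y, hy⟩) k

lemma i_p (s : S.Side δ x) : s.i e ≫ s.p e = f.app x :=
  match s with
  | .low h => congr_app l.fac ⟨x, h⟩
  | .high h => e.base_base ⟨x, h⟩

end Side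

namespace PartialFactorization

namespace StratumExtension

variable {l : PartialFactorization S f δ} (e : l.StratumExtension)
  (hS : S.HasThroughDecomposition) {ε : Ordinal.{v}}

/-- The extension of `l` by `e`, pulled back to a diagram of objects of degree `≤ δ`. -/
noncomputable def glueFunctor {D : Type w} [Category.{w'} D] (K : D ⥤ C)
    (s : ∀ d, S.Side δ (K.obj d)) : D ⥤ M where
  obj d := (s d).obj e
  map k := Side.map e hS _ _ (K.map k)
  map_id d := by rw [K.map_id, Side.map_id]
  map_comp k k' := by rw [K.map_comp, Side.map_comp e hS _ _ _ _ _]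

/-- The extension of `l` by `e`, as a partial factorization over objects of degree `≤ δ`. -/
noncomputable def glue (s : ∀ x : S.Below ε, S.Side δ x.obj) : PartialFactorization S f ε where
  E := e.glueFunctor hS (S.belowι ε) s
  i :=
    { app x := (s x).i e
      naturality _ _ k := (Side.i_map e hS _ _ _).symm }
  p :=
    { app x := (s x).p e
      naturality _ _ k := Side.map_p e hS _ _ _ }
  fac := by
    ext x
    exact Side.i_p e _

lemma glue_low : e.glue hS (fun x : S.Below δ => .low x.property) = l := rfl

lemma restrict_glue (h : δ ≤ ε) (s : ∀ x : S.Below ε, S.Side δ x.obj) :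
    (e.glue hS s).restrict h = l := by
  change e.glue hS (fun x => s ((S.belowOfLE h).obj x)) = l
  rw [Subsingleton.elim (fun x => s ((S.belowOfLE h).obj x)) fun x => .low x.property, glue_low]

/-- The latching cocone of the left factor of the extension of `l` by `e`. -/
noncomputable def glueLatchingCocone (s : ∀ x : S.Below δ, S.Side δ x.obj) {D : Type w}
    [Category.{w'} D] (K : D ⥤ C) (t : ∀ d, S.Side δ (K.obj d)) :
    LatchingCocone (e.glue hS s).i K (e.glueFunctor hS K t) where
  base :=
    { app d := (t d).i e
      naturality _ _ _ := (Side.i_map e hS _ _ _).symm }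
  incl z d h := Side.map e hS (s z) (t d) h
  map_incl _ _ _ := (Side.map_comp e hS _ _ _ _ _).symm
  incl_map _ _ _ _ _ := (Side.map_comp e hS _ _ _ _ _).symm
  app_incl _ _ _ := Side.i_map e hS _ _ _

/-- On the stratum of degree `δ`, the extension of `l` by `e` is `e.G`. -/
noncomputable def glueFunctorStratumIso :
    e.G ≅ e.glueFunctor hS (S.stratumι δ) (fun d => .high d.deg_obj) :=
  NatIso.ofComponents (fun d => Iso.refl (e.G.obj d)) fun k =>
    (Category.comp_id _).trans ((e.map_of_inStratum hS k.2).symm.trans (Category.id_comp _).symm)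

lemma isLeft_glueLatchingCocone {R : MorphismProperty M} (hc : e.c.IsLeft R)
    (s : ∀ x : S.Below δ, S.Side δ x.obj) (t : ∀ d : S.Stratum δ, S.Side δ d.obj) :
    (e.glueLatchingCocone hS s (S.stratumι δ) t).IsLeft R := by
  obtain rfl : s = fun x => .low x.property := Subsingleton.elim _ _
  obtain rfl : t = fun d => .high d.deg_obj := Subsingleton.elim _ _
  have h : e.c.postcomp (e.glueFunctorStratumIso hS).hom =
      e.glueLatchingCocone hS (fun x => .low x.property) (S.stratumι δ) fun d => .high d.deg_obj :=
    LatchingCocone.ext (by ext d; exact Category.comp_id _)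
      (funext fun _ => funext fun _ => funext fun _ => Category.comp_id _)
  exact h ▸ hc.postcomp_iso _

/-- The matching cone of the right factor of the extension of `l` by `e`. -/
noncomputable def glueMatchingCone (s : ∀ x : S.Below δ, S.Side δ x.obj) {x : C}
    (t : S.Side δ x) : MatchingCone (e.glue hS s).p x (t.obj e) where
  base := t.p e
  proj z g := Side.map e hS t (s z) g
  proj_map _ _ := (Side.map_comp e hS _ _ _ _ _).symm
  proj_app _ _ := Side.map_p e hS _ _ _

lemma isRight_glueMatchingCone {R : MorphismProperty M} (hm : ∀ d, (e.m d).IsRight R)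
    (s : ∀ x : S.Below δ, S.Side δ x.obj) {x : C} (hx : S.deg x = δ) (t : S.Side δ x) :
    (e.glueMatchingCone hS s t).IsRight R := by
  obtain rfl : s = fun x => .low x.property := Subsingleton.elim _ _
  obtain rfl : t = .high hx := Subsingleton.elim _ _
  exact hm ⟨x, hx⟩

lemma exists_isReedy_succ (hS : S.HasThroughDecomposition) {R : MorphismProperty M}
    (hl : l.IsReedy R) (hc : e.c.IsLeft R) (hm : ∀ d, (e.m d).IsRight R) :
    ∃ l' : PartialFactorization S f (Order.succ δ),
      l'.restrict (Order.le_succ δ) = l ∧ l'.IsReedy R := by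
  let s (x : S.Below (Order.succ δ)) : S.Side δ x.obj :=
    (Side.nonempty_of_lt_succ x.property).some
  have h_restrict := e.restrict_glue hS (Order.le_succ δ) s
  have hl' : ((e.glue hS s).restrict (Order.le_succ δ)).IsReedy R := by rwa [h_restrict]
  refine ⟨e.glue hS s, h_restrict, fun {γ} hγ => ?_, fun {γ} hγ x hx => ?_⟩
  · obtain hγ' | rfl := (Order.lt_succ_iff.1 hγ).lt_or_eq
    · exact hl'.latching hγ'
    · exact e.isLeft_glueLatchingCocone hS hc _ _
  · obtain hγ' | rfl := (Order.lt_succ_iff.1 hγ).lt_or_eq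
    · exact hl'.matching hγ' ⟨x.obj, hx.trans_lt hγ'⟩ hx
    · exact e.isRight_glueMatchingCone hS hm _ hx _

end StratumExtension

variable (l : PartialFactorization S f δ)

lemma matchingConeOfSource_precomp_map {x y : C} (k : x ⟶ y) :
    (l.matchingConeOfSource y).precomp (A.map k) = (l.matchingConeOfSource x).along k :=
  MatchingCone.ext (f.naturality k) (funext fun _ => funext fun _ =>
    (Category.assoc _ _ _).symm.trans (congrArg (· ≫ _) (A.map_comp _ _).symm))

lemma matchingConeOfBelow_precomp_map {z z' : S.Below δ} (k : z ⟶ z') {x : C} (h : z'.obj ⟶ x) :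
    (l.matchingConeOfBelow z' x h).precomp (l.E.map k) =
      l.matchingConeOfBelow z x (k.hom ≫ h) := by
  refine MatchingCone.ext ?_ (funext fun z'' => funext fun g => ?_)
  · refine (Category.assoc _ _ _).symm.trans ((congrArg (· ≫ _) (l.p.naturality k)).trans ?_)
    exact (Category.assoc _ _ _).trans (congrArg (_ ≫ ·) (B.map_comp _ _).symm)
  · refine (l.E.map_comp _ _).symm.trans (congrArg l.E.map ?_)
    exact InducedCategory.hom_ext (Category.assoc _ _ _).symm

lemma matchingConeOfBelow_along (z : S.Below δ) {x y : C} (h : z.obj ⟶ x) (k : x ⟶ y) :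
    (l.matchingConeOfBelow z x h).along k = l.matchingConeOfBelow z y (h ≫ k) :=
  MatchingCone.ext ((Category.assoc _ _ _).trans (congrArg (_ ≫ ·) (B.map_comp _ _).symm))
    (funext fun _ => funext fun _ =>
      congrArg l.E.map (InducedCategory.hom_ext (Category.assoc _ _ _).symm))

lemma matchingConeOfBelow_precomp_i (z : S.Below δ) {x : C} (h : z.obj ⟶ x) :
    (l.matchingConeOfBelow z x h).precomp (l.i.app z) =
      (l.matchingConeOfSource x).precomp (A.map h) := by
  refine MatchingCone.ext ?_ (funext fun z' => funext fun g => ?_)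
  · refine (Category.assoc _ _ _).symm.trans ((congrArg (· ≫ _) (congr_app l.fac z)).trans ?_)
    exact (f.naturality h).symm
  · refine (l.i.naturality _).symm.trans ?_
    exact (congrArg (· ≫ _) (A.map_comp _ _)).trans (Category.assoc _ _ _)

/-- The unique factorization over the empty set of objects of degree `< 0`. -/
def zero (f : A ⟶ B) : PartialFactorization S f 0 where
  E :=
    { obj x := (not_lt_zero x.property).elim
      map {x _} _ := (not_lt_zero x.property).elim
      map_id x := (not_lt_zero x.property).elim
      map_comp {x _ _} _ _ := (not_lt_zero x.property).elim }
  i :=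
    { app x := (not_lt_zero x.property).elim
      naturality {x _} _ := (not_lt_zero x.property).elim }
  p :=
    { app x := (not_lt_zero x.property).elim
      naturality {x _} _ := (not_lt_zero x.property).elim }
  fac := by
    ext x
    exact (not_lt_zero x.property).elim

variable [HasLimits M]

lemma exists_latchingCocone_relMatching {D : Type w} [Category.{w'} D] (K : D ⥤ C) :
    ∃ c : LatchingCocone l.i K (K ⋙ relMatching l.p),
      (∀ d, (relMatchingCone l.p (K.obj d)).precomp (c.base.app d) =
        l.matchingConeOfSource (K.obj d)) ∧
      ∀ z d h, (relMatchingCone l.p (K.obj d)).precomp (c.incl z d h) =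
        l.matchingConeOfBelow z (K.obj d) h := by
  obtain ⟨φ, hφ⟩ := exists_relMatching_lift l.p (K := K) (F := K ⋙ A)
    (fun d => l.matchingConeOfSource (K.obj d))
    (fun e => l.matchingConeOfSource_precomp_map (K.map e))
  choose θ hθ _ using fun (z : S.Below δ) (d : D) (h : z.obj ⟶ K.obj d) =>
    isUniversal_relMatchingCone l.p (K.obj d) (l.matchingConeOfBelow z (K.obj d) h)
  refine ⟨
    { base := φ
      incl := θ
      map_incl := fun {z z'} k d h => (isUniversal_relMatchingCone l.p (K.obj d)).hom_ext ?_
      incl_map := fun z d d' h e => (isUniversal_relMatchingCone l.p (K.obj d')).hom_ext ?_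
      app_incl := fun z d h => (isUniversal_relMatchingCone l.p (K.obj d)).hom_ext ?_ }, hφ, hθ⟩
  · rw [MatchingCone.precomp_comp, hθ, hθ, matchingConeOfBelow_precomp_map]
  · refine (MatchingCone.precomp_comp _ _ _).trans ?_
    refine (congrArg (fun c => c.precomp (θ z d h))
      (relMatchingCone_precomp_map l.p (K.map e))).trans ?_
    rw [← MatchingCone.precomp_along, hθ, hθ, matchingConeOfBelow_along]
  · rw [MatchingCone.precomp_comp, hθ, matchingConeOfBelow_precomp_i]
    exact ((MatchingCone.precomp_comp _ _ _).trans
      (congrArg (fun c => c.precomp (A.map h)) (hφ d))).symm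

lemma exists_stratumExtension [HasColimits M] {R : MorphismProperty M} (hR : R.llp.rlp = R)
    (hfac : ∀ {X Y : S.Stratum δ ⥤ M} (g : X ⟶ Y), ∃ (Z : S.Stratum δ ⥤ M) (j : X ⟶ Z)
      (q : Z ⟶ Y), projectiveL R _ j ∧ R.functorCategory _ q ∧ j ≫ q = g) :
    ∃ e : l.StratumExtension, e.c.IsLeft R ∧ ∀ d, (e.m d).IsRight R := by
  obtain ⟨cQ, hbase, hincl⟩ := l.exists_latchingCocone_relMatching (S.stratumι δ)
  obtain ⟨P, cP, hP⟩ := LatchingCocone.exists_isUniversal l.i (S.stratumι δ)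
  obtain ⟨w, hw, -⟩ := hP cQ
  obtain ⟨G, j, q, hj, hq, rfl⟩ := hfac w
  rw [LatchingCocone.postcomp_comp] at hw
  refine ⟨
    { G := G
      c := cP.postcomp j
      m := fun d => (relMatchingCone l.p d.obj).precomp (q.app d)
      precomp_map := fun {d d'} k => ?_
      precomp_base := fun d => ?_
      precomp_incl := fun z d h => ?_ },
    (hP.isLeft_iff rfl R).2 hj,
    fun d => ((isUniversal_relMatchingCone l.p d.obj).isRight_iff rfl hR).2 (hq d)⟩
  · refine (MatchingCone.precomp_comp _ _ _).symm.trans ((congrArg _ (q.naturality k)).trans ?_)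
    refine (MatchingCone.precomp_comp _ _ _).trans
      (Eq.trans ?_ (MatchingCone.precomp_along _ _ _).symm)
    exact congrArg (fun c => c.precomp (q.app d)) (relMatchingCone_precomp_map l.p k.1)
  · refine (MatchingCone.precomp_comp _ _ _).symm.trans (Eq.trans ?_ (hbase d))
    exact congrArg _ (congr_app (congrArg LatchingCocone.base hw) d)
  · refine (MatchingCone.precomp_comp _ _ _).symm.trans (Eq.trans ?_ (hincl z d h))
    exact congrArg _ (congrArg (fun c => c.incl z d h) hw)

end PartialFactorization

variable [HasLimits M] [HasColimits M] {R : MorphismProperty M}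

lemma HasThroughDecomposition.exists_isReedy (hS : S.HasThroughDecomposition)
    (hR : R.llp.rlp = R)
    (hfac : ∀ (δ : Ordinal.{v}) {X Y : S.Stratum δ ⥤ M} (g : X ⟶ Y), ∃ (Z : S.Stratum δ ⥤ M)
      (j : X ⟶ Z) (q : Z ⟶ Y), projectiveL R _ j ∧ R.functorCategory _ q ∧ j ≫ q = g)
    (f : A ⟶ B) (β : Ordinal.{v}) :
    ∃ l : PartialFactorization S f β, l.IsReedy R := by
  obtain ⟨l⟩ := nonempty_of_transfinite
    (T := fun δ => { l : PartialFactorization S f δ // l.IsReedy R })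
    (fun h l => ⟨l.1.restrict h, l.2.restrict h⟩) (fun _ => rfl) (fun _ _ _ => rfl)
    ⟨⟨.zero f, fun hγ => (not_lt_zero hγ).elim, fun hγ => (not_lt_zero hγ).elim⟩⟩
    (fun δ l => by
      obtain ⟨e, hc, hm⟩ := l.1.exists_stratumExtension hR (hfac δ)
      obtain ⟨l', h, h'⟩ := e.exists_isReedy_succ hS l.2 hc hm
      exact ⟨⟨l', h'⟩, Subtype.ext h⟩)
    (fun δ hδ l hl => by
      let L : PartialFactorization.CoherentFamily S f δ :=
        ⟨hδ, fun j hj => (l j hj).1, fun hj' hjj' => congrArg Subtype.val (hl _ _ hj' hjj')⟩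
      refine ⟨⟨L.limit, PartialFactorization.isReedy_of_restrict fun γ hγ =>
        ⟨Order.succ γ, (hδ.succ_lt hγ).le, Order.lt_succ γ, ?_⟩⟩,
        fun i hi => Subtype.ext (L.restrict_limit hi)⟩
      rw [L.restrict_limit (hδ.succ_lt hγ)]
      exact (l _ _).2) β
  exact ⟨l.1, l.2⟩

theorem HasThroughDecomposition.exists_factorization (hS : S.HasThroughDecomposition)
    (hR : R.llp.rlp = R)
    (hfac : ∀ (δ : Ordinal.{v}) {X Y : S.Stratum δ ⥤ M} (g : X ⟶ Y), ∃ (Z : S.Stratum δ ⥤ M)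
      (j : X ⟶ Z) (q : Z ⟶ Y), projectiveL R _ j ∧ R.functorCategory _ q ∧ j ≫ q = g)
    (f : A ⟶ B) :
    ∃ (E : C ⥤ M) (i : A ⟶ E) (p : E ⟶ B), S.cReedyL R i ∧ S.cReedyR R p ∧ i ≫ p = f := by
  let β : Ordinal.{v} := ⨆ x, S.deg x + 1
  have hβ (x : C) : S.deg x < β := Ordinal.lt_iSup_add_one S.deg x
  obtain ⟨l, hl⟩ := hS.exists_isReedy hR hfac f β
  let t : C ⥤ S.Below β := { obj := fun x => ⟨x, hβ x⟩, map := fun k => ⟨k⟩ }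
  let i : A ⟶ t ⋙ l.E :=
    { app := fun x => l.i.app (t.obj x), naturality := fun _ _ k => l.i.naturality (t.map k) }
  let p : t ⋙ l.E ⟶ B :=
    { app := fun x => l.p.app (t.obj x), naturality := fun _ _ k => l.p.naturality (t.map k) }
  refine ⟨t ⋙ l.E, i, p, fun δ => ?_, fun x => ?_, ?_⟩
  · refine (S.projectiveL_latchingMap_iff δ i (S.stratumι δ) R).2 ?_
    by_cases hδ : δ < β
    · exact hl.latching hδ
    · have : IsEmpty (S.Stratum δ) := ⟨fun d => hδ (d.deg_obj ▸ hβ d.obj)⟩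
      intro Y Z q _ b c _
      refine ⟨{ app := isEmptyElim, naturality := isEmptyElim }, ?_, LatchingCocone.ext ?_
        (funext fun _ => funext isEmptyElim)⟩ <;>
      · ext d
        exact isEmptyElim d
  · exact (S.matchingMap_mem_iff p hR x).2 (hl.matching (hβ x) (t.obj x) rfl)
  · ext x
    exact congr_app l.fac (t.obj x)

end Stratification

/-! ### The model structure -/

namespace Stratification

variable {C : Type v} [SmallCategory C] {S : Stratification C} {M : Type u} [Category.{v} M]
  {R : MorphismProperty M}

section Retracts

variable (P : ObjectProperty C) {A B A' B' : C ⥤ M} {f : A ⟶ B} {f' : A' ⟶ B'}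

lemma whiskerLeft_comm {D : Type w} [Category.{w'} D] (K : D ⥤ C) {a : A ⟶ A'} {b : B ⟶ B'}
    (w : a ≫ f' = f ≫ b) :
    Functor.whiskerLeft K a ≫ Functor.whiskerLeft K f' =
      Functor.whiskerLeft K f ≫ Functor.whiskerLeft K b := by
  rw [← Functor.whiskerLeft_comp, w, Functor.whiskerLeft_comp]

lemma matchingCone_precomp_app {a : A ⟶ A'} {b : B ⟶ B'} (w : a ≫ f' = f ≫ b) (x : C) :
    (matchingCone P f' x).precomp (a.app x) =
      (matchingCone P f x).postcomp (Functor.whiskerLeft P.ι a) b (whiskerLeft_comm P.ι w) :=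
  MatchingCone.ext (congr_app w x) (funext fun _ => funext fun g => (a.naturality g).symm)

lemma latchingCocone_postcomp_whiskerLeft {D : Type w} [Category.{w'} D] (K : D ⥤ C)
    {a : A ⟶ A'} {b : B ⟶ B'} (w : a ≫ f' = f ≫ b) :
    (latchingCocone P f K).postcomp (Functor.whiskerLeft K b) =
      (latchingCocone P f' K).precomp (Functor.whiskerLeft P.ι b) a
        (whiskerLeft_comm P.ι w).symm :=
  LatchingCocone.ext (whiskerLeft_comm K w).symm
    (funext fun _ => funext fun _ => funext fun h => b.naturality h)

variable (r : RetractArrow f f')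

include r

lemma matchingCone_lifts_of_retract (x : C) {K L : M} {i : K ⟶ L}
    (h : (matchingCone P f' x).Lifts i) : (matchingCone P f x).Lifts i := by
  intro t c hc
  obtain ⟨l, hl, hlc⟩ := h (t ≫ r.i.left.app x)
    (c.postcomp (Functor.whiskerLeft P.ι r.i.left) r.i.right (whiskerLeft_comm P.ι r.i_w)) (by
      rw [MatchingCone.precomp_comp, matchingCone_precomp_app P r.i_w,
        ← MatchingCone.precomp_postcomp, hc, MatchingCone.precomp_postcomp])
  refine ⟨l ≫ r.r.left.app x, ?_, ?_⟩
  · rw [← Category.assoc, hl, Category.assoc, ← NatTrans.comp_app, r.retract_left]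
    exact Category.comp_id t
  · rw [MatchingCone.precomp_comp, matchingCone_precomp_app P r.r_w,
      ← MatchingCone.precomp_postcomp, hlc]
    exact MatchingCone.postcomp_postcomp_eq_self _ _
      (congrArg (Functor.whiskerLeft P.ι) r.retract_left) r.retract_right

lemma latchingCocone_lifts_of_retract {D : Type w} [Category.{w'} D] (K : D ⥤ C) {Y Z : D ⥤ M}
    {p : Y ⟶ Z} (h : (latchingCocone P f' K).Lifts p) : (latchingCocone P f K).Lifts p := by
  intro b c hc
  obtain ⟨l, hl, hlc⟩ := h (Functor.whiskerLeft K r.r.right ≫ b)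
    (c.precomp (Functor.whiskerLeft P.ι r.r.right) r.r.left (whiskerLeft_comm P.ι r.r_w).symm) (by
      rw [LatchingCocone.postcomp_comp, latchingCocone_postcomp_whiskerLeft P K r.r_w,
        ← LatchingCocone.postcomp_precomp, hc, LatchingCocone.postcomp_precomp])
  refine ⟨Functor.whiskerLeft K r.i.right ≫ l, ?_, ?_⟩
  · rw [Category.assoc, hl, ← Category.assoc, ← Functor.whiskerLeft_comp, r.retract_right]
    exact Category.id_comp b
  · rw [LatchingCocone.postcomp_comp, latchingCocone_postcomp_whiskerLeft P K r.i_w,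
      ← LatchingCocone.postcomp_precomp, hlc]
    exact LatchingCocone.precomp_precomp_eq_self _ _
      (congrArg (Functor.whiskerLeft P.ι) r.retract_right) r.retract_left

end Retracts

lemma isStableUnderRetracts_cReedyR [HasLimits M] (hR : R.llp.rlp = R) :
    (S.cReedyR R).IsStableUnderRetracts where
  of_retract r h x := (S.matchingMap_mem_iff _ hR x).2 fun _ _ i hi =>
    matchingCone_lifts_of_retract _ r x ((S.matchingMap_mem_iff _ hR x).1 (h x) i hi)

lemma isStableUnderRetracts_cReedyL [HasColimits M] :
    (S.cReedyL R).IsStableUnderRetracts where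
  of_retract r h δ := (S.projectiveL_latchingMap_iff δ _ (S.stratumι δ) R).2 fun _ _ p hp =>
    latchingCocone_lifts_of_retract _ r _
      ((S.projectiveL_latchingMap_iff δ _ (S.stratumι δ) R).1 (h δ) p hp)

lemma HasThroughDecomposition.isWeakFactorizationSystem [HasLimits M] [HasColimits M]
    (hS : S.HasThroughDecomposition) (hR : R.llp.rlp = R)
    (hfac : ∀ (δ : Ordinal.{v}) {X Y : S.Stratum δ ⥤ M} (g : X ⟶ Y), ∃ (Z : S.Stratum δ ⥤ M)
      (j : X ⟶ Z) (q : Z ⟶ Y), projectiveL R _ j ∧ R.functorCategory _ q ∧ j ≫ q = g) :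
    (S.cReedyL R).IsWeakFactorizationSystem (S.cReedyR R) := by
  have := isStableUnderRetracts_cReedyR (S := S) hR
  have := isStableUnderRetracts_cReedyL (S := S) (R := R)
  have : (S.cReedyL R).HasFactorization (S.cReedyR R) := ⟨fun f => by
    obtain ⟨E, i, p, hi, hp, fac⟩ := hS.exists_factorization hR hfac f
    exact ⟨⟨E, i, p, fac, hi, hp⟩⟩⟩
  exact .mk' _ _ fun i p hi hp => hS.hasLiftingProperty hR
    (fun δ => (S.projectiveL_latchingMap_iff δ i _ R).1 (hi δ))
    fun x => (S.matchingMap_mem_iff p hR x).1 (hp x)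

end Stratification

section Projective

variable {D : Type w} [Category.{w'} D] {M : Type u} [Category.{v} M] [ModelCategory M]

lemma fibrations_llp_rlp : (fibrations M).llp.rlp = fibrations M := by
  rw [MorphismProperty.llp_eq_of_wfs (trivialCofibrations M) (fibrations M),
    MorphismProperty.rlp_eq_of_wfs (trivialCofibrations M) (fibrations M)]

lemma trivialFibrations_llp_rlp : (trivialFibrations M).llp.rlp = trivialFibrations M := by
  rw [MorphismProperty.llp_eq_of_wfs (cofibrations M) (trivialFibrations M),
    MorphismProperty.rlp_eq_of_wfs (cofibrations M) (trivialFibrations M)]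

lemma functorCategory_trivialFibrations :
    (trivialFibrations M).functorCategory D =
      (fibrations M).functorCategory D ⊓ (weakEquivalences M).functorCategory D :=
  le_antisymm (fun _ _ _ hf => ⟨fun x => (hf x).1, fun x => (hf x).2⟩)
    fun _ _ _ hf x => ⟨hf.1 x, hf.2 x⟩

lemma exists_projectiveL_factorization {N : Type*} [Category* N] {L : MorphismProperty (D ⥤ N)}
    {R : MorphismProperty N} [L.IsWeakFactorizationSystem (R.functorCategory D)] {X Y : D ⥤ N}
    (g : X ⟶ Y) :
    ∃ (Z : D ⥤ N) (j : X ⟶ Z) (q : Z ⟶ Y),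
      projectiveL R D j ∧ R.functorCategory D q ∧ j ≫ q = g := by
  let d := MorphismProperty.factorizationData L (R.functorCategory D) g
  refine ⟨d.Z, d.i, d.p, ?_, d.hp, d.fac⟩
  rw [projectiveL, MorphismProperty.llp_eq_of_wfs L (R.functorCategory D)]
  exact d.hi

namespace HasProjectiveModelStructure

lemma exists_isWeakFactorizationSystem (h : HasProjectiveModelStructure D M) :
    ∃ L : MorphismProperty (D ⥤ M),
      L.IsWeakFactorizationSystem ((trivialFibrations M).functorCategory D) ∧
      (L ⊓ (weakEquivalences M).functorCategory D).IsWeakFactorizationSystem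
        ((fibrations M).functorCategory D) := by
  obtain ⟨_, hW, hF⟩ := h
  refine ⟨cofibrations (D ⥤ M), ?_, ?_⟩
  · rw [functorCategory_trivialFibrations, ← hW, ← hF]
    exact inferInstanceAs
      ((cofibrations (D ⥤ M)).IsWeakFactorizationSystem (trivialFibrations (D ⥤ M)))
  · rw [← hW, ← hF]
    exact inferInstanceAs
      ((trivialCofibrations (D ⥤ M)).IsWeakFactorizationSystem (fibrations (D ⥤ M)))

variable (h : HasProjectiveModelStructure D M)

include h

lemma acyclicProjectiveCofibrations_eq :
    acyclicProjectiveCofibrations D M = projectiveL (fibrations M) D := by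
  obtain ⟨L, _, _⟩ := h.exists_isWeakFactorizationSystem
  rw [acyclicProjectiveCofibrations, projectiveCofibrations, projectiveL, projectiveL,
    MorphismProperty.llp_eq_of_wfs L ((trivialFibrations M).functorCategory D),
    MorphismProperty.llp_eq_of_wfs (L ⊓ (weakEquivalences M).functorCategory D)
      ((fibrations M).functorCategory D)]

lemma exists_factorization_trivialFibrations {X Y : D ⥤ M} (g : X ⟶ Y) :
    ∃ (Z : D ⥤ M) (j : X ⟶ Z) (q : Z ⟶ Y),
      projectiveL (trivialFibrations M) D j ∧ (trivialFibrations M).functorCategory D q ∧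
        j ≫ q = g := by
  obtain ⟨L, _, _⟩ := h.exists_isWeakFactorizationSystem
  exact exists_projectiveL_factorization (L := L) g

lemma exists_factorization_fibrations {X Y : D ⥤ M} (g : X ⟶ Y) :
    ∃ (Z : D ⥤ M) (j : X ⟶ Z) (q : Z ⟶ Y),
      projectiveL (fibrations M) D j ∧ (fibrations M).functorCategory D q ∧ j ≫ q = g := by
  obtain ⟨L, _, _⟩ := h.exists_isWeakFactorizationSystem
  exact exists_projectiveL_factorization (L := L ⊓ (weakEquivalences M).functorCategory D) g

end HasProjectiveModelStructure

end Projective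

namespace Stratification

variable {C : Type v} [SmallCategory C] {S : Stratification C} {M : Type u} [Category.{v} M]

section Matching

variable [HasLimits M] {A B : C ⥤ M} {f : A ⟶ B}

lemma cReedyR_mono {R R' : MorphismProperty M} (h : R ≤ R') : S.cReedyR R ≤ S.cReedyR R' :=
  fun _ _ _ hf x => h _ (hf x)

lemma matchingMap_snd (x : C) : S.matchingMap f x ≫ pullback.snd _ _ = f.app x :=
  pullback.lift_snd _ _ _

end Matching

section Latching

variable [HasColimits M] {A B : C ⥤ M} {f : A ⟶ B}

lemma cReedyL_anti {R R' : MorphismProperty M} (h : R ≤ R') : S.cReedyL R' ≤ S.cReedyL R :=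
  fun _ _ _ hf δ _ _ p hp => hf δ p fun d => h _ (hp d)

lemma inr_latchingMap_app (δ : Ordinal.{v}) {D : Type w} [Category.{w'} D] (K : D ⥤ C) (d : D) :
    (pushout.inr (Functor.whiskerLeft K ((S.latching δ).map f))
      (Functor.whiskerLeft K ((S.fromLatching δ).app A))).app d ≫ (S.latchingMap δ K f).app d =
        f.app (K.obj d) :=
  congr_app (show pushout.inr _ _ ≫ S.latchingMap δ K f = Functor.whiskerLeft K f from
    pushout.inr_desc _ _ _) d

end Latching

section ModelCategory

variable [ModelCategory M] {A B : C ⥤ M} {f : A ⟶ B}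

lemma weakEquivalence_matchingMap_iff [HasLimits M] (x : C)
    (hx : trivialFibrations M (((S.matching (S.deg x)).map f).app x)) :
    weakEquivalences M (S.matchingMap f x) ↔ weakEquivalences M (f.app x) := by
  rw [← matchingMap_snd (S := S) (f := f) x]
  have : weakEquivalences M (pullback.snd (((S.matching (S.deg x)).map f).app x)
      (((S.toMatching (S.deg x)).app B).app x)) :=
    ((trivialFibrations M).pullback_snd _ _ hx).2
  exact ((weakEquivalences M).postcomp_iff (W' := weakEquivalences M) _ _ this).symm

lemma weakEquivalence_latchingMap_app_iff [HasColimits M] (δ : Ordinal.{v}) {D : Type w}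
    [Category.{w'} D] (K : D ⥤ C) (d : D)
    (hd : trivialCofibrations M (((S.latching δ).map f).app (K.obj d))) :
    weakEquivalences M ((S.latchingMap δ K f).app d) ↔
      weakEquivalences M (f.app (K.obj d)) := by
  rw [← inr_latchingMap_app (S := S) δ K d]
  have h := (IsPushout.of_hasPushout (Functor.whiskerLeft K ((S.latching δ).map f))
    (Functor.whiskerLeft K ((S.fromLatching δ).app A))).map ((evaluation D M).obj d)
  exact ((weakEquivalences M).precomp_iff (W' := weakEquivalences M) _ _
    ((trivialCofibrations M).of_isPushout h.flip hd).2).symm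

variable [HasLimits M] [HasColimits M] (hS : S.IsAlmostCReedy)

include hS

lemma IsAlmostCReedy.cReedyR_trivialFibrations :
    S.cReedyR (trivialFibrations M) =
      S.cReedyR (fibrations M) ⊓ (weakEquivalences M).functorCategory C := by
  refine le_antisymm (fun A B f hf => ?_) (fun A B f hf x => ?_)
  · refine ⟨cReedyR_mono (trivialFibrations_sub_fibrations M) f hf, fun x => ?_⟩
    exact (weakEquivalence_matchingMap_iff x (hS.matching_map_app_mem trivialFibrations_llp_rlp x
      fun y _ => hf y)).1 (hf x).2
  · obtain ⟨δ, hδ⟩ : ∃ δ, S.deg x = δ := ⟨_, rfl⟩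
    induction δ using WellFoundedLT.induction generalizing x with
    | ind δ ih =>
      subst hδ
      exact ⟨hf.1 x, (weakEquivalence_matchingMap_iff x (hS.matching_map_app_mem
        trivialFibrations_llp_rlp x fun y hy => ih _ hy y rfl)).2 (hf.2 x)⟩

lemma IsAlmostCReedy.trivialCofibrations_latching_map_app (x : C)
    (hf : ∀ δ < S.deg x, projectiveL (fibrations M) (S.Stratum δ) (S.stratumLatchingMap δ f)) :
    trivialCofibrations M (((S.latching (S.deg x)).map f).app x) := by
  rw [← MorphismProperty.llp_eq_of_wfs (trivialCofibrations M) (fibrations M)]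
  exact hS.latching_map_app_mem fibrations_llp_rlp x hf

variable (hM : ∀ δ : Ordinal.{v}, HasProjectiveModelStructure (S.Stratum δ) M)

include hM

lemma IsAlmostCReedy.cReedyL_fibrations :
    S.cReedyL (fibrations M) =
      S.cReedyL (trivialFibrations M) ⊓ (weakEquivalences M).functorCategory C := by
  refine le_antisymm (fun A B f hf => ?_) (fun A B f hf δ => ?_)
  · refine ⟨cReedyL_anti (trivialFibrations_sub_fibrations M) f hf, fun x => ?_⟩
    have h := hf (S.deg x)
    rw [← (hM _).acyclicProjectiveCofibrations_eq] at h
    exact (weakEquivalence_latchingMap_app_iff (S.deg x) (S.stratumι (S.deg x)) ⟨x, rfl⟩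
      (hS.trivialCofibrations_latching_map_app x fun γ _ => hf γ)).1 (h.2 ⟨x, rfl⟩)
  · induction δ using WellFoundedLT.induction with
    | ind δ ih =>
      rw [← (hM _).acyclicProjectiveCofibrations_eq]
      refine ⟨hf.1 δ, ?_⟩
      rintro ⟨x, rfl⟩
      exact (weakEquivalence_latchingMap_app_iff (S.deg x) (S.stratumι (S.deg x)) ⟨x, rfl⟩
        (hS.trivialCofibrations_latching_map_app x fun γ hγ => ih γ hγ)).2 (hf.2 x)

theorem IsAlmostCReedy.exists_modelCategory :
    ∃ _ : ModelCategory (C ⥤ M),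
      weakEquivalences (C ⥤ M) = (weakEquivalences M).functorCategory C ∧
      fibrations (C ⥤ M) = S.cReedyR (fibrations M) ∧
      trivialFibrations (C ⥤ M) = S.cReedyR (trivialFibrations M) ∧
      cofibrations (C ⥤ M) = S.cReedyL (trivialFibrations M) ∧
      trivialCofibrations (C ⥤ M) = S.cReedyL (fibrations M) := by
  have hT := hS.isBistratified.hasThroughDecomposition
  let _ : CategoryWithFibrations (C ⥤ M) := ⟨S.cReedyR (fibrations M)⟩
  let _ : CategoryWithCofibrations (C ⥤ M) := ⟨S.cReedyL (trivialFibrations M)⟩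
  let _ : CategoryWithWeakEquivalences (C ⥤ M) := ⟨(weakEquivalences M).functorCategory C⟩
  have hTF : trivialFibrations (C ⥤ M) = S.cReedyR (trivialFibrations M) :=
    hS.cReedyR_trivialFibrations.symm
  have hTC : trivialCofibrations (C ⥤ M) = S.cReedyL (fibrations M) :=
    (hS.cReedyL_fibrations hM).symm
  have : (weakEquivalences (C ⥤ M)).HasTwoOutOfThreeProperty :=
    { comp_mem f g hf hg x := (weakEquivalences M).comp_mem _ _ (hf x) (hg x)
      of_postcomp f g hg hfg x := (weakEquivalences M).of_postcomp _ _ (hg x) (hfg x)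
      of_precomp f g hf hfg x := (weakEquivalences M).of_precomp _ _ (hf x) (hfg x) }
  have : (cofibrations (C ⥤ M)).IsWeakFactorizationSystem (trivialFibrations (C ⥤ M)) := by
    rw [hTF]
    exact hT.isWeakFactorizationSystem trivialFibrations_llp_rlp
      fun δ _ _ => (hM δ).exists_factorization_trivialFibrations
  have : (trivialCofibrations (C ⥤ M)).IsWeakFactorizationSystem (fibrations (C ⥤ M)) := by
    rw [hTC]
    exact hT.isWeakFactorizationSystem fibrations_llp_rlp
      fun δ _ _ => (hM δ).exists_factorization_fibrations
  exact ⟨ModelCategory.mk' _, rfl, rfl, hTF, rfl, hTC⟩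

end ModelCategory

end Stratification

/-! ### Groupoid strata -/

namespace KanExtension

lemma ran_map_app_mem {C : Type v} [SmallCategory C] {D : Type w} [Category.{v} D]
    {ι : D ⥤ C} {M : Type u} [Category.{v} M] [∀ x, HasLimitsOfShape (StructuredArrow x ι) M]
    {R : MorphismProperty M} (hR : R.llp.rlp = R) {E B : D ⥤ M} (p : E ⟶ B)
    (hp : R.functorCategory D p) {x : C}
    (hx : IsEmpty (StructuredArrow x ι) ∨ HasInitial (StructuredArrow x ι)) :
    R ((ι.ran.map p).app x) := by
  have hlim (F : D ⥤ M) := ι.isPointwiseRightKanExtensionRanCounit F x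
  rw [← hR]
  obtain hx | hx := hx
  · have isTerminal (F : D ⥤ M) : IsTerminal ((ι.ran.obj F).obj x) :=
      .ofUniqueHom (fun T => (hlim F).lift ⟨T, { app := isEmptyElim, naturality := isEmptyElim }⟩)
        fun _ _ => (hlim F).hom_ext isEmptyElim
    have := isIso_of_isTerminal (isTerminal E) (isTerminal B) ((ι.ran.map p).app x)
    exact R.llp.rlp.of_isIso _
  · let g := ⊥_ (StructuredArrow x ι)
    have isIso_ranπ (F : D ⥤ M) : IsIso (ranπ ι F g.hom) := by
      have : IsIso (limit.π (StructuredArrow.proj x ι ⋙ F) g) :=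
        isIso_π_of_isInitial initialIsInitial _
      rw [ranπ, ← ι.ranObjObjIsoLimit_hom_π]
      exact IsIso.comp_isIso' inferInstance this
    have isPullback : IsPullback (ranπ ι E g.hom) ((ι.ran.map p).app x) (p.app g.right)
        (ranπ ι B g.hom) :=
      IsPullback.of_horiz_isIso ⟨(ran_map_app_ranπ p g.hom).symm⟩
    exact R.llp.rlp.of_isPullback isPullback (hR.symm ▸ hp g.right)

end KanExtension

lemma exists_isoClass_representatives (G : Type w) [Category.{w'} G] [IsGroupoid G] :
    ∃ (r : G → G) (_ : ∀ g, g ⟶ r g), ∀ {g g' : G}, (g ⟶ g') → r g = r g' := by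
  let s := isIsomorphicSetoid G
  exact ⟨fun g => (Quotient.mk s g).out, fun g => (Quotient.mk_out (s := s) g).some.inv,
    fun k => congrArg Quotient.out (Quotient.sound (s := s) ⟨asIso k⟩)⟩

lemma hasLiftingProperty_of_isGroupoid {G : Type w} [Category.{w'} G] [IsGroupoid G] {M : Type u}
    [Category.{v} M] {X Y E B : G ⥤ M} (φ : X ⟶ Y) (p : E ⟶ B)
    (h : ∀ (a : X ⟶ E) (b : Y ⟶ B), CommSq a φ p b → ∀ g : G, ∃ l : Y.obj g ⟶ E.obj g,
      (∀ e : g ⟶ g, Y.map e ≫ l = l ≫ E.map e) ∧ φ.app g ≫ l = a.app g ∧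
        l ≫ p.app g = b.app g) : HasLiftingProperty φ p := by
  refine ⟨fun {a b} sq => ?_⟩
  choose l hl hl₁ hl₂ using h a b sq
  -- Conjugating the lift at one representative of each isomorphism class makes it natural.
  obtain ⟨r, c, hr⟩ := exists_isoClass_representatives G
  have conj_naturality {g g' s s' : G} (hs : s = s') (c : g ⟶ s) (c' : g' ⟶ s') (k : g ⟶ g') :
      Y.map k ≫ Y.map c' ≫ l s' ≫ E.map (inv c') = (Y.map c ≫ l s ≫ E.map (inv c)) ≫ E.map k := by
    subst hs
    have hk : Y.map k ≫ Y.map c' = Y.map c ≫ Y.map (inv c ≫ k ≫ c') := by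
      rw [← Y.map_comp, ← Y.map_comp, IsIso.hom_inv_id_assoc]
    rw [← Category.assoc, hk, Category.assoc, reassoc_of% hl s (inv c ≫ k ≫ c'), ← E.map_comp]
    simp
  refine ⟨⟨{ app := fun g => Y.map (c g) ≫ l (r g) ≫ E.map (inv (c g))
             naturality := fun g g' k => conj_naturality (hr k) (c g) (c g') k }, ?_, ?_⟩⟩
  · ext g
    rw [NatTrans.comp_app, ← φ.naturality_assoc, reassoc_of% (hl₁ (r g)), ← a.naturality,
      ← X.map_comp_assoc, IsIso.hom_inv_id, X.map_id, Category.id_comp]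
  · ext g
    rw [NatTrans.comp_app, Category.assoc, Category.assoc, p.naturality,
      reassoc_of% (hl₂ (r g)), ← b.naturality, ← Y.map_comp_assoc, IsIso.hom_inv_id, Y.map_id,
      Category.id_comp]

lemma isEmpty_or_hasInitial_structuredArrow {G : Type w} [Category.{w'} G] [IsGroupoid G]
    {D : Type*} [Category* D] (F : D ⥤ G) [F.Full] [F.Faithful] (y : G) :
    IsEmpty (StructuredArrow y F) ∨ HasInitial (StructuredArrow y F) := by
  refine (isEmpty_or_nonempty _).imp id fun ⟨g⟩ => ?_
  refine IsInitial.hasInitial (X := g) (.ofUniqueHom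
    (fun g' => StructuredArrow.homMk (F.preimage (inv g.hom ≫ g'.hom))) fun g' k => ?_)
  ext
  exact F.map_injective (by simp)

namespace Stratification

variable {C : Type v} [SmallCategory C] {S : Stratification C} {M : Type u} [Category.{v} M]

section

variable (hS : S.HasThroughDecomposition)

include hS

lemma HasThroughDecomposition.inStratum_iso_hom {x y : C} (hxy : S.deg x = S.deg y) (e : x ≅ y) :
    S.inStratum e.hom := by
  by_contra he
  obtain ⟨z, g, h, hz, fac⟩ := hS.exists_fac e.hom hxy he
  refine hS.not_inStratum g (h ≫ e.inv) hz ?_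
  rw [← Category.assoc, fac, e.hom_inv_id]
  exact S.inStratum.id_mem x

variable {δ : Ordinal.{v}} (d : S.Stratum δ)

/-- The automorphism group of `d` in `C`, as a subcategory of the stratum. -/
def HasThroughDecomposition.autToStratum : SingleObj (Aut d.obj) ⥤ S.Stratum δ where
  obj _ := d
  map a := ⟨(autι d.obj).map a, hS.inStratum_iso_hom rfl (show Aut d.obj from a)⟩
  map_id a := Subtype.ext ((autι d.obj).map_id a)
  map_comp a b := Subtype.ext ((autι d.obj).map_comp a b)

instance : (hS.autToStratum d).Faithful where
  map_injective h := Iso.ext (congrArg Subtype.val h)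

instance [IsGroupoid (S.Stratum δ)] : (hS.autToStratum d).Full where
  map_surjective (e : d ⟶ d) := ⟨(S.stratumι δ).mapIso (asIso e), rfl⟩

end

lemma HasThroughDecomposition.hasLiftingProperty_latchingMap_autι_iff [HasColimits M]
    (hS : S.HasThroughDecomposition) {A B : C ⥤ M} (f : A ⟶ B) {δ : Ordinal.{v}}
    (d : S.Stratum δ) {X Y : SingleObj (Aut d.obj) ⥤ M} (p : X ⟶ Y) :
    HasLiftingProperty (S.latchingMap δ (autι d.obj) f) p ↔
      HasLiftingProperty (Functor.whiskerLeft (hS.autToStratum d) (S.stratumLatchingMap δ f)) p :=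
  (S.hasLiftingProperty_whiskerLeft_latchingMap_iff δ f (autι d.obj) (𝟭 _) p).trans
    (S.hasLiftingProperty_whiskerLeft_latchingMap_iff δ f (S.stratumι δ) (hS.autToStratum d)
      p).symm

lemma HasThroughDecomposition.projectiveL_stratumLatchingMap_iff [HasLimits M] [HasColimits M]
    (hS : S.HasThroughDecomposition) {R : MorphismProperty M} (hR : R.llp.rlp = R)
    {A B : C ⥤ M} (f : A ⟶ B) (δ : Ordinal.{v}) [IsGroupoid (S.Stratum δ)] :
    projectiveL R (S.Stratum δ) (S.stratumLatchingMap δ f) ↔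
      ∀ d : S.Stratum δ, projectiveL R _ (S.latchingMap δ (autι d.obj) f) := by
  refine ⟨fun h d X Y p hp => ?_, fun h X Y p hp => ?_⟩
  · rw [hS.hasLiftingProperty_latchingMap_autι_iff]
    refine (((hS.autToStratum d).ranAdjunction M).hasLiftingProperty_iff _ _).2 (h _ fun y => ?_)
    exact KanExtension.ran_map_app_mem hR p hp (isEmpty_or_hasInitial_structuredArrow _ y)
  · refine hasLiftingProperty_of_isGroupoid _ _ fun a b sq d => ?_
    let K := hS.autToStratum d
    have := (hS.hasLiftingProperty_latchingMap_autι_iff f d (Functor.whiskerLeft K p)).1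
      (h d _ fun _ => hp d)
    have sq' : CommSq (Functor.whiskerLeft K a) (Functor.whiskerLeft K (S.stratumLatchingMap δ f))
        (Functor.whiskerLeft K p) (Functor.whiskerLeft K b) :=
      sq.map ((Functor.whiskeringLeft _ _ M).obj K)
    refine ⟨sq'.lift.app (SingleObj.star _), fun e => ?_, congr_app sq'.fac_left _,
      congr_app sq'.fac_right _⟩
    obtain ⟨k, rfl⟩ : ∃ k : SingleObj.star (Aut d.obj) ⟶ SingleObj.star _, K.map k = e :=
      K.map_surjective e
    exact sq'.lift.naturality k

lemma HasThroughDecomposition.cReedyL_iff_of_isGroupoid [HasLimits M] [HasColimits M]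
    (hS : S.HasThroughDecomposition) (hG : ∀ δ, IsGroupoid (S.Stratum δ))
    {R : MorphismProperty M} (hR : R.llp.rlp = R) {A B : C ⥤ M} (f : A ⟶ B) :
    S.cReedyL R f ↔ ∀ x : C, projectiveL R _ (S.autLatchingMap x f) := by
  refine (forall_congr' fun δ => hS.projectiveL_stratumLatchingMap_iff hR f δ).trans
    ⟨fun h x => h _ ⟨x, rfl⟩, fun h δ => ?_⟩
  rintro ⟨x, rfl⟩
  exact h x

lemma IsAlmostGReedy.cReedyL_fibrations_iff [HasLimits M] [HasColimits M] [ModelCategory M]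
    (hS : S.IsAlmostGReedy)
    (hM : ∀ δ : Ordinal.{v}, HasProjectiveModelStructure (S.Stratum δ) M) {A B : C ⥤ M}
    (f : A ⟶ B) :
    S.cReedyL (fibrations M) f ↔
      ∀ x : C, acyclicProjectiveCofibrations (SingleObj (Aut x)) M (S.autLatchingMap x f) := by
  have hC := hS.toIsAlmostCReedy
  have cofibration_iff := hC.isBistratified.hasThroughDecomposition.cReedyL_iff_of_isGroupoid
    hS.isGroupoid (R := trivialFibrations M) trivialFibrations_llp_rlp f
  refine ⟨fun h x => ?_, fun h δ => ?_⟩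
  · obtain ⟨h_cof, h_weq⟩ := (hC.cReedyL_fibrations hM).le f h
    refine ⟨cofibration_iff.1 h_cof x, fun d => ?_⟩
    exact (weakEquivalence_latchingMap_app_iff (S.deg x) (autι x) d
      (hC.trivialCofibrations_latching_map_app x fun γ _ => h γ)).2 (h_weq x)
  · induction δ using WellFoundedLT.induction with
    | ind δ ih =>
      rw [← (hM _).acyclicProjectiveCofibrations_eq]
      refine ⟨cofibration_iff.2 (fun x => (h x).1) δ, ?_⟩
      rintro ⟨x, rfl⟩
      have hx := hC.trivialCofibrations_latching_map_app x ih
      have h_weq := (weakEquivalence_latchingMap_app_iff (S.deg x) (autι x) (SingleObj.star _)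
        hx).1 ((h x).2 _)
      exact (weakEquivalence_latchingMap_app_iff (S.deg x) (S.stratumι (S.deg x)) ⟨x, rfl⟩
        hx).2 h_weq

end Stratification

theorem mainTheorem8 {C : Type v} [SmallCategory C] (S : Stratification C)
    (hS : S.IsAlmostCReedy)
    {M : Type u} [Category.{v} M] [HasLimits M] [HasColimits M] [ModelCategory M]
    (hM : ∀ δ : Ordinal.{v}, HasProjectiveModelStructure (S.Stratum δ) M) :
    ∃ _ : ModelCategory (C ⥤ M),
      (∀ {A B : C ⥤ M} (f : A ⟶ B),
        (weakEquivalences (C ⥤ M) f ↔ ∀ x : C, weakEquivalences M (f.app x)) ∧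
        (fibrations (C ⥤ M) f ↔ ∀ x : C, fibrations M (S.matchingMap f x)) ∧
        (trivialFibrations (C ⥤ M) f ↔ ∀ x : C, trivialFibrations M (S.matchingMap f x)) ∧
        (cofibrations (C ⥤ M) f ↔ ∀ δ : Ordinal.{v},
          projectiveCofibrations (S.Stratum δ) M (S.stratumLatchingMap δ f)) ∧
        (trivialCofibrations (C ⥤ M) f ↔ ∀ δ : Ordinal.{v},
          acyclicProjectiveCofibrations (S.Stratum δ) M (S.stratumLatchingMap δ f))) ∧
      (S.IsAlmostGReedy → ∀ {A B : C ⥤ M} (f : A ⟶ B),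
        (cofibrations (C ⥤ M) f ↔ ∀ x : C,
          projectiveCofibrations (SingleObj (Aut x)) M (S.autLatchingMap x f)) ∧
        (trivialCofibrations (C ⥤ M) f ↔ ∀ x : C,
          acyclicProjectiveCofibrations (SingleObj (Aut x)) M (S.autLatchingMap x f))) := by
  obtain ⟨_, hW, hF, hTF, hC, hTC⟩ := hS.exists_modelCategory hM
  refine ⟨inferInstance, fun f => ⟨?_, ?_, ?_, ?_, ?_⟩, fun hG A B f => ⟨?_, ?_⟩⟩
  · rw [hW]; rfl
  · rw [hF]; rfl
  · rw [hTF]; rfl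
  · rw [hC]; rfl
  · rw [hTC]
    exact forall_congr' fun δ => by rw [(hM δ).acyclicProjectiveCofibrations_eq]
  · rw [hC]
    exact hS.isBistratified.hasThroughDecomposition.cReedyL_iff_of_isGroupoid hG.isGroupoid
      trivialFibrations_llp_rlp f
  · rw [hTC]
    exact hG.cReedyL_fibrations_iff hM f
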